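/- Work over $\mathbb{C}$ with complete convex bornological vector spaces; $\hat\otimes$ denotes the completed bornological tensor product (universal for bounded bilinear maps into complete spaces) and $M(A)$ the algebra of bounded two-sided multipliers of a bornological algebra $A$. A bornological algebra $H \neq 0$ (not necessarily unital) is essential if multiplication induces a bornological isomorphism $H \hat\otimes_H H \cong H$. A homomorphism $f : H \to M(K)$ is a bounded multiplicative linear map; it is essential if it induces bornological isomorphisms $H \hat\otimes_H K \cong K \cong K \hat\otimes_H H$. A bornological quantum group is an essential bornological algebra $H$ with the approximation property, together with a coassociative essential homomorphism $\Delta : H \to M(H \hat\otimes H)$ such that the four Galois maps $$\gamma_l(f \otimes g) = \Delta(f)(g \otimes 1),\quad \gamma_r(f \otimes g) = \Delta(f)(1 \otimes g),\quad \rho_l(f \otimes g) = (f \otimes 1)\Delta(g),\quad \rho_r(f \otimes g) = (1 \otimes f)\Delta(g)$$ are bornological isomorphisms of $H \hat\otimes H$ onto itself, and a faithful left invariant bounded linear functional $\phi : H \to \mathbb{C}$ (a left Haar functional). Here $\phi$ is faithful if $\phi(fg) = 0$ for all $g$ implies $f = 0$ and $\phi(fg) = 0$ for all $f$ implies $g =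 0$; a bounded linear functional $\phi$ is left invariant if $(\mathrm{id} \hat\otimes \phi)\Delta(f) = \phi(f) 1$ in $M(H)$ for all $f$, that is, $(\mathrm{id}\hat\otimes\phi)\gamma_l(f \otimes g) = \phi(f) g = (\mathrm{id}\hat\otimes\phi)\rho_l(g \otimes f)$ for all $f, g$; and $\psi$ is right invariant if $(\psi \hat\otimes \mathrm{id})\Delta(f) = \psi(f) 1$, that is, $(\psi\hat\otimes\mathrm{id})\gamma_r(f \otimes g) = \psi(f) g = (\psi\hat\otimes\mathrm{id})\rho_r(g \otimes f)$ for all $f, g$. Theorem. Let $H$ be a bornological quantum group with left Haar functional $\phi$. (1) The left Haar functional is unique up to a scalar: every left invariant bounded linear functional $\phi'$ on $H$ is of the form $\phi' = c\,\phi$ with $c \in \mathbb{C}$, and $c \neq 0$ if $\phi'$ is faithful. (2) If $\phi_1$ is any faithful left invariant functional and $\psi$ any faithful right invariant functional on $H$, then there is a bornological isomorphism (a linear bijection bounded in both directions) $\nu : H \to H$ with $\psi(hf) = \phi_1(h\,\nu(f))$ for all $f, h \in H$. -/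

import Mathlib

set_option linter.unusedSectionVars false
universe u

namespace BornQG

open Filter Topology Bornology Pointwise

section Spaces

variable {V : Type u} [AddCommGroup V] [Module ℂ V]

/-- A disk is a circled convex subset. -/
structure IsDisk (S : Set V) : Prop where
  balanced : Balanced ℂ S
  convex : Convex ℝ S

/-- A disk `S` is completant if its linear span, with the Minkowski functional of `S` as
semi-norm, is a Banach space. -/
structure IsCompletant (S : Set V) : Prop extends IsDisk S where
  eq_zero : ∀ x ∈ Submodule.span ℂ S, gauge S x = 0 → x = 0
  complete : ∀ x : ℕ → V, (∀ n, x n ∈ Submodule.span ℂ S) →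
    (∀ ε > 0, ∃ N, ∀ m ≥ N, ∀ n ≥ N, gauge S (x m - x n) < ε) →
    ∃ y ∈ Submodule.span ℂ S, Tendsto (fun n => gauge S (x n - y)) atTop (𝓝 0)

/-- A complete (convex) bornological vector space over `ℂ`; the small sets are the sets `S` with
`IsBounded S`. -/
class CompleteBornSpace (V : Type u) [AddCommGroup V] [Module ℂ V] [Bornology V] : Prop where
  isBounded_add : ∀ S T : Set V, IsBounded S → IsBounded T → IsBounded (S + T)
  isBounded_smul : ∀ (c : ℂ) (S : Set V), IsBounded S → IsBounded (c • S)
  isBounded_hull : ∀ S : Set V, IsBounded S → IsBounded (convexHull ℝ (balancedHull ℂ S))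
  exists_completant : ∀ S : Set V, IsBounded S → ∃ T, S ⊆ T ∧ IsBounded T ∧ IsCompletant T

theorem IsDisk.exists_mem_smul {S : Set V} (hS : IsDisk S) (hne : S.Nonempty) {x : V}
    (hx : x ∈ Submodule.span ℂ S) : ∃ r : ℝ, 0 < r ∧ x ∈ r • S := by
  induction hx using Submodule.span_induction with
  | mem x h => exact ⟨1, one_pos, by simpa using h⟩
  | zero =>
    obtain ⟨s, hs⟩ := hne
    refine ⟨1, one_pos, ?_⟩
    have := hS.balanced.smul_mem (a := (0 : ℂ)) (by simp) hs
    simpa using this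
  | add x y _ _ hx hy =>
    obtain ⟨r, hr, hx⟩ := hx
    obtain ⟨t, ht, hy⟩ := hy
    refine ⟨r + t, by positivity, ?_⟩
    rw [hS.convex.add_smul hr.le ht.le]
    exact Set.add_mem_add hx hy
  | smul c x _ hx =>
    obtain ⟨r, hr, s, hs, rfl⟩ := hx
    have h1 : (0 : ℝ) < ‖c‖ + 1 := by positivity
    refine ⟨(‖c‖ + 1) * r, by positivity, (c / ((‖c‖ + 1 : ℝ) : ℂ)) • s,
      hS.balanced.smul_mem ?_ hs, ?_⟩
    · rw [norm_div, Complex.norm_real, Real.norm_of_nonneg h1.le, div_le_one h1]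
      linarith
    · have h2 : ((‖c‖ + 1 : ℝ) : ℂ) ≠ 0 := by exact_mod_cast h1.ne'
      simp only [← Complex.coe_smul, smul_smul]
      congr 1
      push_cast at h2 ⊢
      field_simp

theorem IsDisk.zero_mem {S : Set V} (hS : IsDisk S) (hne : S.Nonempty) : (0 : V) ∈ S := by
  obtain ⟨s, hs⟩ := hne
  have := hS.balanced.smul_mem (a := (0 : ℂ)) (by simp) hs
  simpa using this

theorem gauge_coe_span (S : Set V) (x : Submodule.span ℂ S) :
    gauge ((↑) ⁻¹' S : Set (Submodule.span ℂ S)) x = gauge S (x : V) := by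
  have hc : ∀ (r : ℝ) (z : Submodule.span ℂ S), ((r • z : Submodule.span ℂ S) : V) = r • (z : V) :=
    fun r z => rfl
  rw [gauge_def', gauge_def']
  simp only [Set.mem_preimage, hc]

theorem IsDisk.preimage_span {S : Set V} (hS : IsDisk S) :
    IsDisk ((↑) ⁻¹' S : Set (Submodule.span ℂ S)) where
  balanced := by
    intro a ha y hy
    obtain ⟨z, hz, rfl⟩ := hy
    exact hS.balanced.smul_mem ha hz
  convex := by
    intro x hx y hy a b ha hb hab
    exact hS.convex hx hy ha hb hab

theorem IsDisk.absorbent_span {S : Set V} (hS : IsDisk S) (hne : S.Nonempty) :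
    Absorbent ℝ ((↑) ⁻¹' S : Set (Submodule.span ℂ S)) := by
  rintro ⟨x, hx⟩
  obtain ⟨r, hr, s, hs, rfl⟩ := hS.exists_mem_smul hne hx
  rw [absorbs_iff_norm]
  refine ⟨r, fun c hc => ?_⟩
  have hc0 : c ≠ 0 := by
    rintro rfl
    simp at hc
    linarith
  rintro _ rfl
  rw [Set.mem_smul_set_iff_inv_smul_mem₀ hc0]
  change c⁻¹ • (r • s) ∈ S
  rw [smul_smul, ← Complex.coe_smul]
  refine hS.balanced.smul_mem ?_ hs
  rw [Complex.norm_real, norm_mul, norm_inv, Real.norm_of_nonneg hr.le]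
  rw [inv_mul_le_iff₀ (by linarith)]
  linarith

theorem IsDisk.gauge_add_le {S : Set V} (hS : IsDisk S) (hne : S.Nonempty) {x y : V}
    (hx : x ∈ Submodule.span ℂ S) (hy : y ∈ Submodule.span ℂ S) :
    gauge S (x + y) ≤ gauge S x + gauge S y := by
  have h := _root_.gauge_add_le hS.preimage_span.convex (hS.absorbent_span hne)
    (⟨x, hx⟩ : Submodule.span ℂ S) ⟨y, hy⟩
  rw [gauge_coe_span, gauge_coe_span, gauge_coe_span] at h
  exact h

theorem IsDisk.gauge_smul {S : Set V} (hS : IsDisk S) (c : ℂ) (x : V) :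
    gauge S (c • x) = ‖c‖ * gauge S x := _root_.gauge_smul hS.balanced c x

theorem IsDisk.gauge_neg {S : Set V} (hS : IsDisk S) (x : V) :
    gauge S (-x) = gauge S x := by
  have := hS.gauge_smul (-1) x
  simpa using this

theorem IsDisk.mem_smul_of_gauge_lt {S : Set V} (hS : IsDisk S) (hne : S.Nonempty) {x : V}
    (hx : x ∈ Submodule.span ℂ S) {r : ℝ} (h : gauge S x < r) : x ∈ r • S := by
  rw [← gauge_coe_span S ⟨x, hx⟩] at h
  obtain ⟨b, hb, hbr, s, hs, hs'⟩ := exists_lt_of_gauge_lt (hS.absorbent_span hne) h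
  have h3 : x = b • (s : V) := congrArg Subtype.val hs'.symm
  have hr : 0 < r := hb.trans hbr
  rw [h3, Set.mem_smul_set_iff_inv_smul_mem₀ hr.ne', smul_smul, ← Complex.coe_smul]
  refine hS.balanced.smul_mem ?_ hs
  rw [Complex.norm_real, norm_mul, norm_inv, Real.norm_of_nonneg hr.le, Real.norm_of_nonneg hb.le,
    inv_mul_le_iff₀ hr]
  linarith

theorem mem_span_of_mem_smul {S : Set V} {x : V} {r : ℝ} (h : x ∈ r • S) :
    x ∈ Submodule.span ℂ S := by
  obtain ⟨s, hs, rfl⟩ := h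
  change r • s ∈ _
  rw [← Complex.coe_smul]
  exact Submodule.smul_mem _ _ (Submodule.subset_span hs)

theorem IsDisk.gauge_le_mul_of_subset {S T : Set V} (hS : IsDisk S) (hne : S.Nonempty)
    (h : S ⊆ T) {x : V} (hx : x ∈ Submodule.span ℂ S) : gauge T x ≤ gauge S x := by
  refine le_of_forall_pos_lt_add fun ε hε => ?_
  have h1 := hS.mem_smul_of_gauge_lt hne hx (r := gauge S x + ε / 2) (by linarith)
  have h2 := gauge_le_of_mem (a := gauge S x + ε / 2) (by have := gauge_nonneg (s := S) x; linarith)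
    (Set.smul_set_mono h h1)
  linarith

theorem CompleteBornSpace.isBounded_real_smul [Bornology V] [CompleteBornSpace V] (r : ℝ)
    {S : Set V} (h : IsBounded S) : IsBounded (r • S) := by
  have := CompleteBornSpace.isBounded_smul (r : ℂ) S h
  have h2 : r • S = (r : ℂ) • S := by
    ext x
    simp only [Set.mem_smul_set, Complex.coe_smul]
  rwa [h2]

/-- Absolutely convergent series in the Banach space spanned by a completant disk converge. -/
theorem IsCompletant.exists_sum {S : Set V} (hS : IsCompletant S) (hne : S.Nonempty) {ι : Type u}
    (a : ι → ℂ) (d : ι → V) (hd : ∀ i, a i ≠ 0 → d i ∈ S) (ha : Summable fun i => ‖a i‖) :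
    ∃ y ∈ Submodule.span ℂ S, gauge S y ≤ ∑' i, ‖a i‖ ∧
      Tendsto (fun s : Finset ι => gauge S ((∑ i ∈ s, a i • d i) - y)) atTop (𝓝 0) := by
  classical
  let N : AddGroupNorm (Submodule.span ℂ S) :=
    { toFun := fun x => gauge S (x : V)
      map_zero' := gauge_zero
      add_le' := fun x y => hS.toIsDisk.gauge_add_le hne x.2 y.2
      neg' := fun x => hS.toIsDisk.gauge_neg x
      eq_zero_of_map_eq_zero' := fun x hx => Subtype.ext (hS.eq_zero x x.2 hx) }
  let _ : NormedAddCommGroup (Submodule.span ℂ S) := N.toNormedAddCommGroup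
  have hN : ∀ x : Submodule.span ℂ S, ‖x‖ = gauge S (x : V) := fun x => rfl
  have : CompleteSpace (Submodule.span ℂ S) := by
    refine Metric.complete_of_cauchySeq_tendsto fun x hx => ?_
    rw [Metric.cauchySeq_iff] at hx
    obtain ⟨y, hy, hy'⟩ := hS.complete (fun n => (x n : V)) (fun n => (x n).2) (by
      intro ε hε
      obtain ⟨M, hM⟩ := hx ε hε
      refine ⟨M, fun m hm n hn => ?_⟩
      have := hM m hm n hn
      rwa [dist_eq_norm, hN] at this)
    refine ⟨⟨y, hy⟩, ?_⟩
    rw [tendsto_iff_norm_sub_tendsto_zero]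
    exact hy'
  have hmem : ∀ i, a i • d i ∈ Submodule.span ℂ S := fun i => by
    by_cases h : a i = 0
    · simp [h]
    · exact Submodule.smul_mem _ _ (Submodule.subset_span (hd i h))
  let f : ι → Submodule.span ℂ S := fun i => ⟨a i • d i, hmem i⟩
  have hf : ∀ i, ‖f i‖ ≤ ‖a i‖ := fun i => by
    rw [hN]
    change gauge S (a i • d i) ≤ _
    rw [hS.toIsDisk.gauge_smul]
    by_cases h : a i = 0
    · simp [h]
    · exact mul_le_of_le_one_right (norm_nonneg _) (gauge_le_one_of_mem (hd i h))
  have hsum : Summable f := Summable.of_norm_bounded ha hf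
  refine ⟨(∑' i, f i : Submodule.span ℂ S), Subtype.property _, ?_, ?_⟩
  · rw [← hN]
    exact tsum_of_norm_bounded ha.hasSum hf
  · have := hsum.hasSum
    rw [HasSum, tendsto_iff_norm_sub_tendsto_zero] at this
    simp only [SummationFilter.unconditional_filter] at this
    refine this.congr fun s => ?_
    rw [hN]
    simp [f]

/-- The image of an open ball of a Banach space under a linear map with closed kernel is
completant. -/
theorem isCompletant_image_ball {E : Type u} [NormedAddCommGroup E] [NormedSpace ℂ E]
    [CompleteSpace E] (f : E →ₗ[ℂ] V) (hf : IsClosed (LinearMap.ker f : Set E)) {r : ℝ}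
    (hr : 0 < r) : IsCompletant (f '' Metric.ball 0 r) := by
  have := hf
  let g : (E ⧸ LinearMap.ker f) →ₗ[ℂ] V := (LinearMap.ker f).liftQ f le_rfl
  have hg : Function.Injective g := by
    rw [← LinearMap.ker_eq_bot]
    exact Submodule.ker_liftQ_eq_bot _ _ _ le_rfl
  have hgr : ∀ (c : ℝ) z, g (c • z) = c • g z := fun c z => by
    rw [← Complex.coe_smul, map_smul, Complex.coe_smul]
  have himg : f '' Metric.ball 0 r = g '' Metric.ball 0 r := by
    ext y
    constructor
    · rintro ⟨x, hx, rfl⟩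
      refine ⟨Submodule.Quotient.mk x, ?_, rfl⟩
      rw [mem_ball_zero_iff] at hx ⊢
      exact (Submodule.Quotient.norm_mk_le _ x).trans_lt hx
    · rintro ⟨z, hz, rfl⟩
      rw [mem_ball_zero_iff] at hz
      obtain ⟨x, rfl, hx⟩ := Submodule.Quotient.norm_mk_lt z (sub_pos.2 hz)
      refine ⟨x, ?_, rfl⟩
      rw [mem_ball_zero_iff]
      linarith
  have hgauge : ∀ z, gauge (f '' Metric.ball 0 r) (g z) = ‖z‖ / r := fun z => by
    rw [himg, ← gauge_ball hr.le z, gauge_def', gauge_def']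
    simp only [← hgr, hg.mem_set_image]
  have hspan : ∀ y ∈ Submodule.span ℂ (f '' Metric.ball 0 r), ∃ z, g z = y := fun y hy => by
    have : Submodule.span ℂ (f '' Metric.ball 0 r) ≤ LinearMap.range g := by
      rw [Submodule.span_le, himg]
      rintro _ ⟨z, _, rfl⟩
      exact ⟨z, rfl⟩
    exact this hy
  have hspan' : ∀ z, g z ∈ Submodule.span ℂ (f '' Metric.ball 0 r) := fun z => by
    have h1 : (0 : ℝ) < r / (‖z‖ + 1) := by positivity
    have h2 : g ((r / (‖z‖ + 1)) • z) ∈ f '' Metric.ball 0 r := by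
      rw [himg]
      refine ⟨_, ?_, rfl⟩
      rw [mem_ball_zero_iff, norm_smul, Real.norm_of_nonneg h1.le, div_mul_eq_mul_div,
        div_lt_iff₀ (by positivity)]
      nlinarith [norm_nonneg z]
    have h3 : g z = (r / (‖z‖ + 1))⁻¹ • g ((r / (‖z‖ + 1)) • z) := by
      rw [← hgr, smul_smul, inv_mul_cancel₀ h1.ne', one_smul]
    rw [h3, ← Complex.coe_smul]
    exact Submodule.smul_mem _ _ (Submodule.subset_span h2)
  refine ⟨⟨?_, ?_⟩, ?_, ?_⟩
  · rintro c hc _ ⟨_, ⟨x, hx, rfl⟩, rfl⟩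
    refine ⟨c • x, ?_, map_smul f c x⟩
    rw [mem_ball_zero_iff] at hx ⊢
    rw [norm_smul]
    exact (mul_le_of_le_one_left (norm_nonneg _) hc).trans_lt hx
  · exact (convex_ball (0 : E) r).linear_image (f.restrictScalars ℝ)
  · intro y hy h0
    obtain ⟨z, rfl⟩ := hspan y hy
    rw [hgauge, div_eq_zero_iff, or_iff_left hr.ne', norm_eq_zero] at h0
    rw [h0, map_zero]
  · intro x hx hc
    choose z hz using fun n => hspan (x n) (hx n)
    have hcau : CauchySeq z := by
      rw [Metric.cauchySeq_iff]
      intro ε hε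
      obtain ⟨N, hN⟩ := hc (ε / r) (by positivity)
      refine ⟨N, fun m hm n hn => ?_⟩
      have := hN m hm n hn
      rw [← hz, ← hz, ← map_sub, hgauge] at this
      rw [dist_eq_norm]
      exact (div_lt_div_iff_of_pos_right hr).1 this
    obtain ⟨w, hw⟩ := cauchySeq_tendsto_of_complete hcau
    refine ⟨g w, hspan' w, ?_⟩
    rw [tendsto_iff_norm_sub_tendsto_zero] at hw
    have := hw.div_const r
    rw [zero_div] at this
    refine this.congr fun n => ?_
    rw [← hz, ← map_sub, hgauge]

end Spaces

section Maps

variable {V W X Y : Type u} [AddCommGroup V] [Module ℂ V] [Bornology V]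
  [AddCommGroup W] [Module ℂ W] [Bornology W] [AddCommGroup X] [Module ℂ X] [Bornology X]
  [AddCommGroup Y] [Module ℂ Y] [Bornology Y]

/-- A linear map is bounded if it maps small sets to small sets. -/
def BddLin {V W : Type*} [AddCommGroup V] [Module ℂ V] [Bornology V] [AddCommGroup W] [Module ℂ W]
    [Bornology W] (f : V →ₗ[ℂ] W) : Prop :=
  ∀ S : Set V, IsBounded S → IsBounded (f '' S)

/-- Bounded bilinear maps. -/
def BddBilin (b : V →ₗ[ℂ] W →ₗ[ℂ] X) : Prop :=
  ∀ (S : Set V) (T : Set W), IsBounded S → IsBounded T → IsBounded (Set.image2 (b · ·) S T)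

/-- A bornological isomorphism: a linear bijection which is bounded in both directions. -/
def IsBornIso (e : V ≃ₗ[ℂ] W) : Prop :=
  BddLin (e : V →ₗ[ℂ] W) ∧ BddLin (e.symm : W →ₗ[ℂ] V)

end Maps

section Tensor

variable (V W : Type u) [AddCommGroup V] [Module ℂ V] [Bornology V]
  [AddCommGroup W] [Module ℂ W] [Bornology W]

/-- Absolutely summable families of coefficients supported in a product of two small sets; such a
family `a` represents the convergent series `∑ a (v, w) • (v ⊗ w)`. -/
def seriesSubmodule : Submodule ℂ (V × W → ℂ) where
  carrier := {a | (Summable fun p => ‖a p‖) ∧ ∃ (S : Set V) (T : Set W), IsBounded S ∧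
    IsBounded T ∧ ∀ p, a p ≠ 0 → p ∈ S ×ˢ T}
  zero_mem' := ⟨by simp, ∅, ∅, isBounded_empty, isBounded_empty, by simp⟩
  add_mem' := by
    rintro a b ⟨ha, S, T, hS, hT, h⟩ ⟨hb, S', T', hS', hT', h'⟩
    refine ⟨(ha.add hb).of_nonneg_of_le (fun _ => norm_nonneg _) (fun p => norm_add_le _ _),
      S ∪ S', T ∪ T', hS.union hS', hT.union hT', fun p hp => ?_⟩
    by_cases h0 : a p = 0
    · have h1 : b p ≠ 0 := by
        rintro h1
        simp [h0, h1] at hp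
      exact ⟨Or.inr (h' p h1).1, Or.inr (h' p h1).2⟩
    · exact ⟨Or.inl (h p h0).1, Or.inl (h p h0).2⟩
  smul_mem' := by
    rintro c a ⟨ha, S, T, hS, hT, h⟩
    refine ⟨by simpa [norm_mul] using ha.mul_left ‖c‖, S, T, hS, hT, fun p hp => h p ?_⟩
    rintro h0
    simp [h0] at hp

/-- The space of all such series. -/
def Series : Type u := seriesSubmodule V W

instance : AddCommGroup (Series V W) := inferInstanceAs (AddCommGroup (seriesSubmodule V W))

instance : Module ℂ (Series V W) := inferInstanceAs (Module ℂ (seriesSubmodule V W))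

variable {V W}

/-- The `ℓ¹`-norm of the coefficients. -/
noncomputable def Series.norm (a : Series V W) : ℝ := ∑' p, ‖a.1 p‖

/-- The support condition `a (v, w) = 0` for `(v, w)` outside `S × T`. -/
def Series.SuppIn (a : Series V W) (S : Set V) (T : Set W) : Prop :=
  ∀ p, a.1 p ≠ 0 → p ∈ S ×ˢ T

/-- The series consisting of the single term `v ⊗ w`. -/
noncomputable def Series.single (p : V × W) : Series V W := by
  classical
  exact Subtype.mk (p := (· ∈ seriesSubmodule V W)) (Pi.single p 1) ⟨summable_of_ne_finset_zero (s := {p}) (fun q hq => by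
      rw [Finset.mem_singleton] at hq
      simp [hq]), {p.1}, {p.2}, isBounded_singleton, isBounded_singleton,
    fun q hq => by
      by_cases h : q = p
      · subst h
        simp
      · simp [h] at hq⟩

theorem Series.single_apply [DecidableEq (V × W)] (p q : V × W) :
    (Series.single p).1 q = if q = p then 1 else 0 := by
  unfold Series.single
  simp only [Pi.single_apply]
  congr

/-- A subspace of series which is closed under convergence inside the Banach spaces `ℓ¹(S × T)`
with `S`, `T` small. -/
def IsClosedSub (M : Submodule ℂ (Series V W)) : Prop :=
  ∀ (S : Set V) (T : Set W), IsBounded S → IsBounded T → ∀ (u : ℕ → Series V W) (a : Series V W),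
    (∀ n, u n ∈ M) → (∀ n, (u n).SuppIn S T) → a.SuppIn S T →
    Tendsto (fun n => (u n - a).norm) atTop (𝓝 0) → a ∈ M

/-- The bilinearity relations, and further relations `v ⊗ w = v' ⊗ w'` prescribed by `R`. -/
inductive Relator (R : Set ((V × W) × (V × W))) : Series V W → Prop
  | add_left (v v' : V) (w : W) :
      Relator R (.single (v + v', w) - .single (v, w) - .single (v', w))
  | add_right (v : V) (w w' : W) :
      Relator R (.single (v, w + w') - .single (v, w) - .single (v, w'))
  | smul_left (c : ℂ) (v : V) (w : W) :
      Relator R (.single (c • v, w) - c • .single (v, w))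
  | smul_right (c : ℂ) (v : V) (w : W) :
      Relator R (.single (v, c • w) - c • .single (v, w))
  | rel (p q : V × W) : (p, q) ∈ R → Relator R (.single p - .single q)

/-- The smallest closed subspace containing the relations. -/
def relators (R : Set ((V × W) × (V × W))) : Submodule ℂ (Series V W) :=
  sInf {M | IsClosedSub M ∧ ∀ a, Relator R a → a ∈ M}

variable (V W) in
/-- The completed bornological tensor product of `V` and `W` modulo the closed subspace generated
by the relations in `R`. Its elements are the series `∑ aₙ • (vₙ ⊗ wₙ)` with `(aₙ)` absolutely
summable and with `(vₙ)`, `(wₙ)` contained in small sets. -/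
def BTensor (R : Set ((V × W) × (V × W))) : Type u := Series V W ⧸ relators R

variable (V W) in
/-- The completed bornological tensor product. -/
abbrev CTensor : Type u := BTensor V W ∅

variable {R : Set ((V × W) × (V × W))}

noncomputable instance : AddCommGroup (BTensor V W R) :=
  inferInstanceAs (AddCommGroup (Series V W ⧸ relators R))

noncomputable instance : Module ℂ (BTensor V W R) :=
  inferInstanceAs (Module ℂ (Series V W ⧸ relators R))

variable (R) in
noncomputable def BTensor.mk : Series V W →ₗ[ℂ] BTensor V W R := (relators R).mkQ

variable (V W) in
/-- The closed ball of radius `C` in `ℓ¹(S × T)`. -/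
def Series.ball (S : Set V) (T : Set W) (C : ℝ) : Set (Series V W) :=
  {a | a.SuppIn S T ∧ a.norm ≤ C}

theorem Series.summable (a : Series V W) : Summable fun p => ‖a.1 p‖ := a.2.1

theorem Series.norm_add_le (a b : Series V W) : (a + b).norm ≤ a.norm + b.norm := by
  unfold Series.norm
  rw [← a.summable.tsum_add b.summable]
  exact (a + b).summable.tsum_le_tsum (fun p => _root_.norm_add_le _ _)
    (a.summable.add b.summable)

theorem Series.norm_smul (c : ℂ) (a : Series V W) : (c • a).norm = ‖c‖ * a.norm := by
  unfold Series.norm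
  rw [← tsum_mul_left]
  exact tsum_congr fun p => _root_.norm_smul c (a.1 p)

theorem Series.norm_nonneg (a : Series V W) : 0 ≤ a.norm := tsum_nonneg fun _ => _root_.norm_nonneg _

theorem Series.SuppIn.mono {a : Series V W} {S S' : Set V} {T T' : Set W} (h : a.SuppIn S T)
    (hS : S ⊆ S') (hT : T ⊆ T') : a.SuppIn S' T' :=
  fun p hp => ⟨hS (h p hp).1, hT (h p hp).2⟩

theorem Series.SuppIn.add {a b : Series V W} {S : Set V} {T : Set W} (h : a.SuppIn S T)
    (h' : b.SuppIn S T) : (a + b).SuppIn S T := fun p hp => by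
  by_cases h0 : a.1 p = 0
  · refine h' p fun h1 => hp ?_
    change a.1 p + b.1 p = 0
    rw [h0, h1, add_zero]
  · exact h p h0

theorem Series.SuppIn.smul {a : Series V W} {S : Set V} {T : Set W} (c : ℂ) (h : a.SuppIn S T) :
    (c • a).SuppIn S T := fun p hp => h p fun h0 => hp (by
  change c • a.1 p = 0
  rw [h0, smul_zero])

theorem Series.SuppIn.sub {a b : Series V W} {S : Set V} {T : Set W} (h : a.SuppIn S T)
    (h' : b.SuppIn S T) : (a - b).SuppIn S T := by
  have := h.add (h'.smul (-1))
  rwa [neg_one_smul, ← sub_eq_add_neg] at this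

theorem Series.exists_suppIn (a : Series V W) :
    ∃ (S : Set V) (T : Set W), IsBounded S ∧ IsBounded T ∧ a.SuppIn S T := a.2.2

theorem Series.single_suppIn {v : V} {w : W} {S : Set V} {T : Set W} (hv : v ∈ S) (hw : w ∈ T) :
    (Series.single (v, w)).SuppIn S T := by
  classical
  intro p hp
  rw [Series.single_apply] at hp
  have : p = (v, w) := by
    by_contra h
    simp [h] at hp
  subst this
  exact ⟨hv, hw⟩

theorem Series.single_norm (p : V × W) : (Series.single p).norm = 1 := by
  classical
  unfold Series.norm
  rw [tsum_eq_single p]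
  · simp [Series.single_apply]
  · intro q hq
    simp [Series.single_apply, hq]

theorem Series.ball_mono {S S' : Set V} {T T' : Set W} {C C' : ℝ} (hS : S ⊆ S') (hT : T ⊆ T')
    (hC : C ≤ C') : Series.ball V W S T C ⊆ Series.ball V W S' T' C' :=
  fun _ h => ⟨h.1.mono hS hT, h.2.trans hC⟩

/-- A subset of the tensor product is small if it is contained in the image of a ball of
`ℓ¹(S × T)` for some small sets `S`, `T`. -/
instance : Bornology (BTensor V W R) :=
  Bornology.ofBounded {B | ∃ (S : Set V) (T : Set W) (C : ℝ), IsBounded S ∧ IsBounded T ∧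
      B ⊆ BTensor.mk R '' Series.ball V W S T C}
    ⟨∅, ∅, 0, isBounded_empty, isBounded_empty, Set.empty_subset _⟩
    (by
      rintro B ⟨S, T, C, hS, hT, h⟩ B' h'
      exact ⟨S, T, C, hS, hT, h'.trans h⟩)
    (by
      rintro B ⟨S, T, C, hS, hT, h⟩ B' ⟨S', T', C', hS', hT', h'⟩
      refine ⟨S ∪ S', T ∪ T', max C C', hS.union hS', hT.union hT', Set.union_subset
        (h.trans (Set.image_mono (Series.ball_mono ?_ ?_ ?_)))
        (h'.trans (Set.image_mono (Series.ball_mono ?_ ?_ ?_)))⟩ <;> simp)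
    (by
      intro x
      obtain ⟨a, rfl⟩ := (relators R).mkQ_surjective x
      obtain ⟨S, T, hS, hT, h⟩ := a.exists_suppIn
      exact ⟨S, T, a.norm, hS, hT, by
        rintro _ rfl
        exact ⟨a, ⟨h, le_rfl⟩, rfl⟩⟩)

theorem BTensor.isBounded_iff {B : Set (BTensor V W R)} :
    IsBounded B ↔ ∃ (S : Set V) (T : Set W) (C : ℝ), IsBounded S ∧ IsBounded T ∧
      B ⊆ BTensor.mk R '' Series.ball V W S T C := by
  exact Bornology.isBounded_ofBounded_iff _

theorem isClosedSub_relators : IsClosedSub (relators R) := by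
  intro S T hS hT u a hu hus has hlim
  rw [relators, Submodule.mem_sInf]
  intro M hM
  exact hM.1 S T hS hT u a (fun n => (Submodule.mem_sInf.1 (hu n)) M hM) hus has hlim

theorem Relator.mem {a : Series V W} (h : Relator R a) : a ∈ relators R := by
  rw [relators, Submodule.mem_sInf]
  exact fun M hM => hM.2 a h

theorem relators_le {M : Submodule ℂ (Series V W)} (hM : IsClosedSub M)
    (h : ∀ a, Relator R a → a ∈ M) : relators R ≤ M := sInf_le ⟨hM, h⟩

theorem BTensor.mk_eq_zero {a : Series V W} : BTensor.mk R a = 0 ↔ a ∈ relators R :=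
  Submodule.Quotient.mk_eq_zero _

theorem BTensor.mk_surjective : Function.Surjective (BTensor.mk (V := V) (W := W) R) :=
  (relators R).mkQ_surjective

variable (R) in
/-- The canonical bilinear map `(v, w) ↦ v ⊗ w`. -/
noncomputable def BTensor.tmul : V →ₗ[ℂ] W →ₗ[ℂ] BTensor V W R :=
  LinearMap.mk₂ ℂ (fun v w => BTensor.mk R (.single (v, w)))
    (fun v v' w => by
      rw [← sub_eq_zero, ← sub_sub, ← map_sub, ← map_sub, BTensor.mk_eq_zero]
      exact (Relator.add_left v v' w).mem)
    (fun c v w => by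
      rw [← sub_eq_zero, ← map_smul, ← map_sub, BTensor.mk_eq_zero]
      exact (Relator.smul_left c v w).mem)
    (fun v w w' => by
      rw [← sub_eq_zero, ← sub_sub, ← map_sub, ← map_sub, BTensor.mk_eq_zero]
      exact (Relator.add_right v w w').mem)
    (fun c v w => by
      rw [← sub_eq_zero, ← map_smul, ← map_sub, BTensor.mk_eq_zero]
      exact (Relator.smul_right c v w).mem)

theorem BTensor.tmul_def (v : V) (w : W) :
    BTensor.tmul R v w = BTensor.mk R (.single (v, w)) := rfl

theorem BTensor.bddBilin_tmul : BddBilin (BTensor.tmul (V := V) (W := W) R) := by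
  intro S T hS hT
  refine BTensor.isBounded_iff.2 ⟨S, T, 1, hS, hT, ?_⟩
  rintro _ ⟨v, hv, w, hw, rfl⟩
  exact ⟨_, ⟨Series.single_suppIn hv hw, (Series.single_norm _).le⟩, rfl⟩

theorem BTensor.tmul_rel {p q : V × W} (h : (p, q) ∈ R) :
    BTensor.tmul R p.1 p.2 = BTensor.tmul R q.1 q.2 := by
  rw [← sub_eq_zero, BTensor.tmul_def, BTensor.tmul_def, ← map_sub, BTensor.mk_eq_zero]
  exact (Relator.rel p q h).mem

/-- The closed subspace of `ℓ¹(V × W)` of families supported in `S × T`. -/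
def ellOne (S : Set V) (T : Set W) : Submodule ℂ (lp (fun _ : V × W => ℂ) 1) where
  carrier := {a | ∀ p, p ∉ S ×ˢ T → a p = 0}
  zero_mem' := fun _ _ => rfl
  add_mem' := by
    intro a b ha hb p hp
    rw [lp.coeFn_add, Pi.add_apply, ha p hp, hb p hp, add_zero]
  smul_mem' := by
    intro c a ha p hp
    rw [lp.coeFn_smul, Pi.smul_apply, ha p hp, smul_zero]

theorem isClosed_ellOne (S : Set V) (T : Set W) :
    IsClosed (ellOne S T : Set (lp (fun _ : V × W => ℂ) 1)) := by
  have : (ellOne S T : Set (lp (fun _ : V × W => ℂ) 1)) =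
      ⋂ p : V × W, ⋂ _ : p ∉ S ×ˢ T, {a | a p = 0} := by
    ext a
    simp only [Set.mem_iInter]
    rfl
  rw [this]
  refine isClosed_iInter fun p => isClosed_iInter fun _ => ?_
  refine isClosed_eq ?_ continuous_const
  have h1 : LipschitzWith 1 fun a : lp (fun _ : V × W => ℂ) 1 => a p := by
    refine LipschitzWith.of_dist_le_mul fun a b => ?_
    rw [dist_eq_norm, dist_eq_norm, NNReal.coe_one, one_mul]
    exact lp.norm_apply_le_norm one_ne_zero (a - b) p
  exact h1.continuous

/-- Elements of `ℓ¹(S × T)` as series. -/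
noncomputable def ofEllOne {S : Set V} {T : Set W} (hS : IsBounded S) (hT : IsBounded T) :
    ellOne S T →ₗ[ℂ] Series V W where
  toFun a := Subtype.mk (p := (· ∈ seriesSubmodule V W)) (fun p => a.1 p) ⟨by
    have := (memℓp_gen_iff (p := 1) (by simp)).1 (lp.memℓp a.1)
    simpa using this, S, T, hS, hT, fun p hp => by
      by_contra h
      exact hp (a.2 p h)⟩
  map_add' _ _ := rfl
  map_smul' _ _ := rfl

theorem norm_ofEllOne {S : Set V} {T : Set W} (hS : IsBounded S) (hT : IsBounded T)
    (a : ellOne S T) : (ofEllOne hS hT a).norm = ‖a‖ := by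
  have : ‖a‖ = ‖a.1‖ := rfl
  rw [this, lp.norm_eq_tsum_rpow (by simp)]
  simp only [ENNReal.toReal_one, Real.rpow_one, div_one]
  rfl

theorem suppIn_ofEllOne {S : Set V} {T : Set W} (hS : IsBounded S) (hT : IsBounded T)
    (a : ellOne S T) : (ofEllOne hS hT a).SuppIn S T := fun p hp => by
  by_contra h
  exact hp (a.2 p h)

theorem exists_ofEllOne {S : Set V} {T : Set W} (hS : IsBounded S) (hT : IsBounded T)
    (a : Series V W) (h : a.SuppIn S T) : ∃ x, ofEllOne hS hT x = a := by
  refine ⟨⟨⟨a.1, ?_⟩, fun p hp => ?_⟩, rfl⟩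
  · exact memℓp_gen (by simpa using a.summable)
  · by_contra h0
    exact hp (h p h0)

theorem isCompletant_mk_image {S : Set V} {T : Set W} (hS : IsBounded S) (hT : IsBounded T)
    {r : ℝ} (hr : 0 < r) :
    IsCompletant ((BTensor.mk R ∘ₗ ofEllOne hS hT) '' Metric.ball 0 r) := by
  have : IsClosed (ellOne S T : Set (lp (fun _ : V × W => ℂ) 1)) := isClosed_ellOne S T
  have : CompleteSpace (ellOne S T) := this.completeSpace_coe
  refine isCompletant_image_ball _ ?_ hr
  rw [← isSeqClosed_iff_isClosed]
  intro u a hu hlim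
  have hu' : ∀ n, ofEllOne hS hT (u n) ∈ relators R := fun n => BTensor.mk_eq_zero.1 (hu n)
  refine BTensor.mk_eq_zero.2 (isClosedSub_relators S T hS hT _ _ hu'
    (fun n => suppIn_ofEllOne hS hT _) (suppIn_ofEllOne hS hT _) ?_)
  rw [tendsto_iff_norm_sub_tendsto_zero] at hlim
  refine hlim.congr fun n => ?_
  rw [← map_sub, norm_ofEllOne]

theorem Series.isDisk_ball (S : Set V) (T : Set W) (C : ℝ) : IsDisk (Series.ball V W S T C) where
  balanced := by
    rintro c hc _ ⟨a, ha, rfl⟩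
    refine ⟨ha.1.smul c, ?_⟩
    change (c • a).norm ≤ C
    rw [Series.norm_smul]
    exact (mul_le_of_le_one_left a.norm_nonneg hc).trans ha.2
  convex := by
    intro a ha b hb s t hs ht hst
    have h1 : ∀ (r : ℝ) (c : Series V W), r • c = (r : ℂ) • c := fun r c =>
      (Complex.coe_smul r c).symm
    rw [h1, h1]
    refine ⟨(ha.1.smul _).add (hb.1.smul _), (Series.norm_add_le _ _).trans ?_⟩
    rw [Series.norm_smul, Series.norm_smul, Complex.norm_real, Complex.norm_real,
      Real.norm_of_nonneg hs, Real.norm_of_nonneg ht]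
    calc s * a.norm + t * b.norm ≤ s * C + t * C := by
          gcongr
          exacts [ha.2, hb.2]
      _ = C := by rw [← add_mul, hst, one_mul]

theorem IsDisk.image {X Y : Type u} [AddCommGroup X] [Module ℂ X] [AddCommGroup Y] [Module ℂ Y]
    {S : Set X} (hS : IsDisk S) (f : X →ₗ[ℂ] Y) : IsDisk (f '' S) where
  balanced := by
    rintro c hc _ ⟨_, ⟨x, hx, rfl⟩, rfl⟩
    exact ⟨c • x, hS.balanced.smul_mem hc hx, map_smul f c x⟩
  convex := hS.convex.linear_image (f.restrictScalars ℝ)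

instance : CompleteBornSpace (BTensor V W R) where
  isBounded_add B B' hB hB' := by
    obtain ⟨S, T, C, hS, hT, h⟩ := BTensor.isBounded_iff.1 hB
    obtain ⟨S', T', C', hS', hT', h'⟩ := BTensor.isBounded_iff.1 hB'
    refine BTensor.isBounded_iff.2 ⟨S ∪ S', T ∪ T', C + C', hS.union hS', hT.union hT', ?_⟩
    rintro _ ⟨x, hx, y, hy, rfl⟩
    obtain ⟨a, ha, rfl⟩ := h hx
    obtain ⟨b, hb, rfl⟩ := h' hy
    refine ⟨a + b, ⟨(ha.1.mono ?_ ?_).add (hb.1.mono ?_ ?_),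
      (Series.norm_add_le _ _).trans (add_le_add ha.2 hb.2)⟩, map_add _ _ _⟩ <;> simp
  isBounded_smul c B hB := by
    obtain ⟨S, T, C, hS, hT, h⟩ := BTensor.isBounded_iff.1 hB
    refine BTensor.isBounded_iff.2 ⟨S, T, ‖c‖ * C, hS, hT, ?_⟩
    rintro _ ⟨x, hx, rfl⟩
    obtain ⟨a, ha, rfl⟩ := h hx
    refine ⟨c • a, ⟨ha.1.smul c, ?_⟩, map_smul _ _ _⟩
    rw [Series.norm_smul]
    exact mul_le_mul_of_nonneg_left ha.2 (norm_nonneg c)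
  isBounded_hull B hB := by
    obtain ⟨S, T, C, hS, hT, h⟩ := BTensor.isBounded_iff.1 hB
    have hd := (Series.isDisk_ball S T C).image (BTensor.mk R)
    exact BTensor.isBounded_iff.2 ⟨S, T, C, hS, hT,
      convexHull_min (hd.balanced.balancedHull_subset_of_subset h) hd.convex⟩
  exists_completant B hB := by
    obtain ⟨S, T, C, hS, hT, h⟩ := BTensor.isBounded_iff.1 hB
    have hr : 0 < |C| + 1 := by positivity
    refine ⟨_, ?_, ?_, isCompletant_mk_image (R := R) hS hT hr⟩
    · intro x hx
      obtain ⟨a, ha, rfl⟩ := h hx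
      obtain ⟨y, rfl⟩ := exists_ofEllOne hS hT a ha.1
      refine ⟨y, ?_, rfl⟩
      rw [mem_ball_zero_iff, ← norm_ofEllOne hS hT]
      linarith [ha.2, le_abs_self C]
    · refine BTensor.isBounded_iff.2 ⟨S, T, |C| + 1, hS, hT, ?_⟩
      rintro _ ⟨y, hy, rfl⟩
      refine ⟨ofEllOne hS hT y, ⟨suppIn_ofEllOne hS hT y, ?_⟩, rfl⟩
      rw [norm_ofEllOne]
      exact (mem_ball_zero_iff.1 hy).le

end Tensor

section Lift

variable {V W X : Type u} [AddCommGroup V] [Module ℂ V] [Bornology V]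
  [AddCommGroup W] [Module ℂ W] [Bornology W] [AddCommGroup X] [Module ℂ X] [Bornology X]

/-- The series `∑ a (v, w) • b v w` converges to `x` in the Banach space spanned by some small
completant disk of `X`. -/
def SeriesSum (b : V →ₗ[ℂ] W →ₗ[ℂ] X) (a : Series V W) (x : X) : Prop :=
  ∃ D : Set X, IsBounded D ∧ D.Nonempty ∧ IsCompletant D ∧ x ∈ Submodule.span ℂ D ∧
    (∀ p, a.1 p ≠ 0 → b p.1 p.2 ∈ Submodule.span ℂ D) ∧
    Tendsto (fun s : Finset (V × W) => gauge D ((∑ p ∈ s, a.1 p • b p.1 p.2) - x)) atTop (𝓝 0)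

theorem sum_mem_span {b : V →ₗ[ℂ] W →ₗ[ℂ] X} {a : Series V W} {D : Set X}
    (h : ∀ p, a.1 p ≠ 0 → b p.1 p.2 ∈ Submodule.span ℂ D) (s : Finset (V × W)) :
    ∑ p ∈ s, a.1 p • b p.1 p.2 ∈ Submodule.span ℂ D :=
  Submodule.sum_mem _ fun p _ => by
    by_cases h0 : a.1 p = 0
    · simp [h0]
    · exact Submodule.smul_mem _ _ (h p h0)

variable [CompleteBornSpace X]

theorem CompleteBornSpace.exists_completant' {S : Set X} (hS : IsBounded S) :
    ∃ T, S ⊆ T ∧ T.Nonempty ∧ IsBounded T ∧ IsCompletant T := by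
  obtain ⟨T, h1, h2, h3⟩ := CompleteBornSpace.exists_completant (S ∪ {0})
    (hS.union isBounded_singleton)
  exact ⟨T, Set.subset_union_left.trans h1, ⟨0, h1 (by simp)⟩, h2, h3⟩

theorem SeriesSum.mono {b : V →ₗ[ℂ] W →ₗ[ℂ] X} {a : Series V W} {x : X} {D D' : Set X}
    (hD : D.Nonempty) (hDc : IsCompletant D) (hDD : D ⊆ D')
    (hx : x ∈ Submodule.span ℂ D) (h : ∀ p, a.1 p ≠ 0 → b p.1 p.2 ∈ Submodule.span ℂ D)
    (hl : Tendsto (fun s : Finset (V × W) => gauge D ((∑ p ∈ s, a.1 p • b p.1 p.2) - x)) atTop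
      (𝓝 0)) :
    Tendsto (fun s : Finset (V × W) => gauge D' ((∑ p ∈ s, a.1 p • b p.1 p.2) - x)) atTop
      (𝓝 0) :=
  squeeze_zero (fun _ => gauge_nonneg _) (fun s => hDc.toIsDisk.gauge_le_mul_of_subset hD hDD
    (Submodule.sub_mem _ (sum_mem_span h s) hx)) hl

theorem SeriesSum.unique {b : V →ₗ[ℂ] W →ₗ[ℂ] X} {a : Series V W} {x y : X}
    (hx : SeriesSum b a x) (hy : SeriesSum b a y) : x = y := by
  obtain ⟨D, hD, hDn, hDc, hxD, hb, hl⟩ := hx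
  obtain ⟨D', hD', hDn', hDc', hyD, hb', hl'⟩ := hy
  obtain ⟨E, hDE, hEn, hE, hEc⟩ := CompleteBornSpace.exists_completant' (hD.union hD')
  have h1 := Set.subset_union_left.trans hDE
  have h2 := Set.subset_union_right.trans hDE
  have m := SeriesSum.mono hDn hDc h1 hxD hb hl
  have m' := SeriesSum.mono hDn' hDc' h2 hyD hb' hl'
  have hxE := Submodule.span_mono (R := ℂ) h1 hxD
  have hyE := Submodule.span_mono (R := ℂ) h2 hyD
  rw [← sub_eq_zero]
  refine hEc.eq_zero _ (Submodule.sub_mem _ hxE hyE) ?_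
  refine le_antisymm ?_ (gauge_nonneg _)
  have := m.add m'
  rw [add_zero] at this
  refine ge_of_tendsto' this fun s => ?_
  have hs := Submodule.span_mono (R := ℂ) h1 (sum_mem_span hb s)
  have e : x - y = -((∑ p ∈ s, a.1 p • b p.1 p.2) - x) + ((∑ p ∈ s, a.1 p • b p.1 p.2) - y) := by
    abel
  rw [e]
  refine (hEc.toIsDisk.gauge_add_le hEn ?_ ?_).trans ?_
  · exact Submodule.neg_mem _ (Submodule.sub_mem _ hs hxE)
  · exact Submodule.sub_mem _ hs hyE
  · rw [hEc.toIsDisk.gauge_neg]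

theorem SeriesSum.exists_of_subset {b : V →ₗ[ℂ] W →ₗ[ℂ] X} {a : Series V W} {S : Set V}
    {T : Set W} (ha : a.SuppIn S T) {D : Set X} (hD : IsBounded D) (hDn : D.Nonempty)
    (hDc : IsCompletant D) (h : ∀ v ∈ S, ∀ w ∈ T, b v w ∈ D) :
    ∃ x, SeriesSum b a x ∧ x ∈ Submodule.span ℂ D ∧ gauge D x ≤ a.norm := by
  have h' : ∀ p, a.1 p ≠ 0 → b p.1 p.2 ∈ D := fun p hp => h _ (ha p hp).1 _ (ha p hp).2
  obtain ⟨y, hy, hy', hl⟩ := hDc.exists_sum hDn a.1 (fun p => b p.1 p.2) h' a.summable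
  exact ⟨y, ⟨D, hD, hDn, hDc, hy, fun p hp => Submodule.subset_span (h' p hp), hl⟩, hy, hy'⟩

theorem SeriesSum.exists {b : V →ₗ[ℂ] W →ₗ[ℂ] X} (hb : BddBilin b) (a : Series V W) :
    ∃ x, SeriesSum b a x := by
  obtain ⟨S, T, hS, hT, h⟩ := a.exists_suppIn
  obtain ⟨D, hD1, hD2, hD3, hD4⟩ := CompleteBornSpace.exists_completant' (hb S T hS hT)
  obtain ⟨x, hx, _⟩ := SeriesSum.exists_of_subset h hD3 hD2 hD4
    (fun v hv w hw => hD1 ⟨v, hv, w, hw, rfl⟩)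
  exact ⟨x, hx⟩

theorem SeriesSum.add {b : V →ₗ[ℂ] W →ₗ[ℂ] X} {a a' : Series V W} {x x' : X}
    (hx : SeriesSum b a x) (hx' : SeriesSum b a' x') : SeriesSum b (a + a') (x + x') := by
  obtain ⟨D, hD, hDn, hDc, hxD, hb, hl⟩ := hx
  obtain ⟨D', hD', hDn', hDc', hyD, hb', hl'⟩ := hx'
  obtain ⟨E, hDE, hEn, hE, hEc⟩ := CompleteBornSpace.exists_completant' (hD.union hD')
  have h1 := Set.subset_union_left.trans hDE
  have h2 := Set.subset_union_right.trans hDE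
  have m := SeriesSum.mono hDn hDc h1 hxD hb hl
  have m' := SeriesSum.mono hDn' hDc' h2 hyD hb' hl'
  have hxE := Submodule.span_mono (R := ℂ) h1 hxD
  have hyE := Submodule.span_mono (R := ℂ) h2 hyD
  refine ⟨E, hE, hEn, hEc, Submodule.add_mem _ hxE hyE, fun p hp => ?_, ?_⟩
  · by_cases h0 : a.1 p = 0
    · refine Submodule.span_mono (R := ℂ) h2 (hb' p fun h3 => hp ?_)
      change a.1 p + a'.1 p = 0
      rw [h0, h3, add_zero]
    · exact Submodule.span_mono (R := ℂ) h1 (hb p h0)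
  · have := m.add m'
    rw [add_zero] at this
    refine squeeze_zero (fun _ => gauge_nonneg _) (fun s => ?_) this
    have e : (∑ p ∈ s, (a + a').1 p • b p.1 p.2) - (x + x') =
        ((∑ p ∈ s, a.1 p • b p.1 p.2) - x) + ((∑ p ∈ s, a'.1 p • b p.1 p.2) - x') := by
      have : ∀ p, (a + a').1 p = a.1 p + a'.1 p := fun p => rfl
      simp only [this, add_smul, Finset.sum_add_distrib]
      abel
    rw [e]
    exact hEc.toIsDisk.gauge_add_le hEn
      (Submodule.sub_mem _ (Submodule.span_mono (R := ℂ) h1 (sum_mem_span hb s)) hxE)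
      (Submodule.sub_mem _ (Submodule.span_mono (R := ℂ) h2 (sum_mem_span hb' s)) hyE)

theorem SeriesSum.smul {b : V →ₗ[ℂ] W →ₗ[ℂ] X} {a : Series V W} {x : X} (c : ℂ)
    (hx : SeriesSum b a x) : SeriesSum b (c • a) (c • x) := by
  obtain ⟨D, hD, hDn, hDc, hxD, hb, hl⟩ := hx
  have e : ∀ p, (c • a).1 p = c * a.1 p := fun p => rfl
  refine ⟨D, hD, hDn, hDc, Submodule.smul_mem _ _ hxD, fun p hp => hb p fun h0 => hp ?_, ?_⟩
  · rw [e, h0, mul_zero]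
  · have := hl.const_mul ‖c‖
    rw [mul_zero] at this
    refine this.congr fun s => ?_
    rw [← hDc.toIsDisk.gauge_smul, smul_sub, Finset.smul_sum]
    simp only [e, mul_smul]

theorem SeriesSum.single (b : V →ₗ[ℂ] W →ₗ[ℂ] X) (p : V × W) :
    SeriesSum b (Series.single p) (b p.1 p.2) := by
  classical
  obtain ⟨D, hD1, hD2, hD3, hD4⟩ := CompleteBornSpace.exists_completant'
    (isBounded_singleton (x := b p.1 p.2))
  have hm := Submodule.subset_span (R := ℂ) (hD1 rfl)
  refine ⟨D, hD3, hD2, hD4, hm, fun q hq => ?_, ?_⟩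
  · rw [Series.single_apply] at hq
    have : q = p := by
      by_contra h
      simp [h] at hq
    rwa [this]
  · refine tendsto_const_nhds.congr' ?_
    filter_upwards [eventually_ge_atTop {p}] with s hs
    have hp : p ∈ s := hs (by simp)
    simp [Series.single_apply, Finset.sum_ite_eq', hp]

/-- Evaluation of series on a bounded bilinear map. -/
noncomputable def preLift (b : V →ₗ[ℂ] W →ₗ[ℂ] X) (hb : BddBilin b) : Series V W →ₗ[ℂ] X where
  toFun a := (SeriesSum.exists hb a).choose
  map_add' a a' := ((SeriesSum.exists hb (a + a')).choose_spec).unique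
    (((SeriesSum.exists hb a).choose_spec).add (SeriesSum.exists hb a').choose_spec)
  map_smul' c a := ((SeriesSum.exists hb (c • a)).choose_spec).unique
    (((SeriesSum.exists hb a).choose_spec).smul c)

theorem preLift_eq {b : V →ₗ[ℂ] W →ₗ[ℂ] X} (hb : BddBilin b) {a : Series V W} {x : X}
    (h : SeriesSum b a x) : preLift b hb a = x :=
  ((SeriesSum.exists hb a).choose_spec).unique h

theorem preLift_single {b : V →ₗ[ℂ] W →ₗ[ℂ] X} (hb : BddBilin b) (p : V × W) :
    preLift b hb (.single p) = b p.1 p.2 := preLift_eq hb (SeriesSum.single b p)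

theorem preLift_mem {b : V →ₗ[ℂ] W →ₗ[ℂ] X} (hb : BddBilin b) {a : Series V W} {S : Set V}
    {T : Set W} (ha : a.SuppIn S T) {D : Set X} (hD : IsBounded D) (hDn : D.Nonempty)
    (hDc : IsCompletant D) (h : ∀ v ∈ S, ∀ w ∈ T, b v w ∈ D) :
    preLift b hb a ∈ Submodule.span ℂ D ∧ gauge D (preLift b hb a) ≤ a.norm := by
  obtain ⟨x, hx, h1, h2⟩ := SeriesSum.exists_of_subset ha hD hDn hDc h
  rw [preLift_eq hb hx]
  exact ⟨h1, h2⟩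

/-- A linear map on series which maps the balls of `ℓ¹(S × T)` to small sets has closed kernel. -/
theorem isClosedSub_ker (f : Series V W →ₗ[ℂ] X) (hf : ∀ (S : Set V) (T : Set W), IsBounded S →
    IsBounded T → ∃ D : Set X, D.Nonempty ∧ IsCompletant D ∧
      ∀ a : Series V W, a.SuppIn S T → f a ∈ Submodule.span ℂ D ∧ gauge D (f a) ≤ a.norm) :
    IsClosedSub (LinearMap.ker f) := by
  intro S T hS hT u a hu hus has hlim
  obtain ⟨D, hDn, hDc, h⟩ := hf S T hS hT
  refine hDc.eq_zero _ (h a has).1 (le_antisymm ?_ (gauge_nonneg _))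
  refine ge_of_tendsto' hlim fun n => ?_
  have h1 := (h _ ((hus n).sub has)).2
  have h2 : f (u n) = 0 := hu n
  rwa [map_sub, h2, zero_sub, hDc.toIsDisk.gauge_neg] at h1

theorem isClosedSub_ker_preLift (b : V →ₗ[ℂ] W →ₗ[ℂ] X) (hb : BddBilin b) :
    IsClosedSub (LinearMap.ker (preLift b hb)) := by
  refine isClosedSub_ker _ fun S T hS hT => ?_
  obtain ⟨D, hD1, hD2, hD3, hD4⟩ := CompleteBornSpace.exists_completant' (hb S T hS hT)
  exact ⟨D, hD2, hD4, fun a ha => preLift_mem hb ha hD3 hD2 hD4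
    (fun v hv w hw => hD1 ⟨v, hv, w, hw, rfl⟩)⟩

variable {R : Set ((V × W) × (V × W))}

theorem relators_le_ker_preLift (b : V →ₗ[ℂ] W →ₗ[ℂ] X) (hb : BddBilin b)
    (hR : ∀ p q, (p, q) ∈ R → b p.1 p.2 = b q.1 q.2) :
    relators R ≤ LinearMap.ker (preLift b hb) := by
  refine relators_le (isClosedSub_ker_preLift b hb) fun a ha => ?_
  rw [LinearMap.mem_ker]
  cases ha with
  | rel p q h => simp [preLift_single, hR p q h]
  | _ => simp [preLift_single]

/-- The linear map on the tensor product induced by a bounded bilinear map compatible with the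
relations. -/
noncomputable def BTensor.lift (b : V →ₗ[ℂ] W →ₗ[ℂ] X) (hb : BddBilin b)
    (hR : ∀ p q, (p, q) ∈ R → b p.1 p.2 = b q.1 q.2) : BTensor V W R →ₗ[ℂ] X :=
  (relators R).liftQ (preLift b hb) (relators_le_ker_preLift b hb hR)

theorem BTensor.lift_mk {b : V →ₗ[ℂ] W →ₗ[ℂ] X} (hb : BddBilin b)
    (hR : ∀ p q, (p, q) ∈ R → b p.1 p.2 = b q.1 q.2) (a : Series V W) :
    BTensor.lift b hb hR (BTensor.mk R a) = preLift b hb a := rfl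

@[simp]
theorem BTensor.lift_tmul {b : V →ₗ[ℂ] W →ₗ[ℂ] X} (hb : BddBilin b)
    (hR : ∀ p q, (p, q) ∈ R → b p.1 p.2 = b q.1 q.2) (v : V) (w : W) :
    BTensor.lift b hb hR (BTensor.tmul R v w) = b v w :=
  preLift_single hb (v, w)

theorem BTensor.lift_mem {b : V →ₗ[ℂ] W →ₗ[ℂ] X} (hb : BddBilin b)
    (hR : ∀ p q, (p, q) ∈ R → b p.1 p.2 = b q.1 q.2) {S : Set V} {T : Set W} {C : ℝ}
    {D : Set X} (hD : IsBounded D) (hDn : D.Nonempty) (hDc : IsCompletant D)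
    (h : ∀ v ∈ S, ∀ w ∈ T, b v w ∈ D) {x : BTensor V W R}
    (hx : x ∈ BTensor.mk R '' Series.ball V W S T C) :
    BTensor.lift b hb hR x ∈ (C + 1) • D := by
  obtain ⟨a, ha, rfl⟩ := hx
  rw [BTensor.lift_mk]
  have := preLift_mem hb ha.1 hD hDn hDc h
  exact hDc.toIsDisk.mem_smul_of_gauge_lt hDn this.1 (by linarith [this.2, ha.2])

theorem BTensor.bddLin_lift {b : V →ₗ[ℂ] W →ₗ[ℂ] X} (hb : BddBilin b)
    (hR : ∀ p q, (p, q) ∈ R → b p.1 p.2 = b q.1 q.2) : BddLin (BTensor.lift b hb hR) := by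
  intro B hB
  obtain ⟨S, T, C, hS, hT, h⟩ := BTensor.isBounded_iff.1 hB
  obtain ⟨D, hD1, hD2, hD3, hD4⟩ := CompleteBornSpace.exists_completant' (hb S T hS hT)
  refine (CompleteBornSpace.isBounded_real_smul (C + 1) hD3).subset ?_
  rintro _ ⟨x, hx, rfl⟩
  exact BTensor.lift_mem hb hR hD3 hD2 hD4 (fun v hv w hw => hD1 ⟨v, hv, w, hw, rfl⟩) (h hx)

/-- The restriction of a series to a finite set of indices is a linear combination of single
terms, and these restrictions approximate the series. -/
theorem Series.exists_approx (a : Series V W) {S : Set V} {T : Set W} (ha : a.SuppIn S T) :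
    ∃ u : ℕ → Series V W, (∀ n, u n ∈ Submodule.span ℂ (Set.range Series.single)) ∧
      (∀ n, (u n).SuppIn S T) ∧ Tendsto (fun n => (u n - a).norm) atTop (𝓝 0) := by
  classical
  have key : ∀ s : Finset (V × W), ∀ q, (∑ p ∈ s, a.1 p • Series.single p : Series V W).1 q =
      if q ∈ s then a.1 q else 0 := by
    intro s q
    induction s using Finset.induction_on with
    | empty => rfl
    | insert p s hp ih =>
      rw [Finset.sum_insert hp]
      change a.1 p * (Series.single p).1 q + _ = _
      rw [ih, Series.single_apply]
      by_cases h1 : q = p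
      · subst h1
        simp [hp]
      · simp [h1]
  have hn : ∀ ε > 0, ∃ s : Finset (V × W),
      (∑ p ∈ s, a.1 p • Series.single p - a).norm < ε := by
    intro ε hε
    have h1 := a.summable.hasSum
    have h2 := (tendsto_order.1 h1).1 (∑' p, ‖a.1 p‖ - ε) (by linarith)
    obtain ⟨s, hs⟩ := h2.exists
    refine ⟨s, ?_⟩
    have h3 : (∑ p ∈ s, a.1 p • Series.single p - a).norm + ∑ p ∈ s, ‖a.1 p‖ = ∑' p, ‖a.1 p‖ := by
      have e1 : ∑ p ∈ s, ‖a.1 p‖ = ∑' p, if p ∈ s then ‖a.1 p‖ else 0 := by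
        rw [tsum_eq_sum (s := s)]
        · exact Finset.sum_congr rfl fun p hp => by simp [hp]
        · intro p hp
          simp [hp]
      rw [e1]
      unfold Series.norm
      rw [← Summable.tsum_add (Series.summable _)]
      · refine tsum_congr fun p => ?_
        change ‖(∑ p ∈ s, a.1 p • Series.single p : Series V W).1 p - a.1 p‖ + _ = _
        rw [key]
        by_cases hp : p ∈ s <;> simp [hp]
      · exact summable_of_ne_finset_zero (s := s) fun p hp => by simp [hp]
    linarith
  choose s hs using fun n : ℕ => hn (1 / ((n : ℝ) + 1)) (by positivity)
  refine ⟨fun n => ∑ p ∈ s n, a.1 p • Series.single p, fun n => ?_, fun n q hq => ?_, ?_⟩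
  · exact Submodule.sum_mem _ fun p _ => Submodule.smul_mem _ _ (Submodule.subset_span ⟨p, rfl⟩)
  · rw [key] at hq
    exact ha q fun h => hq (by simp [h])
  · exact squeeze_zero (fun n => Series.norm_nonneg _) (fun n => (hs n).le)
      tendsto_one_div_add_atTop_nhds_zero_nat

/-- Bounded linear maps on the tensor product are determined by their values on elementary
tensors. -/
theorem BTensor.ext {f g : BTensor V W R →ₗ[ℂ] X} (hf : BddLin f) (hg : BddLin g)
    (h : ∀ v w, f (BTensor.tmul R v w) = g (BTensor.tmul R v w)) : f = g := by
  have hcl : IsClosedSub (LinearMap.ker ((f - g) ∘ₗ BTensor.mk R)) := by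
    refine isClosedSub_ker _ fun S T hS hT => ?_
    have hB : IsBounded (BTensor.mk R '' Series.ball V W S T 1) :=
      BTensor.isBounded_iff.2 ⟨S, T, 1, hS, hT, subset_rfl⟩
    have hfg := CompleteBornSpace.isBounded_add _ _ (hf _ hB)
      (CompleteBornSpace.isBounded_smul (-1) _ (hg _ hB))
    obtain ⟨D, hD1, hD2, hD3, hD4⟩ := CompleteBornSpace.exists_completant' hfg
    have hD : ∀ a : Series V W, a.SuppIn S T → a.norm ≤ 1 → (f - g) (BTensor.mk R a) ∈ D := by
      intro a ha ha'
      refine hD1 ⟨_, ⟨_, ⟨a, ⟨ha, ha'⟩, rfl⟩, rfl⟩, _, ⟨_, ⟨_, ⟨a, ⟨ha, ha'⟩, rfl⟩, rfl⟩, rfl⟩, ?_⟩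
      simp [sub_eq_add_neg]
    have hr : ∀ a : Series V W, a.SuppIn S T → ∀ r : ℝ, a.norm < r →
        (f - g) (BTensor.mk R a) ∈ r • D := by
      intro a ha r hr
      have hr0 : 0 < r := a.norm_nonneg.trans_lt hr
      have hc : (r : ℂ) ≠ 0 := by exact_mod_cast hr0.ne'
      refine ⟨_, hD (((r : ℂ)⁻¹) • a) (ha.smul _) ?_, ?_⟩
      · rw [Series.norm_smul, norm_inv, Complex.norm_real, Real.norm_of_nonneg hr0.le,
          inv_mul_le_iff₀ hr0]
        linarith
      · change r • _ = _
        rw [map_smul, map_smul, ← Complex.coe_smul, smul_smul, mul_inv_cancel₀ hc, one_smul]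
    refine ⟨D, hD2, hD4, fun a ha => ⟨mem_span_of_mem_smul (hr a ha (a.norm + 1) (by linarith)),
      le_of_forall_pos_le_add fun ε hε => ?_⟩⟩
    exact gauge_le_of_mem (by linarith [a.norm_nonneg]) (hr a ha (a.norm + ε) (by linarith))
  have hs : Submodule.span ℂ (Set.range Series.single) ≤
      LinearMap.ker ((f - g) ∘ₗ BTensor.mk R) := by
    rw [Submodule.span_le]
    rintro _ ⟨p, rfl⟩
    have := h p.1 p.2
    rw [BTensor.tmul_def] at this
    simp [this]
  refine LinearMap.ext fun x => ?_
  obtain ⟨a, rfl⟩ := BTensor.mk_surjective x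
  obtain ⟨S, T, hS, hT, ha⟩ := a.exists_suppIn
  obtain ⟨u, hu, hus, hlim⟩ := a.exists_approx ha
  have := hcl S T hS hT u a (fun n => hs (hu n)) hus ha hlim
  simpa [sub_eq_zero] using this

end Lift

section Constructions

variable {A B C D P X : Type u} [AddCommGroup A] [Module ℂ A] [Bornology A]
  [AddCommGroup B] [Module ℂ B] [Bornology B] [AddCommGroup C] [Module ℂ C] [Bornology C]
  [AddCommGroup D] [Module ℂ D] [Bornology D] [AddCommGroup P] [Module ℂ P] [Bornology P]
  [AddCommGroup X] [Module ℂ X] [Bornology X]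

theorem BddLin.comp {f : A →ₗ[ℂ] B} {g : B →ₗ[ℂ] C} (hg : BddLin g) (hf : BddLin f) :
    BddLin (g ∘ₗ f) := fun S hS => by
  rw [LinearMap.coe_comp, Set.image_comp]
  exact hg _ (hf _ hS)

theorem BddLin.id : BddLin (LinearMap.id : A →ₗ[ℂ] A) := fun S hS => by simpa using hS

theorem BddBilin.left {b : A →ₗ[ℂ] B →ₗ[ℂ] X} (hb : BddBilin b) (x : A) : BddLin (b x) :=
  fun S hS => (hb {x} S isBounded_singleton hS).subset (by simp)

theorem BddBilin.right {b : A →ₗ[ℂ] B →ₗ[ℂ] X} (hb : BddBilin b) (y : B) : BddLin (b.flip y) :=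
  fun S hS => (hb S {y} hS isBounded_singleton).subset (by
    rintro _ ⟨x, hx, rfl⟩
    exact ⟨x, hx, y, rfl, rfl⟩)

theorem BddBilin.compl {b : A →ₗ[ℂ] B →ₗ[ℂ] X} (hb : BddBilin b) {f : C →ₗ[ℂ] A}
    {g : D →ₗ[ℂ] B} (hf : BddLin f) (hg : BddLin g) : BddBilin (b.compl₁₂ f g) := by
  intro S T hS hT
  refine (hb _ _ (hf S hS) (hg T hT)).subset ?_
  rintro _ ⟨x, hx, y, hy, rfl⟩
  exact ⟨f x, ⟨x, hx, rfl⟩, g y, ⟨y, hy, rfl⟩, rfl⟩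

theorem BddBilin.comp {b : A →ₗ[ℂ] B →ₗ[ℂ] X} (hb : BddBilin b) {f : X →ₗ[ℂ] P}
    (hf : BddLin f) : BddBilin (b.compr₂ f) := by
  intro S T hS hT
  refine (hf _ (hb S T hS hT)).subset ?_
  rintro _ ⟨x, hx, y, hy, rfl⟩
  exact ⟨_, ⟨x, hx, y, hy, rfl⟩, rfl⟩

/-- The elementary tensor `a ⊗ b` in the completed tensor product. -/
noncomputable abbrev tm (a : A) (b : B) : CTensor A B := BTensor.tmul ∅ a b

/-- The map `f ⊗ g` between completed tensor products. -/
noncomputable def tmap (f : A →ₗ[ℂ] C) (g : B →ₗ[ℂ] D) (hf : BddLin f) (hg : BddLin g) :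
    CTensor A B →ₗ[ℂ] CTensor C D :=
  BTensor.lift ((BTensor.tmul ∅).compl₁₂ f g) (BTensor.bddBilin_tmul.compl hf hg)
    (fun _ _ h => h.elim)

@[simp]
theorem tmap_tm (f : A →ₗ[ℂ] C) (g : B →ₗ[ℂ] D) (hf : BddLin f) (hg : BddLin g) (a : A) (b : B) :
    tmap f g hf hg (tm a b) = tm (f a) (g b) := BTensor.lift_tmul _ _ _ _

theorem bddLin_tmap (f : A →ₗ[ℂ] C) (g : B →ₗ[ℂ] D) (hf : BddLin f) (hg : BddLin g) :
    BddLin (tmap f g hf hg) := BTensor.bddLin_lift _ _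

theorem BddLin.add [CompleteBornSpace B] {f g : A →ₗ[ℂ] B} (hf : BddLin f) (hg : BddLin g) :
    BddLin (f + g) := fun S hS => by
  refine (CompleteBornSpace.isBounded_add _ _ (hf S hS) (hg S hS)).subset ?_
  rintro _ ⟨x, hx, rfl⟩
  exact ⟨f x, ⟨x, hx, rfl⟩, g x, ⟨x, hx, rfl⟩, rfl⟩

theorem BddLin.smul [CompleteBornSpace B] {f : A →ₗ[ℂ] B} (c : ℂ) (hf : BddLin f) :
    BddLin (c • f) := fun S hS => by
  refine (CompleteBornSpace.isBounded_smul c _ (hf S hS)).subset ?_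
  rintro _ ⟨x, hx, rfl⟩
  exact ⟨f x, ⟨x, hx, rfl⟩, rfl⟩

/-- Bounded trilinear maps. -/
def BddTrilin (t : A →ₗ[ℂ] B →ₗ[ℂ] P →ₗ[ℂ] X) : Prop :=
  ∀ (S : Set A) (T : Set B) (U : Set P), IsBounded S → IsBounded T → IsBounded U →
    IsBounded {x | ∃ a ∈ S, ∃ b ∈ T, ∃ p ∈ U, t a b p = x}

theorem BddTrilin.bddBilin {t : A →ₗ[ℂ] B →ₗ[ℂ] P →ₗ[ℂ] X} (ht : BddTrilin t) (p : P) :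
    BddBilin (t.compr₂ (LinearMap.applyₗ p)) := by
  intro S T hS hT
  refine (ht S T {p} hS hT isBounded_singleton).subset ?_
  rintro _ ⟨a, ha, b, hb, rfl⟩
  exact ⟨a, ha, b, hb, p, rfl, rfl⟩

variable [CompleteBornSpace X]

/-- The bilinear map `(a ⊗ b, p) ↦ t a b p` induced by a bounded trilinear map `t`. -/
noncomputable def liftTri (t : A →ₗ[ℂ] B →ₗ[ℂ] P →ₗ[ℂ] X) (ht : BddTrilin t) :
    CTensor A B →ₗ[ℂ] P →ₗ[ℂ] X :=
  LinearMap.flip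
    { toFun := fun p => BTensor.lift (t.compr₂ (LinearMap.applyₗ p)) (ht.bddBilin p)
        (fun _ _ h => h.elim)
      map_add' := fun p q => BTensor.ext (BTensor.bddLin_lift _ _)
        ((BTensor.bddLin_lift _ _).add (BTensor.bddLin_lift _ _)) (fun a b => by simp)
      map_smul' := fun c p => BTensor.ext (BTensor.bddLin_lift _ _)
        ((BTensor.bddLin_lift _ _).smul c) (fun a b => by simp) }

@[simp]
theorem liftTri_tm (t : A →ₗ[ℂ] B →ₗ[ℂ] P →ₗ[ℂ] X) (ht : BddTrilin t) (a : A) (b : B) (p : P) :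
    liftTri t ht (tm a b) p = t a b p :=
  BTensor.lift_tmul (R := ∅) (ht.bddBilin p) (fun _ _ h => h.elim) a b

theorem bddBilin_liftTri (t : A →ₗ[ℂ] B →ₗ[ℂ] P →ₗ[ℂ] X) (ht : BddTrilin t) :
    BddBilin (liftTri t ht) := by
  intro U T hU hT
  obtain ⟨S, S', c, hS, hS', h⟩ := BTensor.isBounded_iff.1 hU
  obtain ⟨D, hD1, hD2, hD3, hD4⟩ := CompleteBornSpace.exists_completant' (ht S S' T hS hS' hT)
  refine (CompleteBornSpace.isBounded_real_smul (c + 1) hD3).subset ?_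
  rintro _ ⟨x, hx, p, hp, rfl⟩
  exact BTensor.lift_mem (ht.bddBilin p) (fun _ _ h => h.elim) hD3 hD2 hD4
    (fun v hv w hw => hD1 ⟨v, hv, w, hw, p, hp, rfl⟩) (h hx)

/-- Uniform boundedness of `f ⊗ g` for `f`, `g` in equibounded sets. -/
theorem tmap_mem {S : Set A} {T : Set B} {U : Set C} {U' : Set D} {c : ℝ}
    (hU : IsBounded U) (hU' : IsBounded U') :
    ∃ E : Set (CTensor C D), IsBounded E ∧ ∀ (f : A →ₗ[ℂ] C) (g : B →ₗ[ℂ] D) (hf : BddLin f)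
      (hg : BddLin g), (∀ a ∈ S, f a ∈ U) → (∀ b ∈ T, g b ∈ U') →
      ∀ x ∈ BTensor.mk ∅ '' Series.ball A B S T c, tmap f g hf hg x ∈ E := by
  obtain ⟨E, hE1, hE2, hE3, hE4⟩ := CompleteBornSpace.exists_completant'
    (BTensor.bddBilin_tmul (R := ∅) U U' hU hU')
  refine ⟨(c + 1) • E, CompleteBornSpace.isBounded_real_smul _ hE3, fun f g hf hg h h' x hx => ?_⟩
  exact BTensor.lift_mem _ _ hE3 hE2 hE4
    (fun v hv w hw => hE1 ⟨f v, h v hv, g w, h' w hw, rfl⟩) hx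

variable (A B C) in
/-- The trilinear map `(a, b, c) ↦ a ⊗ (b ⊗ c)`. -/
noncomputable def assocTri : A →ₗ[ℂ] B →ₗ[ℂ] C →ₗ[ℂ] CTensor A (CTensor B C) :=
  LinearMap.mk₂ ℂ (fun a b => (BTensor.tmul ∅ a) ∘ₗ (BTensor.tmul ∅ b : C →ₗ[ℂ] CTensor B C))
    (fun a a' b => by ext; simp) (fun c a b => by ext; simp)
    (fun a b b' => by ext; simp) (fun c a b => by ext; simp)

theorem bddTrilin_assocTri : BddTrilin (assocTri A B C) := by
  intro S T U hS hT hU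
  refine (BTensor.bddBilin_tmul S _ hS (BTensor.bddBilin_tmul T U hT hU)).subset ?_
  rintro _ ⟨a, ha, b, hb, p, hp, rfl⟩
  exact ⟨a, ha, _, ⟨b, hb, p, hp, rfl⟩, rfl⟩

variable (A B C) in
/-- The associativity map `(a ⊗ b) ⊗ c ↦ a ⊗ (b ⊗ c)`. -/
noncomputable def assocMap : CTensor (CTensor A B) C →ₗ[ℂ] CTensor A (CTensor B C) :=
  BTensor.lift (liftTri (assocTri A B C) bddTrilin_assocTri) (bddBilin_liftTri _ _)
    (fun _ _ h => h.elim)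

@[simp]
theorem assocMap_tm (a : A) (b : B) (c : C) :
    assocMap A B C (tm (tm a b) c) = tm a (tm b c) := by
  rw [assocMap, BTensor.lift_tmul, liftTri_tm]
  rfl

theorem bddBilin_smul_right [CompleteBornSpace A] {φ : B →ₗ[ℂ] ℂ} (hφ : BddLin φ) :
    BddBilin ((LinearMap.lsmul ℂ A).flip.compl₂ φ) := by
  intro S T hS hT
  obtain ⟨r, hr⟩ := (hφ T hT).exists_norm_le
  refine (CompleteBornSpace.isBounded_smul (r : ℂ) _
    (CompleteBornSpace.isBounded_hull S hS)).subset ?_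
  rintro _ ⟨a, ha, b, hb, rfl⟩
  have hn : ‖φ b‖ ≤ r := hr _ ⟨b, hb, rfl⟩
  have hr0 : 0 ≤ r := (norm_nonneg _).trans hn
  refine ⟨(φ b / r) • a, subset_convexHull ℝ _ ?_, ?_⟩
  · refine mem_balancedHull_iff.2 ⟨φ b / r, ?_, a, ha, rfl⟩
    rw [norm_div, Complex.norm_real, Real.norm_of_nonneg hr0]
    exact div_le_one_of_le₀ hn hr0
  · change (r : ℂ) • (φ b / r) • a = φ b • a
    rw [smul_smul]
    congr 1
    rcases hr0.eq_or_lt with h | h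
    · rw [← h, norm_le_zero_iff] at hn
      simp [hn]
    · have : (r : ℂ) ≠ 0 := by exact_mod_cast h.ne'
      field_simp

theorem BddBilin.flip {b : A →ₗ[ℂ] B →ₗ[ℂ] X} (hb : BddBilin b) : BddBilin b.flip := by
  intro S T hS hT
  refine (hb T S hT hS).subset ?_
  rintro _ ⟨x, hx, y, hy, rfl⟩
  exact ⟨y, hy, x, hx, rfl⟩

/-- The slice map `id ⊗ φ : a ⊗ b ↦ φ b • a`. -/
noncomputable def sliceRight [CompleteBornSpace A] (φ : B →ₗ[ℂ] ℂ) (hφ : BddLin φ) :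
    CTensor A B →ₗ[ℂ] A :=
  BTensor.lift ((LinearMap.lsmul ℂ A).flip.compl₂ φ) (bddBilin_smul_right hφ)
    (fun _ _ h => h.elim)

/-- The slice map `φ ⊗ id : a ⊗ b ↦ φ a • b`. -/
noncomputable def sliceLeft [CompleteBornSpace B] (φ : A →ₗ[ℂ] ℂ) (hφ : BddLin φ) :
    CTensor A B →ₗ[ℂ] B :=
  BTensor.lift ((LinearMap.lsmul ℂ B).flip.compl₂ φ).flip (bddBilin_smul_right hφ).flip
    (fun _ _ h => h.elim)

@[simp]
theorem sliceRight_tm [CompleteBornSpace A] (φ : B →ₗ[ℂ] ℂ) (hφ : BddLin φ) (a : A) (b : B) :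
    sliceRight φ hφ (tm a b) = φ b • a := BTensor.lift_tmul _ _ _ _

@[simp]
theorem sliceLeft_tm [CompleteBornSpace B] (φ : A →ₗ[ℂ] ℂ) (hφ : BddLin φ) (a : A) (b : B) :
    sliceLeft φ hφ (tm a b) = φ a • b := BTensor.lift_tmul _ _ _ _

end Constructions

section Algebras

/-- A bornological algebra, not necessarily unital: a complete bornological vector space with an
associative bounded bilinear multiplication. -/
class BornAlgebra (A : Type u) [NonUnitalRing A] [Module ℂ A] [Bornology A] : Prop
    extends CompleteBornSpace A, IsScalarTower ℂ A A, SMulCommClass ℂ A A where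
  isBounded_mul : ∀ S T : Set A, IsBounded S → IsBounded T → IsBounded (S * T)

variable {A B : Type u} [NonUnitalRing A] [Module ℂ A] [Bornology A] [BornAlgebra A]
  [NonUnitalRing B] [Module ℂ B] [Bornology B] [BornAlgebra B]

theorem bddBilin_mul : BddBilin (LinearMap.mul ℂ A) := fun S T hS hT =>
  BornAlgebra.isBounded_mul S T hS hT

variable (A B) in
/-- The trilinear map `(a, b, y) ↦ (a ⊗ b) y`. -/
noncomputable def tensorMulTri : A →ₗ[ℂ] B →ₗ[ℂ] CTensor A B →ₗ[ℂ] CTensor A B :=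
  LinearMap.mk₂ ℂ
    (fun a b => tmap (LinearMap.mul ℂ A a) (LinearMap.mul ℂ B b) (bddBilin_mul.left a)
      (bddBilin_mul.left b))
    (fun a a' b => BTensor.ext (bddLin_tmap _ _ _ _)
      ((bddLin_tmap _ _ _ _).add (bddLin_tmap _ _ _ _)) (fun x y => by
        simp [LinearMap.map_add₂]))
    (fun c a b => BTensor.ext (bddLin_tmap _ _ _ _) ((bddLin_tmap _ _ _ _).smul c)
      (fun x y => by simp [LinearMap.map_smul₂]))
    (fun a b b' => BTensor.ext (bddLin_tmap _ _ _ _)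
      ((bddLin_tmap _ _ _ _).add (bddLin_tmap _ _ _ _)) (fun x y => by simp))
    (fun c a b => BTensor.ext (bddLin_tmap _ _ _ _) ((bddLin_tmap _ _ _ _).smul c)
      (fun x y => by simp))

theorem bddTrilin_tensorMulTri : BddTrilin (tensorMulTri A B) := by
  intro S T U hS hT hU
  obtain ⟨S', T', c, hS', hT', h⟩ := BTensor.isBounded_iff.1 hU
  obtain ⟨E, hE, hE'⟩ := tmap_mem (S := S') (T := T') (c := c)
    (BornAlgebra.isBounded_mul S S' hS hS') (BornAlgebra.isBounded_mul T T' hT hT')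
  refine hE.subset ?_
  rintro _ ⟨a, ha, b, hb, x, hx, rfl⟩
  exact hE' _ _ (bddBilin_mul.left a) (bddBilin_mul.left b) (fun a' ha' => Set.mul_mem_mul ha ha') (fun b' hb' => Set.mul_mem_mul hb hb')
    x (h hx)

variable (A B) in
/-- The multiplication of the completed tensor product, `(a ⊗ b) (a' ⊗ b') = a a' ⊗ b b'`. -/
noncomputable def tensorMul : CTensor A B →ₗ[ℂ] CTensor A B →ₗ[ℂ] CTensor A B :=
  liftTri (tensorMulTri A B) bddTrilin_tensorMulTri

theorem tensorMul_tm (a a' : A) (b b' : B) :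
    tensorMul A B (tm a b) (tm a' b') = tm (a * a') (b * b') := by
  rw [tensorMul, liftTri_tm]
  exact tmap_tm _ _ (bddBilin_mul.left a) (bddBilin_mul.left b) _ _

theorem bddBilin_tensorMul : BddBilin (tensorMul A B) := bddBilin_liftTri _ _

theorem tensorMul_assoc (x y z : CTensor A B) :
    tensorMul A B (tensorMul A B x y) z = tensorMul A B x (tensorMul A B y z) := by
  have h := bddBilin_tensorMul (A := A) (B := B)
  have h1 : ∀ a b a' b', tensorMul A B (tensorMul A B (tm a b) (tm a' b')) =
      tensorMul A B (tm a b) ∘ₗ tensorMul A B (tm a' b') := fun a b a' b' => by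
    refine BTensor.ext (h.left _) ((h.left _).comp (h.left _)) fun a'' b'' => ?_
    change tensorMul A B _ (tm a'' b'') = tensorMul A B (tm a b) (tensorMul A B _ (tm a'' b''))
    simp only [tensorMul_tm, mul_assoc]
  have h2 : ∀ a b z, (tensorMul A B).flip z ∘ₗ tensorMul A B (tm a b) =
      tensorMul A B (tm a b) ∘ₗ (tensorMul A B).flip z := fun a b z => by
    refine BTensor.ext ((h.right _).comp (h.left _)) ((h.left _).comp (h.right _))
      fun a' b' => ?_
    exact LinearMap.congr_fun (h1 a b a' b') z
  have h3 : (tensorMul A B).flip z ∘ₗ (tensorMul A B).flip y =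
      (tensorMul A B).flip (tensorMul A B y z) := by
    refine BTensor.ext ((h.right _).comp (h.right _)) (h.right _) fun a b => ?_
    exact LinearMap.congr_fun (h2 a b z) y
  exact LinearMap.congr_fun h3 x

noncomputable instance : NonUnitalRing (CTensor A B) :=
  { (inferInstance : AddCommGroup (CTensor A B)) with
    mul := fun x y => tensorMul A B x y
    left_distrib := fun x y z => map_add (tensorMul A B x) y z
    right_distrib := fun x y z => LinearMap.map_add₂ (tensorMul A B) x y z
    zero_mul := fun x => LinearMap.map_zero₂ (tensorMul A B) x
    mul_zero := fun x => map_zero (tensorMul A B x)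
    mul_assoc := tensorMul_assoc }

theorem tensor_mul_def (x y : CTensor A B) : x * y = tensorMul A B x y := rfl

@[simp]
theorem tm_mul_tm (a a' : A) (b b' : B) : tm a b * tm a' b' = tm (a * a') (b * b') :=
  tensorMul_tm a a' b b'

instance : BornAlgebra (CTensor A B) where
  smul_assoc c x y := LinearMap.map_smul₂ (tensorMul A B) c x y
  smul_comm c x y := (map_smul (tensorMul A B x) c y).symm
  isBounded_mul S T hS hT := bddBilin_tensorMul S T hS hT

variable (A) in
/-- Multipliers `(L, R)` of `A`: a bounded left multiplier `L` and a bounded right multiplier `R`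
with `f L(g) = R(f) g`. -/
def multiplierSubmodule : Submodule ℂ ((A →ₗ[ℂ] A) × (A →ₗ[ℂ] A)) where
  carrier := {m | BddLin m.1 ∧ BddLin m.2 ∧ (∀ f g, m.1 (f * g) = m.1 f * g) ∧
    (∀ f g, m.2 (f * g) = f * m.2 g) ∧ ∀ f g, f * m.1 g = m.2 f * g}
  zero_mem' := by
    have : BddLin (0 : A →ₗ[ℂ] A) := fun S _ => (isBounded_singleton (x := (0 : A))).subset (by
      rintro _ ⟨x, _, rfl⟩
      rfl)
    refine ⟨this, this, ?_, ?_, ?_⟩ <;> simp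
  add_mem' := by
    rintro m n ⟨h1, h2, h3, h4, h5⟩ ⟨k1, k2, k3, k4, k5⟩
    exact ⟨h1.add k1, h2.add k2, fun f g => by simp [h3, k3, add_mul],
      fun f g => by simp [h4, k4, mul_add], fun f g => by simp [h5, k5, add_mul, mul_add]⟩
  smul_mem' := by
    rintro c m ⟨h1, h2, h3, h4, h5⟩
    exact ⟨h1.smul c, h2.smul c, fun f g => by simp [h3, smul_mul_assoc],
      fun f g => by simp [h4, mul_smul_comm],
      fun f g => by simp [mul_smul_comm, smul_mul_assoc, h5]⟩

variable (A) in
/-- The multiplier algebra `M(A)`. -/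
def Multiplier : Type u := multiplierSubmodule A

namespace Multiplier

instance : AddCommGroup (Multiplier A) := inferInstanceAs (AddCommGroup (multiplierSubmodule A))

instance : Module ℂ (Multiplier A) := inferInstanceAs (Module ℂ (multiplierSubmodule A))

/-- The left multiplier `g ↦ m g`. -/
def L (m : Multiplier A) : A →ₗ[ℂ] A := m.1.1

/-- The right multiplier `g ↦ g m`. -/
def R (m : Multiplier A) : A →ₗ[ℂ] A := m.1.2

theorem bddLin_L (m : Multiplier A) : BddLin m.L := m.2.1

theorem bddLin_R (m : Multiplier A) : BddLin m.R := m.2.2.1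

theorem L_mul (m : Multiplier A) (f g : A) : m.L (f * g) = m.L f * g := m.2.2.2.1 f g

theorem R_mul (m : Multiplier A) (f g : A) : m.R (f * g) = f * m.R g := m.2.2.2.2.1 f g

theorem mul_L (m : Multiplier A) (f g : A) : f * m.L g = m.R f * g := m.2.2.2.2.2 f g

/-- Constructor for multipliers. -/
def mk (L R : A →ₗ[ℂ] A) (hL : BddLin L) (hR : BddLin R) (h1 : ∀ f g, L (f * g) = L f * g)
    (h2 : ∀ f g, R (f * g) = f * R g) (h3 : ∀ f g, f * L g = R f * g) : Multiplier A :=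
  Subtype.mk (p := (· ∈ multiplierSubmodule A)) (L, R) ⟨hL, hR, h1, h2, h3⟩

/-- Multiplication of multipliers: `(m n) g = m (n g)` and `g (m n) = (g m) n`. -/
instance : Mul (Multiplier A) where
  mul m n := mk (m.L ∘ₗ n.L) (n.R ∘ₗ m.R) (m.bddLin_L.comp n.bddLin_L)
    (n.bddLin_R.comp m.bddLin_R) (fun f g => by simp [L_mul]) (fun f g => by simp [R_mul])
    (fun f g => by simp [mul_L])

instance : One (Multiplier A) where
  one := mk LinearMap.id LinearMap.id BddLin.id BddLin.id (fun _ _ => rfl) (fun _ _ => rfl)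
    (fun _ _ => rfl)

/-- A set of multipliers is small if the corresponding sets of left and right multipliers are
equibounded. -/
instance : Bornology (Multiplier A) :=
  Bornology.ofBounded {M | ∀ S : Set A, IsBounded S →
      IsBounded {x | ∃ m ∈ M, ∃ a ∈ S, m.L a = x} ∧ IsBounded {x | ∃ m ∈ M, ∃ a ∈ S, m.R a = x}}
    (by
      intro S _
      simp)
    (by
      intro M hM M' h S hS
      refine ⟨(hM S hS).1.subset ?_, (hM S hS).2.subset ?_⟩
      · rintro _ ⟨m, hm, a, ha, rfl⟩
        exact ⟨m, h hm, a, ha, rfl⟩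
      · rintro _ ⟨m, hm, a, ha, rfl⟩
        exact ⟨m, h hm, a, ha, rfl⟩)
    (by
      intro M hM M' hM' S hS
      refine ⟨((hM S hS).1.union (hM' S hS).1).subset ?_,
        ((hM S hS).2.union (hM' S hS).2).subset ?_⟩
      · rintro _ ⟨m, hm | hm, a, ha, rfl⟩
        · exact Or.inl ⟨m, hm, a, ha, rfl⟩
        · exact Or.inr ⟨m, hm, a, ha, rfl⟩
      · rintro _ ⟨m, hm | hm, a, ha, rfl⟩
        · exact Or.inl ⟨m, hm, a, ha, rfl⟩
        · exact Or.inr ⟨m, hm, a, ha, rfl⟩)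
    (by
      intro m S hS
      refine ⟨(m.bddLin_L S hS).subset ?_, (m.bddLin_R S hS).subset ?_⟩
      · rintro _ ⟨_, rfl, a, ha, rfl⟩
        exact ⟨a, ha, rfl⟩
      · rintro _ ⟨_, rfl, a, ha, rfl⟩
        exact ⟨a, ha, rfl⟩)

variable (A) in
/-- The canonical map `A → M(A)`. -/
noncomputable def incl : A →ₗ[ℂ] Multiplier A where
  toFun a := mk (LinearMap.mul ℂ A a) ((LinearMap.mul ℂ A).flip a) (bddBilin_mul.left a)
    (bddBilin_mul.right a) (fun f g => by simp [mul_assoc]) (fun f g => by simp [mul_assoc])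
    (fun f g => by simp [mul_assoc])
  map_add' a b := Subtype.ext (Prod.ext (map_add _ a b) (map_add _ a b))
  map_smul' c a := Subtype.ext (Prod.ext (map_smul _ c a) (map_smul _ c a))

/-- The multiplier `m ⊗ n` of a tensor product. -/
noncomputable def tensor (m : Multiplier A) (n : Multiplier B) : Multiplier (CTensor A B) :=
  mk (tmap m.L n.L m.bddLin_L n.bddLin_L) (tmap m.R n.R m.bddLin_R n.bddLin_R)
    (bddLin_tmap _ _ _ _) (bddLin_tmap _ _ _ _)
    (fun f g => by
      have h := bddBilin_tensorMul (A := A) (B := B)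
      have h1 : ∀ a b, tmap m.L n.L m.bddLin_L n.bddLin_L ∘ₗ tensorMul A B (tm a b) =
          tensorMul A B (tmap m.L n.L m.bddLin_L n.bddLin_L (tm a b)) := fun a b => by
        refine BTensor.ext ((bddLin_tmap _ _ _ _).comp (h.left _)) (h.left _) fun a' b' => ?_
        simp [tensorMul_tm, L_mul]
      have h2 : tmap m.L n.L m.bddLin_L n.bddLin_L ∘ₗ (tensorMul A B).flip g =
          (tensorMul A B).flip g ∘ₗ tmap m.L n.L m.bddLin_L n.bddLin_L := by
        refine BTensor.ext ((bddLin_tmap _ _ _ _).comp (h.right _))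
          ((h.right _).comp (bddLin_tmap _ _ _ _)) fun a b => ?_
        exact LinearMap.congr_fun (h1 a b) g
      exact LinearMap.congr_fun h2 f)
    (fun f g => by
      have h := bddBilin_tensorMul (A := A) (B := B)
      have h1 : ∀ a b, tmap m.R n.R m.bddLin_R n.bddLin_R ∘ₗ tensorMul A B (tm a b) =
          tensorMul A B (tm a b) ∘ₗ tmap m.R n.R m.bddLin_R n.bddLin_R := fun a b => by
        refine BTensor.ext ((bddLin_tmap _ _ _ _).comp (h.left _))
          ((h.left _).comp (bddLin_tmap _ _ _ _)) fun a' b' => ?_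
        simp [tensorMul_tm, R_mul]
      have h2 : tmap m.R n.R m.bddLin_R n.bddLin_R ∘ₗ (tensorMul A B).flip g =
          (tensorMul A B).flip (tmap m.R n.R m.bddLin_R n.bddLin_R g) := by
        refine BTensor.ext ((bddLin_tmap _ _ _ _).comp (h.right _)) (h.right _) fun a b => ?_
        exact LinearMap.congr_fun (h1 a b) g
      exact LinearMap.congr_fun h2 f)
    (fun f g => by
      have h := bddBilin_tensorMul (A := A) (B := B)
      have h1 : ∀ a b, tensorMul A B (tm a b) ∘ₗ tmap m.L n.L m.bddLin_L n.bddLin_L =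
          tensorMul A B (tmap m.R n.R m.bddLin_R n.bddLin_R (tm a b)) := fun a b => by
        refine BTensor.ext ((h.left _).comp (bddLin_tmap _ _ _ _)) (h.left _) fun a' b' => ?_
        simp [tensorMul_tm, mul_L]
      have h2 : (tensorMul A B).flip (tmap m.L n.L m.bddLin_L n.bddLin_L g) =
          (tensorMul A B).flip g ∘ₗ tmap m.R n.R m.bddLin_R n.bddLin_R := by
        refine BTensor.ext (h.right _) ((h.right _).comp (bddLin_tmap _ _ _ _)) fun a b => ?_
        exact LinearMap.congr_fun (h1 a b) g
      exact LinearMap.congr_fun h2 f)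

end Multiplier

end Algebras

section Approximation

variable (V : Type u) [AddCommGroup V] [Module ℂ V] [Bornology V]

variable {V} in
/-- A subset is compact if it is a compact subset of the Banach space spanned by some small
completant disk; compactness in a normed space is expressed by sequences. -/
def IsBornCompact (S : Set V) : Prop :=
  ∃ T : Set V, IsBounded T ∧ IsCompletant T ∧ S ⊆ Submodule.span ℂ T ∧
    ∀ u : ℕ → V, (∀ n, u n ∈ S) → ∃ x ∈ S, ∃ k : ℕ → ℕ, StrictMono k ∧
      Tendsto (fun n => gauge T (u (k n) - x)) atTop (𝓝 0)

variable {V} in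
/-- Operators of the form `x ↦ ∑ φᵢ x • vᵢ`, a finite sum with bounded linear functionals `φᵢ`. -/
def IsFiniteRank (f : V →ₗ[ℂ] V) : Prop :=
  ∃ (n : ℕ) (φ : Fin n → V →ₗ[ℂ] ℂ) (v : Fin n → V), (∀ i, BddLin (φ i)) ∧
    ∀ x, f x = ∑ i, φ i x • v i

/-- The approximation property: for every compact disk `S` there is a sequence of finite rank
operators converging to the identity in `Hom(⟨S⟩, V)`, that is, uniformly on `S` with respect to
the norm of some small disk `T`. -/
def ApproximationProperty : Prop :=
  ∀ S : Set V, IsDisk S → IsBornCompact S → ∃ f : ℕ → V →ₗ[ℂ] V, (∀ n, IsFiniteRank (f n)) ∧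
    ∃ T : Set V, IsBounded T ∧ IsDisk T ∧ ∃ ε : ℕ → ℝ, Tendsto ε atTop (𝓝 0) ∧
      ∀ n, ∀ x ∈ S, f n x - x ∈ ε n • T

end Approximation

section QuantumGroups

open Multiplier

variable {H K : Type u} [NonUnitalRing H] [Module ℂ H] [Bornology H] [BornAlgebra H]
  [NonUnitalRing K] [Module ℂ K] [Bornology K] [BornAlgebra K]

variable (H) in
/-- A nonzero bornological algebra `H` is essential if the multiplication induces a bornological
isomorphism `H ⊗_H H ≅ H`. Here `H ⊗_H H` is the quotient of the completed tensor product by the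
closed subspace generated by `a b ⊗ c - a ⊗ b c`. -/
def IsEssentialAlgebra : Prop :=
  Nontrivial H ∧ ∃ e : BTensor H H {r | ∃ a b c : H, r = ((a * b, c), (a, b * c))} ≃ₗ[ℂ] H,
    IsBornIso e ∧ ∀ a b, e (BTensor.tmul _ a b) = a * b

/-- A homomorphism of bornological algebras `H → M(K)`. -/
structure IsHom (f : H →ₗ[ℂ] Multiplier K) : Prop where
  bdd : BddLin f
  map_mul : ∀ a b, f (a * b) = f a * f b

/-- A homomorphism `f : H → M(K)` is essential if it turns `K` into an essential left and right
`H`-module, that is, `H ⊗_H K ≅ K` and `K ⊗_H H ≅ K` via the module structures. -/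
structure IsEssentialHom (f : H →ₗ[ℂ] Multiplier K) : Prop extends IsHom f where
  left : ∃ e : BTensor H K {r | ∃ (a b : H) (k : K), r = ((a * b, k), (a, (f b).L k))} ≃ₗ[ℂ] K,
    IsBornIso e ∧ ∀ a k, e (BTensor.tmul _ a k) = (f a).L k
  right : ∃ e : BTensor K H {r | ∃ (k : K) (a b : H), r = (((f a).R k, b), (k, a * b))} ≃ₗ[ℂ] K,
    IsBornIso e ∧ ∀ k a, e (BTensor.tmul _ k a) = (f a).R k

/-- `F` is a unital homomorphism `M(H) → M(K)`. -/
structure IsUnitalHom (F : Multiplier H →ₗ[ℂ] Multiplier K) : Prop where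
  bdd : BddLin F
  map_one : F 1 = 1
  map_mul : ∀ m n, F (m * n) = F m * F n

/-- Coassociativity `(Δ ⊗ id) Δ = (id ⊗ Δ) Δ`. Here `E₁` and `E₂` are the (unique) unital
homomorphisms on `M(H ⊗ H)` extending the homomorphisms `Δ ⊗ id` and `id ⊗ Δ` on `H ⊗ H`, and
multipliers of `(H ⊗ H) ⊗ H` and `H ⊗ (H ⊗ H)` are compared by the associativity isomorphism. -/
def IsCoassociative (Δ : H →ₗ[ℂ] Multiplier (CTensor H H)) : Prop :=
  ∃ (E₁ : Multiplier (CTensor H H) →ₗ[ℂ] Multiplier (CTensor (CTensor H H) H))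
    (E₂ : Multiplier (CTensor H H) →ₗ[ℂ] Multiplier (CTensor H (CTensor H H))),
    IsUnitalHom E₁ ∧ IsUnitalHom E₂ ∧
    (∀ a b, E₁ (incl _ (tm a b)) = (Δ a).tensor (incl H b)) ∧
    (∀ a b, E₂ (incl _ (tm a b)) = (incl H a).tensor (Δ b)) ∧
    ∀ f, (assocMap H H H) ∘ₗ (E₁ (Δ f)).L = (E₂ (Δ f)).L ∘ₗ (assocMap H H H) ∧
      (assocMap H H H) ∘ₗ (E₁ (Δ f)).R = (E₂ (Δ f)).R ∘ₗ (assocMap H H H)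

/-- A comultiplication is a coassociative essential homomorphism `H → M(H ⊗ H)`. -/
structure IsComultiplication (Δ : H →ₗ[ℂ] Multiplier (CTensor H H)) : Prop
    extends IsEssentialHom Δ where
  coassoc : IsCoassociative Δ

/-- The statement that the Galois maps
`γ_l (f ⊗ g) = Δ(f) (g ⊗ 1)`, `γ_r (f ⊗ g) = Δ(f) (1 ⊗ g)`,
`ρ_l (f ⊗ g) = (f ⊗ 1) Δ(g)`, `ρ_r (f ⊗ g) = (1 ⊗ f) Δ(g)`
are bornological isomorphisms of `H ⊗ H` onto itself. -/
structure GaloisIsos (Δ : H →ₗ[ℂ] Multiplier (CTensor H H)) where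
  gammaL : CTensor H H ≃ₗ[ℂ] CTensor H H
  gammaR : CTensor H H ≃ₗ[ℂ] CTensor H H
  rhoL : CTensor H H ≃ₗ[ℂ] CTensor H H
  rhoR : CTensor H H ≃ₗ[ℂ] CTensor H H
  gammaL_iso : IsBornIso gammaL
  gammaR_iso : IsBornIso gammaR
  rhoL_iso : IsBornIso rhoL
  rhoR_iso : IsBornIso rhoR
  gammaL_tm : ∀ f g, incl _ (gammaL (tm f g)) = Δ f * (incl H g).tensor 1
  gammaR_tm : ∀ f g, incl _ (gammaR (tm f g)) = Δ f * Multiplier.tensor 1 (incl H g)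
  rhoL_tm : ∀ f g, incl _ (rhoL (tm f g)) = (incl H f).tensor 1 * Δ g
  rhoR_tm : ∀ f g, incl _ (rhoR (tm f g)) = Multiplier.tensor 1 (incl H f) * Δ g

/-- A bounded linear functional `ω` is faithful if `ω(fg) = 0` for all `g` implies `f = 0`, and
`ω(fg) = 0` for all `f` implies `g = 0`. -/
structure IsFaithful (ω : H →ₗ[ℂ] ℂ) : Prop where
  bdd : BddLin ω
  left : ∀ f, (∀ g, ω (f * g) = 0) → f = 0
  right : ∀ g, (∀ f, ω (f * g) = 0) → g = 0

/-- Left invariance `(id ⊗ φ) Δ(f) = φ(f) 1` of a bounded linear functional, as an equality of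
multipliers: `(id ⊗ φ)(Δ(f) (g ⊗ 1)) = φ(f) g` and `(id ⊗ φ)((g ⊗ 1) Δ(f)) = φ(f) g`. -/
structure IsLeftInvariant {Δ : H →ₗ[ℂ] Multiplier (CTensor H H)} (G : GaloisIsos Δ)
    (φ : H →ₗ[ℂ] ℂ) : Prop where
  bdd : BddLin φ
  left : ∀ f g, sliceRight φ bdd (G.gammaL (tm f g)) = φ f • g
  right : ∀ f g, sliceRight φ bdd (G.rhoL (tm g f)) = φ f • g

/-- Right invariance `(ψ ⊗ id) Δ(f) = ψ(f) 1` of a bounded linear functional, as an equality of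
multipliers: `(ψ ⊗ id)(Δ(f) (1 ⊗ g)) = ψ(f) g` and `(ψ ⊗ id)((1 ⊗ g) Δ(f)) = ψ(f) g`. -/
structure IsRightInvariant {Δ : H →ₗ[ℂ] Multiplier (CTensor H H)} (G : GaloisIsos Δ)
    (ψ : H →ₗ[ℂ] ℂ) : Prop where
  bdd : BddLin ψ
  left : ∀ f g, sliceLeft ψ bdd (G.gammaR (tm f g)) = ψ f • g
  right : ∀ f g, sliceLeft ψ bdd (G.rhoR (tm g f)) = ψ f • g

variable (H) in
/-- A bornological quantum group: an essential bornological algebra with the approximation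
property, a comultiplication all of whose Galois maps are isomorphisms, and a faithful left
invariant functional, the left Haar functional. -/
structure BornQuantumGroup where
  essential : IsEssentialAlgebra H
  approximation : ApproximationProperty H
  comul : H →ₗ[ℂ] Multiplier (CTensor H H)
  isComultiplication : IsComultiplication comul
  galois : GaloisIsos comul
  haar : H →ₗ[ℂ] ℂ
  haar_faithful : IsFaithful haar
  haar_leftInvariant : IsLeftInvariant galois haar

end QuantumGroups

end BornQG

namespace BornQG

open Filter Topology Bornology Pointwise

/-! ### Summable weights and compact disks in the Banach spaces of completant disks. -/

section Compactness

/-! Write `φ` for a left and `ψ` for a right invariant functional. Evaluating `ψ ⊗ φ` on `Δ(x)Δ(f)(1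
⊗ g)` gives `ψ(xf)φ(g)`, and on `Δ(x)Δ(f)(g ⊗ 1)` gives `φ(xf)ψ(g)`. Both kinds of elements exhaust
`Δ(x)(H ⊗ H)` because the Galois maps are onto. Rewriting `γ_r(f ⊗ g)` as a value of `γ_l` therefore
yields `φ(x ν(f)) = φ(g)ψ(xf)` with `ν(f) = (id ⊗ ψ)γ_l⁻¹γ_r(f ⊗ g)` (`modularMap_spec`). The
reverse passage gives a map in the other direction (`modularMapInv_spec`). Once `φ(g) = 1`, and
likewise for `ψ`, the two maps are mutually inverse by faithfulness, which is part (2).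

For part (1), one nonzero right invariant `ψ` suffices. The same `ν`, built from `ψ` alone, serves
the Haar functional and any other left invariant functional; `ν` is onto by faithfulness of the Haar
functional, so the two are proportional on products, hence everywhere, since `H` is essential
(`eq_smul_haar_of_rightInvariant`).

It remains to produce `ψ`, which is the Haar functional composed with the antipode `S`. The antipode
has to satisfy `S((id ⊗ φ)(Δ(f)(1 ⊗ g))) = (id ⊗ φ)((1 ⊗ f)Δ(g))`. So `(id ⊗ φ)ρ_r γ_r⁻¹` should be
`S ⊗ φ`, and the point is that it does factor through `id ⊗ φ` (`preAntipode_tm`). This rests on an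
explicit formula for `γ_r⁻¹` on elements `(id ⊗ φ)(Δ(f)(1 ⊗ g)) ⊗ q`, which comes from
coassociativity and left invariance (`gammaR_haarConvSwap`). The same formula shows that `ψ = φ ∘ S`
is right invariant (`exists_rightInvariant`).

The analytic input is that slices separate the points of a completed tensor product
(`eq_zero_of_sliceLeft`). This is where the approximation property enters. It makes `H ⊗ H` and `H ⊗
(H ⊗ H)` nondegenerate, so that identities between multipliers become identities between elements.
-/

theorem exists_weights_nat (b : ℕ → ℝ) (hb : ∀ n, 0 < b n) (h : Summable b) :
    ∃ t : ℕ → ℝ, (∀ n, 0 < t n) ∧ Tendsto t atTop (𝓝 0) ∧ Summable fun n => b n / t n := by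
  let r : ℕ → ℝ := fun n => ∑' k, b (k + n)
  have hs : ∀ n, Summable fun k => b (k + n) := fun n => (summable_nat_add_iff n).2 h
  have hr : ∀ n, r n = b n + r (n + 1) := fun n => by
    have := (hs n).tsum_eq_zero_add
    simp only [r]
    rw [this, zero_add]
    congr 2
    ext k
    congr 1
    ring
  have hpos : ∀ n, 0 < r n := fun n => (hs n).tsum_pos (fun k => (hb _).le) 0 (hb _)
  -- The weights are the square roots of the tails `r n`. Since `b n = r n - r (n + 1)` is a
  -- difference of squares, `b n / √(r n)` is bounded by twice a telescoping difference.
  refine ⟨fun n => √(r n), fun n => Real.sqrt_pos.2 (hpos n), ?_, ?_⟩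
  · have := (tendsto_sum_nat_add b).sqrt
    rwa [Real.sqrt_zero] at this
  · have h1 : ∀ n, b n / √(r n) ≤ 2 * (√(r n) - √(r (n + 1))) := fun n => by
      have p0 := Real.sqrt_pos.2 (hpos n)
      have p1 := Real.sqrt_pos.2 (hpos (n + 1))
      rw [div_le_iff₀ p0]
      have e0 := Real.mul_self_sqrt (hpos n).le
      have e1 := Real.mul_self_sqrt (hpos (n + 1)).le
      have := hr n
      nlinarith [sq_nonneg (√(r n) - √(r (n + 1)))]
    refine summable_of_sum_range_le (c := 2 * √(r 0))
      (fun n => div_nonneg (hb n).le (Real.sqrt_nonneg _)) fun n => ?_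
    calc ∑ i ∈ Finset.range n, b i / √(r i)
        ≤ ∑ i ∈ Finset.range n, 2 * (√(r i) - √(r (i + 1))) := Finset.sum_le_sum fun i _ => h1 i
      _ = 2 * (√(r 0) - √(r n)) := by
          rw [← Finset.mul_sum, Finset.sum_range_sub' (fun i => √(r i))]
      _ ≤ 2 * √(r 0) := by linarith [Real.sqrt_nonneg (r n)]

/-- A summable family stays summable when divided by suitable weights tending to zero. -/
theorem exists_weights {ι : Type*} (a : ι → ℝ) (ha : ∀ i, 0 ≤ a i) (h : Summable a) :
    ∃ t : ι → ℝ, (∀ i, 0 < t i) ∧ (∀ ε > 0, {i | a i ≠ 0 ∧ ε ≤ t i}.Finite) ∧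
      Summable fun i => a i / t i := by
  classical
  have hc : Countable (Function.support a) := h.countable_support
  obtain ⟨e, he⟩ := exists_injective_nat (Function.support a)
  let c : ℕ → ℝ := Function.extend e (fun i => a i) 0
  have hce : ∀ i, c (e i) = a i := fun i => he.extend_apply _ _ _
  have hc0 : ∀ n, 0 ≤ c n := fun n => by
    by_cases hn : ∃ i, e i = n
    · obtain ⟨i, rfl⟩ := hn
      rw [hce]
      exact ha i
    · rw [show c n = 0 from Function.extend_apply' _ _ _ hn]
  have hcs : Summable c := by
    refine (he.summable_iff (f := c) fun n hn => Function.extend_apply' _ _ _ hn).1 ?_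
    have : c ∘ e = fun i : Function.support a => a i := funext hce
    rw [this]
    exact h.subtype _
  -- The geometric term only makes the sequence strictly positive.
  obtain ⟨t, ht, ht0, hts⟩ := exists_weights_nat (fun n => c n + (1 / 2) ^ n)
    (fun n => add_pos_of_nonneg_of_pos (hc0 n) (by positivity))
    (hcs.add summable_geometric_two)
  have hval : ∀ i (hi : a i ≠ 0),
      (if hi : a i ≠ 0 then t (e ⟨i, hi⟩) else 1) = t (e ⟨i, hi⟩) := fun i hi => by simp [hi]
  refine ⟨fun i => if hi : a i ≠ 0 then t (e ⟨i, hi⟩) else 1, fun i => ?_, fun ε hε => ?_, ?_⟩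
  · dsimp only
    split_ifs
    exacts [ht _, one_pos]
  · have h1 : {n | ε ≤ t n}.Finite := by
      have := (tendsto_order.1 ht0).2 ε hε
      rw [← Nat.cofinite_eq_atTop, eventually_cofinite] at this
      simpa using this
    refine ((h1.preimage he.injOn).image Subtype.val).subset ?_
    rintro i ⟨hi, hi'⟩
    exact ⟨⟨i, hi⟩, hi'.trans_eq (hval i hi), rfl⟩
  · refine (Subtype.val_injective (p := (· ∈ Function.support a)).summable_iff fun i hi => ?_).1 ?_
    · have : a i = 0 := by simpa using hi
      simp [this]
    · refine (hts.comp_injective he).of_nonneg_of_le (fun i => ?_) fun i => ?_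
      · simp only [Function.comp_apply]
        rw [hval i i.2]
        exact div_nonneg (ha i) (ht _).le
      · simp only [Function.comp_apply]
        rw [hval i i.2, hce]
        exact div_le_div_of_nonneg_right (by simp) (ht _).le

variable {V : Type u} [AddCommGroup V] [Module ℂ V]

/-- The Banach space spanned by a completant disk. -/
theorem IsCompletant.exists_banach {S : Set V} (hS : IsCompletant S) (hne : S.Nonempty) :
    ∃ (E : Type u) (_ : NormedAddCommGroup E) (_ : NormedSpace ℂ E) (_ : CompleteSpace E)
      (j : E →ₗ[ℂ] V), Function.Injective j ∧ (∀ x ∈ Submodule.span ℂ S, ∃ e, j e = x) ∧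
      (∀ e, j e ∈ Submodule.span ℂ S) ∧ ∀ e, gauge S (j e) = ‖e‖ := by
  let N : AddGroupNorm (Submodule.span ℂ S) :=
    { toFun := fun x => gauge S (x : V)
      map_zero' := gauge_zero
      add_le' := fun x y => hS.toIsDisk.gauge_add_le hne x.2 y.2
      neg' := fun x => hS.toIsDisk.gauge_neg x
      eq_zero_of_map_eq_zero' := fun x hx => Subtype.ext (hS.eq_zero x x.2 hx) }
  let _ : NormedAddCommGroup (Submodule.span ℂ S) := N.toNormedAddCommGroup
  have hN : ∀ x : Submodule.span ℂ S, ‖x‖ = gauge S (x : V) := fun x => rfl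
  let _ : NormedSpace ℂ (Submodule.span ℂ S) :=
    { norm_smul_le := fun c x => (hS.toIsDisk.gauge_smul c (x : V)).le }
  have : CompleteSpace (Submodule.span ℂ S) := by
    refine Metric.complete_of_cauchySeq_tendsto fun x hx => ?_
    rw [Metric.cauchySeq_iff] at hx
    obtain ⟨y, hy, hy'⟩ := hS.complete (fun n => (x n : V)) (fun n => (x n).2) (by
      intro ε hε
      obtain ⟨M, hM⟩ := hx ε hε
      refine ⟨M, fun m hm n hn => ?_⟩
      have := hM m hm n hn
      rwa [dist_eq_norm, hN] at this)
    refine ⟨⟨y, hy⟩, ?_⟩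
    rw [tendsto_iff_norm_sub_tendsto_zero]
    exact hy'
  exact ⟨Submodule.span ℂ S, inferInstance, inferInstance, this, (Submodule.span ℂ S).subtype,
    Subtype.val_injective, fun x hx => ⟨⟨x, hx⟩, rfl⟩, fun e => e.2, fun e => (hN e).symm⟩

/-- A set in the Banach space of a completant disk that accumulates only at the origin is contained
in a compact disk. -/
theorem exists_compact_disk [Bornology V] {D : Set V} (hD : IsBounded D) (hDn : D.Nonempty)
    (hDc : IsCompletant D) {X : Set V} (hX : X ⊆ Submodule.span ℂ D)
    (hfin : ∀ ε > 0, {x ∈ X | ε ≤ gauge D x}.Finite) :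
    ∃ K : Set V, X ⊆ K ∧ IsDisk K ∧ IsBornCompact K := by
  obtain ⟨E, _, _, _, j, hj, hsurj, hmem, hnorm⟩ := hDc.exists_banach hDn
  let _ : NormedSpace ℝ E := NormedSpace.restrictScalars ℝ ℂ E
  let N : Set E := j ⁻¹' X
  -- One ball around the origin covers all but finitely many points.
  have hN : TotallyBounded N := by
    refine Metric.totallyBounded_iff.2 fun ε hε => ?_
    refine ⟨insert 0 (j ⁻¹' {x ∈ X | ε ≤ gauge D x}),
      ((hfin ε hε).preimage hj.injOn).insert 0, fun e he => ?_⟩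
    by_cases h : ε ≤ ‖e‖
    · refine Set.mem_biUnion (x := e) (Or.inr ⟨he, ?_⟩) (Metric.mem_ball_self hε)
      rwa [hnorm]
    · refine Set.mem_biUnion (x := 0) (Or.inl rfl) ?_
      rw [mem_ball_zero_iff]
      exact not_le.1 h
  -- Multiplying by the compact unit disk of `ℂ` makes the set circled and keeps it compact; the
  -- closed convex hull is then a disk, compact because `E` is complete.
  let M : Set E := Metric.closedBall (0 : ℂ) 1 • closure N
  have hM : IsCompact M :=
    (ProperSpace.isCompact_closedBall (0 : ℂ) 1).smul_set
      (hN.closure.isCompact_of_isClosed isClosed_closure)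
  have hMb : Balanced ℂ M := by
    rintro c hc _ ⟨_, ⟨d, hd, e, he, rfl⟩, rfl⟩
    refine ⟨c * d, ?_, e, he, (smul_smul c d e).symm⟩
    rw [mem_closedBall_zero_iff] at hd ⊢
    rw [norm_mul]
    exact mul_le_one₀ hc (norm_nonneg _) hd
  have hMc : Balanced ℂ (convexHull ℝ M) := by
    rintro c hc _ ⟨e, he, rfl⟩
    have h : Convex ℝ {e : E | c • e ∈ convexHull ℝ M} := fun x hx y hy s t hs ht hst => by
      change c • (s • x + t • y) ∈ convexHull ℝ M
      rw [smul_add, smul_comm c s, smul_comm c t]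
      exact convex_convexHull ℝ M hx hy hs ht hst
    exact convexHull_min (s := M) (fun x hx =>
      show c • x ∈ convexHull ℝ M from subset_convexHull ℝ M (hMb.smul_mem hc hx)) h he
  let K : Set E := closure (convexHull ℝ M)
  have hK : IsCompact K :=
    hM.totallyBounded.convexHull.closure.isCompact_of_isClosed isClosed_closure
  have hNK : N ⊆ K := fun e he => subset_closure (subset_convexHull ℝ _
    ⟨1, by simp, e, subset_closure he, one_smul _ _⟩)
  refine ⟨j '' K, fun x hx => ?_, IsDisk.image ⟨hMc.closure,
    (convex_convexHull ℝ M).closure⟩ j, D, hD, hDc, ?_, fun u hu => ?_⟩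
  · obtain ⟨e, rfl⟩ := hsurj x (hX hx)
    exact ⟨e, hNK hx, rfl⟩
  · rintro _ ⟨e, _, rfl⟩
    exact hmem e
  · choose v hv hvu using hu
    obtain ⟨e, he, k, hk, hlim⟩ := hK.isSeqCompact hv
    refine ⟨j e, ⟨e, he, rfl⟩, k, hk, ?_⟩
    rw [tendsto_iff_norm_sub_tendsto_zero] at hlim
    refine hlim.congr fun n => ?_
    rw [← hvu, ← map_sub, hnorm]
    rfl

end Compactness

/-! ### Slices separate points under the approximation property. -/

section Separation

variable {V W X : Type u} [AddCommGroup V] [Module ℂ V] [Bornology V] [CompleteBornSpace V]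
  [AddCommGroup W] [Module ℂ W] [Bornology W] [CompleteBornSpace W]
  [AddCommGroup X] [Module ℂ X] [Bornology X] [CompleteBornSpace X]

theorem bddLin_smulRight {φ : V →ₗ[ℂ] ℂ} (hφ : BddLin φ) (x : X) : BddLin (φ.smulRight x) :=
  fun S hS => ((bddBilin_smul_right (A := X) hφ) {x} S isBounded_singleton hS).subset (by
    rintro _ ⟨v, hv, rfl⟩
    exact ⟨x, rfl, v, hv, rfl⟩)

theorem bddLin_zero {Y : Type*} [AddCommGroup Y] [Module ℂ Y] [Bornology Y] :
    BddLin (0 : V →ₗ[ℂ] Y) := fun S _ => (isBounded_singleton (x := (0 : Y))).subset (by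
    rintro _ ⟨x, _, rfl⟩
    rfl)

theorem bddLin_sum {n : ℕ} {f : Fin n → V →ₗ[ℂ] X} (h : ∀ i, BddLin (f i)) :
    BddLin (∑ i, f i) := by
  classical
  induction (Finset.univ : Finset (Fin n)) using Finset.induction_on with
  | empty => simpa using bddLin_zero
  | insert i s hi ih =>
    rw [Finset.sum_insert hi]
    exact (h i).add ih

theorem IsFiniteRank.bddLin {f : V →ₗ[ℂ] V} (hf : IsFiniteRank f) : BddLin f := by
  obtain ⟨n, φ, v, hφ, hfv⟩ := hf
  have : f = ∑ i, (φ i).smulRight (v i) := LinearMap.ext fun x => by simp [hfv]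
  rw [this]
  exact bddLin_sum fun i => bddLin_smulRight (hφ i) _

theorem bddLin_sliceLeft {ω : V →ₗ[ℂ] ℂ} (hω : BddLin ω) :
    BddLin (sliceLeft (B := W) ω hω) := BTensor.bddLin_lift _ _

theorem bddLin_sliceRight {ω : W →ₗ[ℂ] ℂ} (hω : BddLin ω) :
    BddLin (sliceRight (A := V) ω hω) := BTensor.bddLin_lift _ _

/-- If `f = ∑ φᵢ(·) vᵢ`, then `f ⊗ id` sends `z` to `∑ vᵢ ⊗ (φᵢ ⊗ id)(z)`, so it sees `z` only
through slices. -/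
theorem tmap_finiteRank {f : V →ₗ[ℂ] V} (hf : IsFiniteRank f) {z : CTensor V W}
    (hz : ∀ (ω : V →ₗ[ℂ] ℂ) (hω : BddLin ω), sliceLeft ω hω z = 0) :
    tmap f LinearMap.id hf.bddLin BddLin.id z = 0 := by
  obtain ⟨n, φ, v, hφ, hfv⟩ := id hf
  have : tmap f LinearMap.id hf.bddLin BddLin.id =
      ∑ i, BTensor.tmul ∅ (v i) ∘ₗ sliceLeft (B := W) (φ i) (hφ i) := by
    refine BTensor.ext (bddLin_tmap _ _ _ _) (bddLin_sum fun i =>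
      (BTensor.bddBilin_tmul.left _).comp (bddLin_sliceLeft _)) fun x w => ?_
    simp [tm, hfv, LinearMap.sum_apply]
  rw [this]
  simp [LinearMap.sum_apply, hz]

/-- If `V` has the approximation property then slicing the first leg separates the points of the
completed tensor product of `V` with a complete space. -/
theorem eq_zero_of_sliceLeft (hV : ApproximationProperty V) (z : CTensor V W)
    (hz : ∀ (ω : V →ₗ[ℂ] ℂ) (hω : BddLin ω), sliceLeft ω hω z = 0) : z = 0 := by
  classical
  obtain ⟨a, rfl⟩ := BTensor.mk_surjective z
  obtain ⟨S, T, hS, hT, ha⟩ := a.exists_suppIn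
  -- Each term is rebalanced as `(a p / t p) • (t p • v ⊗ w)`. The coefficients stay summable, while
  -- the vectors `t p • v` accumulate only at zero and hence lie in a compact disk, on which finite
  -- rank operators approximate the identity.
  obtain ⟨t, ht, htfin, hts⟩ := exists_weights (fun p => ‖a.1 p‖) (fun _ => norm_nonneg _)
    a.summable
  obtain ⟨D, hSD, hDn, hD, hDc⟩ := CompleteBornSpace.exists_completant' hS
  have hgD : ∀ p, a.1 p ≠ 0 → gauge D p.1 ≤ 1 := fun p hp =>
    gauge_le_one_of_mem (hSD (ha p hp).1)
  obtain ⟨K, hXK, hKd, hKc⟩ := exists_compact_disk hD hDn hDc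
    (X := {x | ∃ p, a.1 p ≠ 0 ∧ (t p : ℂ) • p.1 = x})
    (by
      rintro _ ⟨p, hp, rfl⟩
      exact Submodule.smul_mem _ _ (Submodule.subset_span (hSD (ha p hp).1)))
    (by
      intro ε hε
      refine ((htfin ε hε).image fun p => (t p : ℂ) • p.1).subset ?_
      rintro _ ⟨⟨p, hp, rfl⟩, h⟩
      refine ⟨p, ⟨by simpa using hp, ?_⟩, rfl⟩
      rw [hDc.toIsDisk.gauge_smul, Complex.norm_real, Real.norm_of_nonneg (ht p).le] at h
      exact h.trans (mul_le_of_le_one_right (ht p).le (hgD p hp)))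
  obtain ⟨f, hf, U, hU, hUd, ε, hε, hfK⟩ := hV K hKd hKc
  obtain ⟨F, hF1, hFn, hF, hFc⟩ := CompleteBornSpace.exists_completant'
    ((BTensor.bddBilin_tmul (R := ∅) U T hU hT).union
      (isBounded_singleton (x := BTensor.mk ∅ a)))
  -- A strictly positive null sequence dominating `|ε n|`, so that one may divide by it.
  let δ : ℕ → ℝ := fun n => |ε n| + 1 / ((n : ℝ) + 1)
  have hδ : ∀ n, 0 < δ n := fun n => by positivity
  have hδ0 : Tendsto δ atTop (𝓝 0) := by
    have := hε.abs.add (tendsto_one_div_add_atTop_nhds_zero_nat (𝕜 := ℝ))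
    rwa [abs_zero, add_zero] at this
  let C : ℝ := ∑' p, ‖a.1 p‖ / t p
  have hUδ : ∀ n, ∀ x ∈ K, ∃ y ∈ U, f n x - x = (δ n : ℂ) • y := by
    intro n x hx
    obtain ⟨y, hy, hyx⟩ := hfK n x hx
    refine ⟨((ε n / δ n : ℝ) : ℂ) • y, hUd.balanced.smul_mem ?_ hy, ?_⟩
    · rw [Complex.norm_real, norm_div, Real.norm_of_nonneg (hδ n).le, div_le_one (hδ n)]
      have : (0 : ℝ) ≤ 1 / ((n : ℝ) + 1) := by positivity
      simp only [δ, Real.norm_eq_abs]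
      linarith
    · rw [smul_smul, ← Complex.ofReal_mul, mul_div_cancel₀ _ (hδ n).ne', Complex.coe_smul]
      exact hyx.symm
  have key : ∀ n, gauge F (BTensor.mk ∅ a) ≤ δ n * C := by
    intro n
    let g : V →ₗ[ℂ] V := f n - LinearMap.id
    have hg : BddLin g := by
      have := (hf n).bddLin.add ((BddLin.id (A := V)).smul (-1))
      rwa [neg_one_smul, ← sub_eq_add_neg] at this
    -- The finite rank part annihilates the element, so `(f n - id) ⊗ id` acts on it as `-1`; it
    -- remains to see that this operator makes it small.
    have e1 : tmap g LinearMap.id hg BddLin.id (BTensor.mk ∅ a) = -BTensor.mk ∅ a := by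
      have e2 : tmap g (LinearMap.id : W →ₗ[ℂ] W) hg BddLin.id =
          tmap (f n) LinearMap.id (hf n).bddLin BddLin.id + (-1 : ℂ) • LinearMap.id := by
        refine BTensor.ext (X := CTensor V W) (bddLin_tmap _ _ _ _)
          ((bddLin_tmap _ _ (hf n).bddLin BddLin.id).add
            ((BddLin.id (A := CTensor V W)).smul _)) fun v w => ?_
        simp [g, tm, sub_eq_add_neg]
      rw [e2, LinearMap.add_apply, tmap_finiteRank (hf n) hz]
      simp
    have hmem : ∀ p, a.1 p ≠ 0 → ∃ y ∈ U, (t p : ℂ) • g p.1 = (δ n : ℂ) • y := by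
      intro p hp
      obtain ⟨y, hy, hyx⟩ := hUδ n _ (hXK ⟨p, hp, rfl⟩)
      refine ⟨y, hy, ?_⟩
      rw [← hyx]
      simp [g, smul_sub]
    choose! y hy hyp using hmem
    -- As `g v = (δ n / t p) • y p` with `y p ∈ U`, the image under `g ⊗ id` is a series of tensors
    -- from `U ⊗ T` whose coefficients have `ℓ¹`-norm `δ n * C`.
    let α : V × W → ℂ := fun p => a.1 p * (δ n / t p : ℝ)
    let d : V × W → CTensor V W := fun p => tm (y p) p.2
    have hα : ∀ p, ‖α p‖ = δ n * (‖a.1 p‖ / t p) := fun p => by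
      simp only [α, norm_mul, Complex.norm_real, norm_div, Real.norm_of_nonneg (hδ n).le,
        Real.norm_of_nonneg (ht p).le]
      ring
    have hαs : Summable fun p => ‖α p‖ := by
      simp only [hα]
      exact hts.mul_left _
    have hd : ∀ p, α p ≠ 0 → d p ∈ F := fun p hp => by
      have hp' : a.1 p ≠ 0 := fun h => hp (by simp [α, h])
      exact hF1 (Or.inl ⟨y p, hy p hp', p.2, (ha p hp').2, rfl⟩)
    have hterm : ∀ p, α p • d p = a.1 p • tm (g p.1) p.2 := fun p => by
      by_cases hp : a.1 p = 0
      · simp [α, hp]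
      · have htp : (t p : ℂ) ≠ 0 := by exact_mod_cast (ht p).ne'
        have : g p.1 = ((δ n / t p : ℝ) : ℂ) • y p := by
          have := hyp p hp
          rw [← eq_inv_smul_iff₀ htp, smul_smul] at this
          rw [this]
          push_cast
          congr 1
          field_simp
        rw [this]
        simp [α, d, tm, mul_smul]
    obtain ⟨x, hx, hxg, hlim⟩ := hFc.exists_sum hFn α d hd hαs
    have hsum : SeriesSum ((BTensor.tmul (V := V) (W := W) ∅).compl₁₂ g LinearMap.id) a x := by
      refine ⟨F, hF, hFn, hFc, hx, fun p hp => ?_, ?_⟩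
      · have htp : α p ≠ 0 := mul_ne_zero hp (by
          exact_mod_cast (div_pos (hδ n) (ht p)).ne')
        have h1 : a.1 p • tm (g p.1) p.2 ∈ Submodule.span ℂ F := by
          rw [← hterm]
          exact Submodule.smul_mem _ _ (Submodule.subset_span (hd p htp))
        exact (Submodule.smul_mem_iff _ hp).1 h1
      · simp only [hterm] at hlim
        exact hlim
    have e3 : tmap g LinearMap.id hg BddLin.id (BTensor.mk ∅ a) = x :=
      preLift_eq (BTensor.bddBilin_tmul.compl hg BddLin.id) hsum
    rw [e1] at e3
    rw [← hFc.toIsDisk.gauge_neg, e3]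
    refine hxg.trans (le_of_eq ?_)
    simp only [hα]
    rw [tsum_mul_left]
  refine hFc.eq_zero _ (Submodule.subset_span (hF1 (Or.inr rfl))) (le_antisymm ?_ (gauge_nonneg _))
  have := hδ0.mul_const C
  rw [zero_mul] at this
  exact ge_of_tendsto' this key

end Separation

/-! ### Bounded functionals on tensor products. -/

section Functionals

variable {V W : Type u} [AddCommGroup V] [Module ℂ V] [Bornology V] [CompleteBornSpace V]
  [AddCommGroup W] [Module ℂ W] [Bornology W] [CompleteBornSpace W]
  {R : Set ((V × W) × (V × W))}

theorem BddLin.functional_comp {φ : W →ₗ[ℂ] ℂ} {f : V →ₗ[ℂ] W} (hφ : BddLin φ) (hf : BddLin f) :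
    BddLin (φ ∘ₗ f) := fun S hS => by
  rw [LinearMap.coe_comp, Set.image_comp]
  exact hφ _ (hf _ hS)

/-- Bounded functionals on the tensor product are determined by their values on elementary
tensors. -/
theorem BTensor.functional_ext [Nontrivial V] {f g : BTensor V W R →ₗ[ℂ] ℂ} (hf : BddLin f)
    (hg : BddLin g) (h : ∀ v w, f (BTensor.tmul R v w) = g (BTensor.tmul R v w)) : f = g := by
  obtain ⟨v, hv⟩ := exists_ne (0 : V)
  -- Multiplying by a fixed nonzero vector turns functionals into maps with values in the complete
  -- space `V`, to which `BTensor.ext` applies.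
  have h1 : f.smulRight v = g.smulRight v :=
    BTensor.ext (bddLin_smulRight hf v) (bddLin_smulRight hg v) fun x y => by simp [h]
  refine LinearMap.ext fun z => ?_
  exact smul_left_injective ℂ hv (LinearMap.congr_fun h1 z)

/-- Fubini: both iterated slices are `φ ⊗ ω`. -/
theorem sliceLeft_sliceRight [Nontrivial V] {φ : V →ₗ[ℂ] ℂ} {ω : W →ₗ[ℂ] ℂ} (hφ : BddLin φ)
    (hω : BddLin ω) (z : CTensor V W) : ω (sliceLeft φ hφ z) = φ (sliceRight ω hω z) := by
  have : ω ∘ₗ sliceLeft φ hφ = φ ∘ₗ sliceRight (A := V) ω hω :=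
    BTensor.functional_ext (hω.functional_comp (bddLin_sliceLeft _))
      (hφ.functional_comp (bddLin_sliceRight _))
      fun v w => by simp [mul_comm]
  exact LinearMap.congr_fun this z

/-- The bounded functionals separate the points of `V`. -/
def IsSeparated (V : Type u) [AddCommGroup V] [Module ℂ V] [Bornology V] : Prop :=
  ∀ v : V, (∀ ω : V →ₗ[ℂ] ℂ, BddLin ω → ω v = 0) → v = 0

theorem IsSeparated.tensor (hV : ApproximationProperty V) (hW : IsSeparated W) :
    IsSeparated (CTensor V W) := fun z hz =>
  eq_zero_of_sliceLeft hV z fun ω hω => hW _ fun ω' hω' =>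
    hz (ω' ∘ₗ sliceLeft ω hω) (hω'.functional_comp (bddLin_sliceLeft _))

end Functionals

/-! ### Faithful functionals, nondegeneracy and essential algebras. -/

section Nondegenerate

/-- An algebra without nonzero elements `z` satisfying `z A = 0`. -/
def IsNondegenerate (A : Type u) [NonUnitalRing A] : Prop := ∀ z : A, (∀ y, z * y = 0) → z = 0

variable {H A : Type u} [NonUnitalRing H] [Module ℂ H] [Bornology H] [BornAlgebra H]
  [NonUnitalRing A] [Module ℂ A] [Bornology A] [BornAlgebra A]

theorem bddLin_mulLeft (a : H) : BddLin (LinearMap.mul ℂ H a) := bddBilin_mul.left a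

theorem bddLin_mulRight (a : H) : BddLin ((LinearMap.mul ℂ H).flip a) := bddBilin_mul.right a

/-- The functionals `φ(· g)` already separate points. -/
theorem IsFaithful.isSeparated {φ : H →ₗ[ℂ] ℂ} (h : IsFaithful φ) : IsSeparated H := fun v hv =>
  h.left v fun g => hv (φ ∘ₗ (LinearMap.mul ℂ H).flip g) (h.bdd.functional_comp (bddLin_mulRight g))

theorem IsFaithful.isNondegenerate {φ : H →ₗ[ℂ] ℂ} (h : IsFaithful φ) : IsNondegenerate H :=
  fun f hf => h.left f fun g => by rw [hf, map_zero]

theorem IsFaithful.exists_eq_one [Nontrivial H] {φ : H →ₗ[ℂ] ℂ} (h : IsFaithful φ) :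
    ∃ g, φ g = 1 := by
  obtain ⟨f, hf⟩ := exists_ne (0 : H)
  by_contra! h0
  refine hf (h.left f fun g => ?_)
  by_contra h1
  exact h0 ((φ (f * g))⁻¹ • (f * g)) (by simp [h1])

theorem sliceLeft_mul_tm {ω : H →ₗ[ℂ] ℂ} (hω : BddLin ω) (z : CTensor H A) (h : H) (w : A) :
    sliceLeft ω hω (z * tm h w) =
      sliceLeft (ω ∘ₗ (LinearMap.mul ℂ H).flip h) (hω.functional_comp (bddLin_mulRight h)) z * w := by
  have : sliceLeft ω hω ∘ₗ (LinearMap.mul ℂ (CTensor H A)).flip (tm h w) =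
      (LinearMap.mul ℂ A).flip w ∘ₗ
        sliceLeft (ω ∘ₗ (LinearMap.mul ℂ H).flip h) (hω.functional_comp (bddLin_mulRight h)) :=
    BTensor.ext ((bddLin_sliceLeft _).comp (bddLin_mulRight _))
      ((bddLin_mulRight _).comp (bddLin_sliceLeft _)) fun a b => by simp
  exact LinearMap.congr_fun this z

/-- Nondegeneracy is used one leg at a time. Slicing `z(h ⊗ w) = 0` by `ω` gives `(ω(· h) ⊗ id)(z) w
= 0`, which removes `w`. Slicing the second leg by `ω'` then gives `ω((id ⊗ ω')(z) h) = 0` for all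
`ω` and `h`, so the right slices of `z` vanish. By Fubini the left slices vanish as well. -/
theorem eq_zero_of_mul_tm [Nontrivial H] (hAP : ApproximationProperty H) (hH : IsSeparated H)
    (hH' : IsNondegenerate H) (hA : IsSeparated A) (hA' : IsNondegenerate A) (z : CTensor H A)
    (hz : ∀ h w, z * tm h w = 0) : z = 0 := by
  refine eq_zero_of_sliceLeft hAP z fun ω hω => ?_
  have h1 : ∀ (ω' : A →ₗ[ℂ] ℂ) (hω' : BddLin ω'), sliceRight ω' hω' z = 0 := fun ω' hω' => by
    refine hH' _ fun h => hH _ fun ω hω => ?_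
    have h2 := sliceLeft_sliceRight (hω.functional_comp (bddLin_mulRight h)) hω' z
    have h3 : sliceLeft (ω ∘ₗ (LinearMap.mul ℂ H).flip h) (hω.functional_comp (bddLin_mulRight h)) z =
        0 :=
      hA' _ fun w => by rw [← sliceLeft_mul_tm hω, hz, map_zero]
    rw [h3, map_zero] at h2
    exact h2.symm
  refine hA _ fun ω' hω' => ?_
  rw [sliceLeft_sliceRight hω hω', h1, map_zero]

theorem IsNondegenerate.tensor [Nontrivial H] (hAP : ApproximationProperty H)
    (hH : IsSeparated H) (hH' : IsNondegenerate H) (hA : IsSeparated A)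
    (hA' : IsNondegenerate A) : IsNondegenerate (CTensor H A) :=
  fun z hz => eq_zero_of_mul_tm hAP hH hH' hA hA' z fun _ _ => hz _

/-- Bounded maps on an essential algebra are determined by their values on products. -/
theorem IsEssentialAlgebra.ext_mul (hH : IsEssentialAlgebra H) {X : Type u} [AddCommGroup X]
    [Module ℂ X] [Bornology X] [CompleteBornSpace X] {f g : H →ₗ[ℂ] X} (hf : BddLin f)
    (hg : BddLin g) (h : ∀ a b, f (a * b) = g (a * b)) : f = g := by
  obtain ⟨_, e, he, hmul⟩ := hH
  have : f ∘ₗ e.toLinearMap = g ∘ₗ e.toLinearMap :=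
    BTensor.ext (hf.comp he.1) (hg.comp he.1) fun a b => by simp [hmul, h]
  refine LinearMap.ext fun x => ?_
  simpa using LinearMap.congr_fun this (e.symm x)

theorem IsEssentialAlgebra.functional_ext_mul (hH : IsEssentialAlgebra H) {f g : H →ₗ[ℂ] ℂ}
    (hf : BddLin f) (hg : BddLin g) (h : ∀ a b, f (a * b) = g (a * b)) : f = g := by
  obtain ⟨_, e, he, hmul⟩ := hH
  have : f ∘ₗ e.toLinearMap = g ∘ₗ e.toLinearMap :=
    BTensor.functional_ext (hf.functional_comp he.1) (hg.functional_comp he.1) fun a b => by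
      simp [hmul, h]
  refine LinearMap.ext fun x => ?_
  simpa using LinearMap.congr_fun this (e.symm x)

end Nondegenerate

/-! ### Evaluation rules for left multipliers. -/

namespace Multiplier

variable {A B : Type u} [NonUnitalRing A] [Module ℂ A] [Bornology A] [BornAlgebra A]
  [NonUnitalRing B] [Module ℂ B] [Bornology B] [BornAlgebra B]

@[simp]
theorem incl_L (a x : A) : (incl A a).L x = a * x := rfl

@[simp]
theorem mul_L_apply (m n : Multiplier A) (x : A) : (m * n).L x = m.L (n.L x) := rfl

@[simp]
theorem one_L (x : A) : (1 : Multiplier A).L x = x := rfl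

@[simp]
theorem tensor_L_tm (m : Multiplier A) (n : Multiplier B) (a : A) (b : B) :
    (m.tensor n).L (tm a b) = tm (m.L a) (n.L b) :=
  tmap_tm _ _ m.bddLin_L n.bddLin_L _ _

end Multiplier

/-! ### Galois maps as one-variable maps, and multiplicativity of the comultiplication. -/

namespace BornQuantumGroup

open Multiplier

variable {H : Type u} [NonUnitalRing H] [Module ℂ H] [Bornology H] [BornAlgebra H]
  (Q : BornQuantumGroup H)

theorem nontrivial (Q : BornQuantumGroup H) : Nontrivial H := Q.essential.1

theorem isSeparated (Q : BornQuantumGroup H) : IsSeparated H := Q.haar_faithful.isSeparated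

theorem isNondegenerate (Q : BornQuantumGroup H) : IsNondegenerate H :=
  Q.haar_faithful.isNondegenerate

theorem isSeparated_tensor (Q : BornQuantumGroup H) : IsSeparated (CTensor H H) :=
  .tensor Q.approximation Q.isSeparated

theorem isNondegenerate_tensor (Q : BornQuantumGroup H) : IsNondegenerate (CTensor H H) :=
  have := Q.nontrivial
  .tensor Q.approximation Q.isSeparated Q.isNondegenerate Q.isSeparated Q.isNondegenerate

/-- The map `f ↦ Δ(f) (g ⊗ 1)`. -/
noncomputable def gl (g : H) : H →ₗ[ℂ] CTensor H H :=
  Q.galois.gammaL.toLinearMap ∘ₗ (BTensor.tmul ∅).flip g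

/-- The map `f ↦ Δ(f) (1 ⊗ g)`. -/
noncomputable def gr (g : H) : H →ₗ[ℂ] CTensor H H :=
  Q.galois.gammaR.toLinearMap ∘ₗ (BTensor.tmul ∅).flip g

/-- The map `f ↦ (a ⊗ 1) Δ(f)`. -/
noncomputable def rl (a : H) : H →ₗ[ℂ] CTensor H H :=
  Q.galois.rhoL.toLinearMap ∘ₗ BTensor.tmul ∅ a

/-- The map `f ↦ (1 ⊗ a) Δ(f)`. -/
noncomputable def rr (a : H) : H →ₗ[ℂ] CTensor H H :=
  Q.galois.rhoR.toLinearMap ∘ₗ BTensor.tmul ∅ a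

theorem bddLin_gl (g : H) : BddLin (Q.gl g) :=
  BddLin.comp Q.galois.gammaL_iso.1 (BTensor.bddBilin_tmul.right g)

theorem bddLin_gr (g : H) : BddLin (Q.gr g) :=
  BddLin.comp Q.galois.gammaR_iso.1 (BTensor.bddBilin_tmul.right g)

theorem bddLin_rl (a : H) : BddLin (Q.rl a) :=
  BddLin.comp Q.galois.rhoL_iso.1 (BTensor.bddBilin_tmul.left a)

theorem bddLin_rr (a : H) : BddLin (Q.rr a) :=
  BddLin.comp Q.galois.rhoR_iso.1 (BTensor.bddBilin_tmul.left a)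

theorem gammaL_tm (f g : H) : Q.galois.gammaL (tm f g) = Q.gl g f := rfl

theorem gammaR_tm (f g : H) : Q.galois.gammaR (tm f g) = Q.gr g f := rfl

theorem rhoL_tm (a f : H) : Q.galois.rhoL (tm a f) = Q.rl a f := rfl

theorem rhoR_tm (a f : H) : Q.galois.rhoR (tm a f) = Q.rr a f := rfl

/-- The identity defining `γ_l` holds in the multiplier algebra; it is read here as an action on
`u`. The next three lemmas do the same for the other Galois maps. -/
theorem gl_mul (f g : H) (u : CTensor H H) :
    Q.gl g f * u = (Q.comul f).L (((incl H g).tensor 1).L u) :=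
  congrArg (fun m : Multiplier (CTensor H H) => m.L u) (Q.galois.gammaL_tm f g)

theorem gr_mul (f g : H) (u : CTensor H H) :
    Q.gr g f * u = (Q.comul f).L ((Multiplier.tensor 1 (incl H g)).L u) :=
  congrArg (fun m : Multiplier (CTensor H H) => m.L u) (Q.galois.gammaR_tm f g)

theorem rl_mul (a f : H) (u : CTensor H H) :
    Q.rl a f * u = ((incl H a).tensor 1).L ((Q.comul f).L u) :=
  congrArg (fun m : Multiplier (CTensor H H) => m.L u) (Q.galois.rhoL_tm a f)

theorem rr_mul (a f : H) (u : CTensor H H) :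
    Q.rr a f * u = (Multiplier.tensor 1 (incl H a)).L ((Q.comul f).L u) :=
  congrArg (fun m : Multiplier (CTensor H H) => m.L u) (Q.galois.rhoR_tm a f)

theorem comul_mul_L (x y : H) (u : CTensor H H) :
    (Q.comul (x * y)).L u = (Q.comul x).L ((Q.comul y).L u) := by
  rw [Q.isComultiplication.map_mul, mul_L_apply]

/-- The way back from multipliers to elements of `H ⊗ H`, by nondegeneracy. -/
theorem eq_of_mul_eq (Q : BornQuantumGroup H) {z w : CTensor H H} (h : ∀ u, z * u = w * u) : z = w :=
  sub_eq_zero.1 (Q.isNondegenerate_tensor _ fun u => by rw [sub_mul, h, sub_self])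

theorem gl_mul_left (x f g : H) : Q.gl g (x * f) = (Q.comul x).L (Q.gl g f) :=
  Q.eq_of_mul_eq fun u => by rw [← Multiplier.L_mul, gl_mul, gl_mul, comul_mul_L]

theorem gr_mul_left (x f g : H) : Q.gr g (x * f) = (Q.comul x).L (Q.gr g f) :=
  Q.eq_of_mul_eq fun u => by rw [← Multiplier.L_mul, gr_mul, gr_mul, comul_mul_L]

/-! ### The modular isomorphism, and uniqueness from a right invariant functional. -/

section Modular

variable {φ ψ : H →ₗ[ℂ] ℂ}

/-- On `w = f ⊗ g` the element under `ψ ⊗ φ` is `Δ(x)Δ(f)(1 ⊗ g) = Δ(xf)(1 ⊗ g)`, and right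
invariance gives `ψ(xf)φ(g)`. -/
theorem pairing_comul_gammaR (hφ : BddLin φ) (hψ : BddLin ψ)
    (h : ∀ f g, sliceLeft ψ hψ (Q.gr g f) = ψ f • g) (x : H) (w : CTensor H H) :
    φ (sliceLeft ψ hψ ((Q.comul x).L (Q.galois.gammaR w))) = ψ (x * sliceRight φ hφ w) := by
  have := Q.nontrivial
  have e : sliceLeft ψ hψ ∘ₗ (Q.comul x).L ∘ₗ Q.galois.gammaR.toLinearMap =
      sliceLeft (ψ ∘ₗ LinearMap.mul ℂ H x) (hψ.functional_comp (bddLin_mulLeft x)) :=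
    BTensor.ext ((bddLin_sliceLeft _).comp (((Q.comul x).bddLin_L).comp Q.galois.gammaR_iso.1))
      (bddLin_sliceLeft _) fun f g => by
        simp only [LinearMap.comp_apply, LinearEquiv.coe_coe, gammaR_tm, ← gr_mul_left, h,
          sliceLeft_tm, LinearMap.mul_apply']
  have e' := LinearMap.congr_fun e w
  simp only [LinearMap.comp_apply, LinearEquiv.coe_coe] at e'
  rw [e', sliceLeft_sliceRight _ hφ]
  rfl

/-- The counterpart with `Δ(xf)(g ⊗ 1)` and left invariance; on `w = f ⊗ g` the value is
`φ(xf)ψ(g)`. -/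
theorem pairing_comul_gammaL (hφ : IsLeftInvariant Q.galois φ) (hψ : BddLin ψ)
    (x : H) (w : CTensor H H) :
    φ (sliceLeft ψ hψ ((Q.comul x).L (Q.galois.gammaL w))) = φ (x * sliceRight ψ hψ w) := by
  have := Q.nontrivial
  have e : sliceRight φ hφ.bdd ∘ₗ (Q.comul x).L ∘ₗ Q.galois.gammaL.toLinearMap =
      sliceLeft (φ ∘ₗ LinearMap.mul ℂ H x) (hφ.bdd.functional_comp (bddLin_mulLeft x)) :=
    BTensor.ext ((bddLin_sliceRight _).comp (((Q.comul x).bddLin_L).comp Q.galois.gammaL_iso.1))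
      (bddLin_sliceLeft _) fun f g => by
        simp only [LinearMap.comp_apply, LinearEquiv.coe_coe, gammaL_tm, ← gl_mul_left,
          sliceLeft_tm, LinearMap.mul_apply']
        exact hφ.left _ _
  have e' := LinearMap.congr_fun e w
  simp only [LinearMap.comp_apply, LinearEquiv.coe_coe] at e'
  rw [sliceLeft_sliceRight hψ hφ.bdd, e', sliceLeft_sliceRight _ hψ]
  rfl

/-- The map `f ↦ (id ⊗ ψ) γ_l⁻¹ γ_r (f ⊗ g)`. -/
noncomputable def modularMap (hψ : BddLin ψ) (g : H) : H →ₗ[ℂ] H :=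
  sliceRight ψ hψ ∘ₗ Q.galois.gammaL.symm.toLinearMap ∘ₗ Q.gr g

/-- The map `f ↦ (id ⊗ φ) γ_r⁻¹ γ_l (f ⊗ g)`. -/
noncomputable def modularMapInv (hφ : BddLin φ) (g : H) : H →ₗ[ℂ] H :=
  sliceRight φ hφ ∘ₗ Q.galois.gammaR.symm.toLinearMap ∘ₗ Q.gl g

theorem bddLin_modularMap (hψ : BddLin ψ) (g : H) : BddLin (Q.modularMap hψ g) :=
  (bddLin_sliceRight _).comp (BddLin.comp Q.galois.gammaL_iso.2 (Q.bddLin_gr g))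

theorem bddLin_modularMapInv (hφ : BddLin φ) (g : H) : BddLin (Q.modularMapInv hφ g) :=
  (bddLin_sliceRight _).comp (BddLin.comp Q.galois.gammaR_iso.2 (Q.bddLin_gl g))

/-- Both pairing formulas are applied to the single element `Δ(x)γ_r(f ⊗ g)`, written once through
`γ_l` and once through `γ_r`. -/
theorem modularMap_spec (hφ : IsLeftInvariant Q.galois φ) (hψ : BddLin ψ)
    (h : ∀ f g, sliceLeft ψ hψ (Q.gr g f) = ψ f • g) (x f g : H) :
    φ (x * Q.modularMap hψ g f) = φ g * ψ (x * f) := by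
  have h1 := Q.pairing_comul_gammaL hφ hψ x (Q.galois.gammaL.symm (Q.gr g f))
  have h2 := Q.pairing_comul_gammaR hφ.bdd hψ h x (tm f g)
  rw [LinearEquiv.apply_symm_apply] at h1
  rw [gammaR_tm] at h2
  refine h1.symm.trans (h2.trans ?_)
  simp [mul_smul_comm]

theorem modularMapInv_spec (hφ : IsLeftInvariant Q.galois φ) (hψ : BddLin ψ)
    (h : ∀ f g, sliceLeft ψ hψ (Q.gr g f) = ψ f • g) (x f g : H) :
    ψ (x * Q.modularMapInv hφ.bdd g f) = ψ g * φ (x * f) := by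
  have h1 := Q.pairing_comul_gammaR hφ.bdd hψ h x (Q.galois.gammaR.symm (Q.gl g f))
  have h2 := Q.pairing_comul_gammaL hφ hψ x (tm f g)
  rw [LinearEquiv.apply_symm_apply] at h1
  rw [gammaL_tm] at h2
  refine h1.symm.trans (h2.trans ?_)
  simp [mul_smul_comm]

/-- Faithful left and right invariant functionals differ by a bornological isomorphism. -/
theorem exists_modular_iso (hφ : IsFaithful φ) (hφl : IsLeftInvariant Q.galois φ)
    (hψ : IsFaithful ψ) (hψr : IsRightInvariant Q.galois ψ) :
    ∃ ν : H ≃ₗ[ℂ] H, IsBornIso ν ∧ ∀ f h, ψ (h * f) = φ (h * ν f) := by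
  have := Q.nontrivial
  obtain ⟨a, ha⟩ := hφ.exists_eq_one
  obtain ⟨b, hb⟩ := hψ.exists_eq_one
  have h1 := fun x f => Q.modularMap_spec hφl hψr.bdd hψr.left x f a
  have h2 := fun x f => Q.modularMapInv_spec hφl hψr.bdd hψr.left x f b
  simp only [ha, hb, one_mul] at h1 h2
  refine ⟨LinearEquiv.ofLinearMap (Q.modularMap hψr.bdd a) (Q.modularMapInv hφl.bdd b) ?_ ?_,
    ⟨Q.bddLin_modularMap hψr.bdd a, Q.bddLin_modularMapInv hφl.bdd b⟩, fun f h => (h1 h f).symm⟩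
  -- Here `φ(x ν(ν'(f))) = ψ(x ν'(f)) = φ(xf)` for all `x`, and faithfulness of `φ` removes `x`; the
  -- other composite uses that of `ψ`.
  · refine LinearMap.ext fun f => sub_eq_zero.1 (hφ.right _ fun x => ?_)
    simp [mul_sub, h1, h2]
  · refine LinearMap.ext fun f => sub_eq_zero.1 (hψ.right _ fun x => ?_)
    simp [mul_sub, h1, h2]

/-- Uniqueness of the left Haar functional, given a nonzero right invariant functional. -/
theorem eq_smul_haar_of_rightInvariant (hψ : BddLin ψ) (h0 : ψ ≠ 0)
    (h : ∀ f g, sliceLeft ψ hψ (Q.gr g f) = ψ f • g) (hφ : IsLeftInvariant Q.galois φ) :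
    ∃ c : ℂ, φ = c • Q.haar := by
  have := Q.nontrivial
  obtain ⟨a, ha⟩ := Q.haar_faithful.exists_eq_one
  obtain ⟨b, hb⟩ : ∃ b, ψ b = 1 := by
    obtain ⟨b, hb⟩ := DFunLike.ne_iff.1 h0
    rw [LinearMap.zero_apply] at hb
    exact ⟨(ψ b)⁻¹ • b, by simp [hb]⟩
  have h1 := fun x f => Q.modularMap_spec Q.haar_leftInvariant hψ h x f a
  have h2 := fun x f => Q.modularMapInv_spec Q.haar_leftInvariant hψ h x f b
  -- The modular map involves only `ψ` and `a`, so it is the same map for `φ` as for the Haar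
  -- functional.
  have h3 := fun x f => Q.modularMap_spec hφ hψ h x f a
  simp only [ha, hb, one_mul] at h1 h2
  refine ⟨φ a, Q.essential.functional_ext_mul hφ.bdd ?_ fun x y => ?_⟩
  · exact Q.haar_leftInvariant.bdd.functional_comp
      ((BddLin.id (A := H)).smul (φ a)) |> fun h => by
        rwa [LinearMap.comp_smul, LinearMap.comp_id] at h
  -- Faithfulness of the Haar functional gives a right inverse of the modular map, so every `y` is a
  -- value `ν(y')`; then `φ(xy) = φ(a)ψ(xy')`, and `ψ(xy')` is the Haar functional at `xy`.
  · have hy : Q.modularMap hψ a (Q.modularMapInv Q.haar_leftInvariant.bdd b y) = y :=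
      sub_eq_zero.1 (Q.haar_faithful.right _ fun x => by simp [mul_sub, h1, h2])
    rw [← hy, h3, LinearMap.smul_apply, h1, smul_eq_mul]

end Modular

end BornQuantumGroup

/-! ### Extensionality on triple tensor products. -/

section Ext

variable {A B C X : Type u} [AddCommGroup A] [Module ℂ A] [Bornology A]
  [AddCommGroup B] [Module ℂ B] [Bornology B] [AddCommGroup C] [Module ℂ C] [Bornology C]
  [AddCommGroup X] [Module ℂ X] [Bornology X] [CompleteBornSpace X]

theorem BTensor.ext_left {f g : CTensor (CTensor A B) C →ₗ[ℂ] X} (hf : BddLin f) (hg : BddLin g)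
    (h : ∀ a b c, f (tm (tm a b) c) = g (tm (tm a b) c)) : f = g := by
  refine BTensor.ext hf hg fun w c => ?_
  have : f ∘ₗ (BTensor.tmul ∅).flip c = g ∘ₗ (BTensor.tmul ∅).flip c :=
    BTensor.ext (hf.comp (BTensor.bddBilin_tmul.right c))
      (hg.comp (BTensor.bddBilin_tmul.right c)) fun a b => h a b c
  exact LinearMap.congr_fun this w

theorem BTensor.ext_right {f g : CTensor A (CTensor B C) →ₗ[ℂ] X} (hf : BddLin f) (hg : BddLin g)
    (h : ∀ a b c, f (tm a (tm b c)) = g (tm a (tm b c))) : f = g := by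
  refine BTensor.ext hf hg fun a w => ?_
  have : f ∘ₗ BTensor.tmul ∅ a = g ∘ₗ BTensor.tmul ∅ a :=
    BTensor.ext (hf.comp (BTensor.bddBilin_tmul.left a))
      (hg.comp (BTensor.bddBilin_tmul.left a)) fun b c => h a b c
  exact LinearMap.congr_fun this w

theorem bddLin_assocMap : BddLin (assocMap A B C) := BTensor.bddLin_lift _ _

end Ext

/-! ### Multipliers and the associativity map. -/

namespace Multiplier

variable {A B C : Type u} [NonUnitalRing A] [Module ℂ A] [Bornology A] [BornAlgebra A]
  [NonUnitalRing B] [Module ℂ B] [Bornology B] [BornAlgebra B]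
  [NonUnitalRing C] [Module ℂ C] [Bornology C] [BornAlgebra C]

theorem mul_incl (m : Multiplier A) (x : A) : m * incl A x = incl A (m.L x) := by
  refine Subtype.ext (Prod.ext (LinearMap.ext fun z => ?_) (LinearMap.ext fun z => ?_))
  · exact m.L_mul x z
  · exact (m.mul_L z x).symm

theorem isBounded_iff {M : Set (Multiplier A)} : IsBounded M ↔ ∀ S : Set A, IsBounded S →
    IsBounded {x | ∃ m ∈ M, ∃ a ∈ S, m.L a = x} ∧ IsBounded {x | ∃ m ∈ M, ∃ a ∈ S, m.R a = x} :=
  Bornology.isBounded_ofBounded_iff _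

theorem bddLin_incl : BddLin (incl A) := by
  refine fun S hS => isBounded_iff.2 fun T hT =>
    ⟨(BornAlgebra.isBounded_mul S T hS hT).subset ?_,
      (BornAlgebra.isBounded_mul T S hT hS).subset ?_⟩
  · rintro _ ⟨_, ⟨a, ha, rfl⟩, b, hb, rfl⟩
    exact Set.mul_mem_mul ha hb
  · rintro _ ⟨_, ⟨a, ha, rfl⟩, b, hb, rfl⟩
    exact Set.mul_mem_mul hb ha

/-- Evaluation `m ↦ m x`. -/
def evalL (x : A) : Multiplier A →ₗ[ℂ] A where
  toFun m := m.L x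
  map_add' _ _ := rfl
  map_smul' _ _ := rfl

theorem bddLin_evalL (x : A) : BddLin (evalL x) := fun M hM =>
  ((isBounded_iff.1 hM) {x} isBounded_singleton).1.subset (by
    rintro _ ⟨m, hm, rfl⟩
    exact ⟨m, hm, x, rfl, rfl⟩)

theorem assocMap_mul (x y : CTensor (CTensor A B) C) :
    assocMap A B C (x * y) = assocMap A B C x * assocMap A B C y := by
  have h1 : ∀ a b c, assocMap A B C ∘ₗ LinearMap.mul ℂ _ (tm (tm a b) c) =
      LinearMap.mul ℂ _ (tm a (tm b c)) ∘ₗ assocMap A B C := fun a b c =>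
    BTensor.ext_left (bddLin_assocMap.comp (bddLin_mulLeft _))
      ((bddLin_mulLeft _).comp bddLin_assocMap) fun a' b' c' => by simp
  have h2 : assocMap A B C ∘ₗ (LinearMap.mul ℂ _).flip y =
      (LinearMap.mul ℂ _).flip (assocMap A B C y) ∘ₗ assocMap A B C :=
    BTensor.ext_left (bddLin_assocMap.comp (bddLin_mulRight _))
      ((bddLin_mulRight _).comp bddLin_assocMap) fun a b c => by
        simpa using LinearMap.congr_fun (h1 a b c) y
  exact LinearMap.congr_fun h2 x

theorem assocMap_tensor_left (m : Multiplier A) (x : CTensor (CTensor A B) C) :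
    assocMap A B C (((m.tensor (1 : Multiplier B)).tensor (1 : Multiplier C)).L x) =
      (m.tensor (1 : Multiplier (CTensor B C))).L (assocMap A B C x) := by
  have : assocMap A B C ∘ₗ ((m.tensor (1 : Multiplier B)).tensor (1 : Multiplier C)).L =
      (m.tensor (1 : Multiplier (CTensor B C))).L ∘ₗ assocMap A B C :=
    BTensor.ext_left (bddLin_assocMap.comp (bddLin_L _)) ((bddLin_L _).comp bddLin_assocMap)
      fun a b c => by simp
  exact LinearMap.congr_fun this x

theorem assocMap_tensor_right (m : Multiplier C) (x : CTensor (CTensor A B) C) :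
    assocMap A B C (((1 : Multiplier (CTensor A B)).tensor m).L x) =
      ((1 : Multiplier A).tensor ((1 : Multiplier B).tensor m)).L (assocMap A B C x) := by
  have : assocMap A B C ∘ₗ ((1 : Multiplier (CTensor A B)).tensor m).L =
      ((1 : Multiplier A).tensor ((1 : Multiplier B).tensor m)).L ∘ₗ assocMap A B C :=
    BTensor.ext_left (bddLin_assocMap.comp (bddLin_L _)) ((bddLin_L _).comp bddLin_assocMap)
      fun a b c => by simp
  exact LinearMap.congr_fun this x

end Multiplier

/-! ### Coassociativity in terms of elements. -/

namespace BornQuantumGroup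

open Multiplier

variable {H : Type u} [NonUnitalRing H] [Module ℂ H] [Bornology H] [BornAlgebra H]
  (Q : BornQuantumGroup H)

/-- Bounded maps on `H ⊗ H` are determined by their values on `Δ(H) (H ⊗ H)`. -/
theorem ext_comul {X : Type u} [AddCommGroup X] [Module ℂ X] [Bornology X] [CompleteBornSpace X]
    {f g : CTensor H H →ₗ[ℂ] X} (hf : BddLin f) (hg : BddLin g)
    (h : ∀ a u, f ((Q.comul a).L u) = g ((Q.comul a).L u)) : f = g := by
  -- Since `γ_l` is onto, `z` may be taken of the form `Δ(a)(b ⊗ 1)`, and then `z u = Δ(a)((b ⊗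
  -- 1)u)`.
  have h1 : ∀ z u, f (z * u) = g (z * u) := fun z u => by
    have : f ∘ₗ (LinearMap.mul ℂ _).flip u ∘ₗ Q.galois.gammaL.toLinearMap =
        g ∘ₗ (LinearMap.mul ℂ _).flip u ∘ₗ Q.galois.gammaL.toLinearMap :=
      BTensor.ext (hf.comp ((bddLin_mulRight u).comp Q.galois.gammaL_iso.1))
        (hg.comp ((bddLin_mulRight u).comp Q.galois.gammaL_iso.1)) fun a b => by
          simp [gammaL_tm, gl_mul, h]
    simpa using LinearMap.congr_fun this (Q.galois.gammaL.symm z)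
  refine BTensor.ext hf hg fun p q => ?_
  -- Essentiality reduces each leg to products, and `ab ⊗ cd = (a ⊗ c)(b ⊗ d)`.
  have h2 : ∀ c d, f ∘ₗ (BTensor.tmul ∅).flip (c * d) = g ∘ₗ (BTensor.tmul ∅).flip (c * d) :=
    fun c d => Q.essential.ext_mul (hf.comp (BTensor.bddBilin_tmul.right _))
      (hg.comp (BTensor.bddBilin_tmul.right _)) fun a b => by
        have := h1 (tm a c) (tm b d)
        rw [tm_mul_tm] at this
        exact this
  have h3 : f ∘ₗ BTensor.tmul ∅ p = g ∘ₗ BTensor.tmul ∅ p :=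
    Q.essential.ext_mul (hf.comp (BTensor.bddBilin_tmul.left _))
      (hg.comp (BTensor.bddBilin_tmul.left _)) fun c d => LinearMap.congr_fun (h2 c d) p
  exact LinearMap.congr_fun h3 q

variable {E₁ : Multiplier (CTensor H H) →ₗ[ℂ] Multiplier (CTensor (CTensor H H) H)}
  {E₂ : Multiplier (CTensor H H) →ₗ[ℂ] Multiplier (CTensor H (CTensor H H))}

/-- The extension is prescribed only on `H ⊗ H`, so its value at `1 ⊗ y` is found by multiplying
with `a ⊗ b`: as `(1 ⊗ y)(a ⊗ b) = a ⊗ yb`, the action is known on all `Δ(a)u ⊗ bc`. By `ext_comul`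
and essentiality these determine a bounded map. -/
theorem extension_one_tensor (hE : IsUnitalHom E₁)
    (h : ∀ a b, E₁ (incl _ (tm a b)) = (Q.comul a).tensor (incl H b)) (y : H) :
    (E₁ ((1 : Multiplier H).tensor (incl H y))).L =
      ((1 : Multiplier (CTensor H H)).tensor (incl H y)).L := by
  have key : ∀ a b u c, (E₁ ((1 : Multiplier H).tensor (incl H y))).L
      (tm ((Q.comul a).L u) (b * c)) = tm ((Q.comul a).L u) (y * (b * c)) := fun a b u c => by
    have h1 : E₁ ((1 : Multiplier H).tensor (incl H y)) * (Q.comul a).tensor (incl H b) =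
        (Q.comul a).tensor (incl H (y * b)) := by
      rw [← h, ← hE.map_mul, mul_incl, ← h]
      simp
    have := congrArg (fun m : Multiplier (CTensor (CTensor H H) H) => m.L (tm u c)) h1
    simpa [mul_assoc] using this
  refine BTensor.ext (bddLin_L _) (bddLin_L _) fun w v => ?_
  have h2 : (E₁ ((1 : Multiplier H).tensor (incl H y))).L ∘ₗ BTensor.tmul ∅ w =
      ((1 : Multiplier (CTensor H H)).tensor (incl H y)).L ∘ₗ BTensor.tmul ∅ w := by
    refine Q.essential.ext_mul ((bddLin_L _).comp (BTensor.bddBilin_tmul.left _))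
      ((bddLin_L _).comp (BTensor.bddBilin_tmul.left _)) fun b c => ?_
    have h3 : (E₁ ((1 : Multiplier H).tensor (incl H y))).L ∘ₗ (BTensor.tmul ∅).flip (b * c) =
        ((1 : Multiplier (CTensor H H)).tensor (incl H y)).L ∘ₗ (BTensor.tmul ∅).flip (b * c) :=
      Q.ext_comul ((bddLin_L _).comp (BTensor.bddBilin_tmul.right _))
        ((bddLin_L _).comp (BTensor.bddBilin_tmul.right _)) fun a u => by
          refine (key a b u c).trans ?_
          simp
    exact LinearMap.congr_fun h3 w
  exact LinearMap.congr_fun h2 v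

/-- Mirror image of `extension_one_tensor`, with the legs exchanged. -/
theorem extension_tensor_one (hE : IsUnitalHom E₂)
    (h : ∀ a b, E₂ (incl _ (tm a b)) = (incl H a).tensor (Q.comul b)) (y : H) :
    (E₂ ((incl H y).tensor (1 : Multiplier H))).L =
      ((incl H y).tensor (1 : Multiplier (CTensor H H))).L := by
  have key : ∀ a b u c, (E₂ ((incl H y).tensor (1 : Multiplier H))).L
      (tm (b * c) ((Q.comul a).L u)) = tm (y * (b * c)) ((Q.comul a).L u) := fun a b u c => by
    have h1 : E₂ ((incl H y).tensor (1 : Multiplier H)) * (incl H b).tensor (Q.comul a) =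
        (incl H (y * b)).tensor (Q.comul a) := by
      rw [← h, ← hE.map_mul, mul_incl, ← h]
      simp
    have := congrArg (fun m : Multiplier (CTensor H (CTensor H H)) => m.L (tm c u)) h1
    simpa [mul_assoc] using this
  refine BTensor.ext (bddLin_L _) (bddLin_L _) fun v w => ?_
  have h2 : (E₂ ((incl H y).tensor (1 : Multiplier H))).L ∘ₗ (BTensor.tmul ∅).flip w =
      ((incl H y).tensor (1 : Multiplier (CTensor H H))).L ∘ₗ (BTensor.tmul ∅).flip w := by
    refine Q.essential.ext_mul ((bddLin_L _).comp (BTensor.bddBilin_tmul.right _))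
      ((bddLin_L _).comp (BTensor.bddBilin_tmul.right _)) fun b c => ?_
    have h3 : (E₂ ((incl H y).tensor (1 : Multiplier H))).L ∘ₗ BTensor.tmul ∅ (b * c) =
        ((incl H y).tensor (1 : Multiplier (CTensor H H))).L ∘ₗ BTensor.tmul ∅ (b * c) :=
      Q.ext_comul ((bddLin_L _).comp (BTensor.bddBilin_tmul.left _))
        ((bddLin_L _).comp (BTensor.bddBilin_tmul.left _)) fun a u => by
          refine (key a b u c).trans ?_
          simp
    exact LinearMap.congr_fun h3 w
  exact LinearMap.congr_fun h2 v

theorem bddLin_extension {A : Type u} [NonUnitalRing A] [Module ℂ A] [Bornology A]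
    [BornAlgebra A] {E : Multiplier (CTensor H H) →ₗ[ℂ] Multiplier A} (hE : IsUnitalHom E)
    (x : A) : BddLin (evalL x ∘ₗ E ∘ₗ incl (CTensor H H)) :=
  (bddLin_evalL x).comp (hE.bdd.comp bddLin_incl)

/-- Multiplication by `a` in the first leg turns the multiplier `(Δ ⊗ id)(w)` into an element of the
triple tensor product. This is checked for `w = p ⊗ r` and extends to all `w` by boundedness. The
next three lemmas treat the other placements of `a`. -/
theorem extension_rl (hE : IsUnitalHom E₁)
    (h : ∀ a b, E₁ (incl _ (tm a b)) = (Q.comul a).tensor (incl H b)) (a : H) (w : CTensor H H)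
    (x : CTensor (CTensor H H) H) :
    (((incl H a).tensor (1 : Multiplier H)).tensor (1 : Multiplier H)).L ((E₁ (incl _ w)).L x) =
      tmap (Q.rl a) LinearMap.id (Q.bddLin_rl a) BddLin.id w * x := by
  have h1 : ∀ p r, (((incl H a).tensor (1 : Multiplier H)).tensor (1 : Multiplier H)).L ∘ₗ
      (E₁ (incl _ (tm p r))).L = LinearMap.mul ℂ _ (tm (Q.rl a p) r) := fun p r =>
    BTensor.ext ((bddLin_L _).comp (bddLin_L _)) (bddLin_mulLeft _) fun u v => by
      simp [h, rl_mul]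
  have h2 : (((incl H a).tensor (1 : Multiplier H)).tensor (1 : Multiplier H)).L ∘ₗ
      evalL x ∘ₗ E₁ ∘ₗ incl (CTensor H H) = (LinearMap.mul ℂ _).flip x ∘ₗ
        tmap (Q.rl a) LinearMap.id (Q.bddLin_rl a) BddLin.id :=
    BTensor.ext ((bddLin_L _).comp (bddLin_extension hE x))
      ((bddLin_mulRight x).comp (bddLin_tmap _ _ _ _)) fun p r => by
        refine (LinearMap.congr_fun (h1 p r) x).trans ?_
        simp
  exact LinearMap.congr_fun h2 w

theorem extension_gl (hE : IsUnitalHom E₁)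
    (h : ∀ a b, E₁ (incl _ (tm a b)) = (Q.comul a).tensor (incl H b)) (a : H) (w : CTensor H H)
    (x : CTensor (CTensor H H) H) :
    (E₁ (incl _ w)).L ((((incl H a).tensor (1 : Multiplier H)).tensor (1 : Multiplier H)).L x) =
      tmap (Q.gl a) LinearMap.id (Q.bddLin_gl a) BddLin.id w * x := by
  have h1 : ∀ p r, (E₁ (incl _ (tm p r))).L ∘ₗ
      (((incl H a).tensor (1 : Multiplier H)).tensor (1 : Multiplier H)).L =
        LinearMap.mul ℂ _ (tm (Q.gl a p) r) := fun p r =>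
    BTensor.ext ((bddLin_L _).comp (bddLin_L _)) (bddLin_mulLeft _) fun u v => by
      simp [h, gl_mul]
  have h2 : evalL ((((incl H a).tensor (1 : Multiplier H)).tensor (1 : Multiplier H)).L x) ∘ₗ
      E₁ ∘ₗ incl (CTensor H H) = (LinearMap.mul ℂ _).flip x ∘ₗ
        tmap (Q.gl a) LinearMap.id (Q.bddLin_gl a) BddLin.id :=
    BTensor.ext (bddLin_extension hE _)
      ((bddLin_mulRight x).comp (bddLin_tmap _ _ _ _)) fun p r => by
        refine (LinearMap.congr_fun (h1 p r) x).trans ?_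
        simp
  exact LinearMap.congr_fun h2 w

theorem extension_rr (hE : IsUnitalHom E₂)
    (h : ∀ a b, E₂ (incl _ (tm a b)) = (incl H a).tensor (Q.comul b)) (a : H) (w : CTensor H H)
    (x : CTensor H (CTensor H H)) :
    ((1 : Multiplier H).tensor ((1 : Multiplier H).tensor (incl H a))).L ((E₂ (incl _ w)).L x) =
      tmap LinearMap.id (Q.rr a) BddLin.id (Q.bddLin_rr a) w * x := by
  have h1 : ∀ p r, ((1 : Multiplier H).tensor ((1 : Multiplier H).tensor (incl H a))).L ∘ₗ
      (E₂ (incl _ (tm p r))).L = LinearMap.mul ℂ _ (tm p (Q.rr a r)) := fun p r =>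
    BTensor.ext ((bddLin_L _).comp (bddLin_L _)) (bddLin_mulLeft _) fun u v => by
      simp [h, rr_mul]
  have h2 : ((1 : Multiplier H).tensor ((1 : Multiplier H).tensor (incl H a))).L ∘ₗ
      evalL x ∘ₗ E₂ ∘ₗ incl (CTensor H H) = (LinearMap.mul ℂ _).flip x ∘ₗ
        tmap LinearMap.id (Q.rr a) BddLin.id (Q.bddLin_rr a) :=
    BTensor.ext ((bddLin_L _).comp (bddLin_extension hE x))
      ((bddLin_mulRight x).comp (bddLin_tmap _ _ _ _)) fun p r => by
        refine (LinearMap.congr_fun (h1 p r) x).trans ?_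
        simp
  exact LinearMap.congr_fun h2 w

theorem extension_gr (hE : IsUnitalHom E₂)
    (h : ∀ a b, E₂ (incl _ (tm a b)) = (incl H a).tensor (Q.comul b)) (a : H) (w : CTensor H H)
    (x : CTensor H (CTensor H H)) :
    (E₂ (incl _ w)).L (((1 : Multiplier H).tensor ((1 : Multiplier H).tensor (incl H a))).L x) =
      tmap LinearMap.id (Q.gr a) BddLin.id (Q.bddLin_gr a) w * x := by
  have h1 : ∀ p r, (E₂ (incl _ (tm p r))).L ∘ₗ
      ((1 : Multiplier H).tensor ((1 : Multiplier H).tensor (incl H a))).L =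
        LinearMap.mul ℂ _ (tm p (Q.gr a r)) := fun p r =>
    BTensor.ext ((bddLin_L _).comp (bddLin_L _)) (bddLin_mulLeft _) fun u v => by
      simp [h, gr_mul]
  have h2 : evalL (((1 : Multiplier H).tensor ((1 : Multiplier H).tensor (incl H a))).L x) ∘ₗ
      E₂ ∘ₗ incl (CTensor H H) = (LinearMap.mul ℂ _).flip x ∘ₗ
        tmap LinearMap.id (Q.gr a) BddLin.id (Q.bddLin_gr a) :=
    BTensor.ext (bddLin_extension hE _)
      ((bddLin_mulRight x).comp (bddLin_tmap _ _ _ _)) fun p r => by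
        refine (LinearMap.congr_fun (h1 p r) x).trans ?_
        simp
  exact LinearMap.congr_fun h2 w

/-- Testing on the tensors `a ⊗ (b ⊗ c)` is enough, and these are values of `assocMap`; surjectivity
of `assocMap` is not needed. -/
theorem eq_of_mul_assoc_eq (Q : BornQuantumGroup H) {z w : CTensor H (CTensor H H)}
    (h : ∀ x, z * assocMap H H H x = w * assocMap H H H x) : z = w := by
  have := Q.nontrivial
  refine sub_eq_zero.1 (eq_zero_of_mul_tm Q.approximation Q.isSeparated Q.isNondegenerate
    Q.isSeparated_tensor Q.isNondegenerate_tensor _ fun a v => ?_)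
  rw [sub_mul, sub_eq_zero]
  have : LinearMap.mul ℂ _ z = LinearMap.mul ℂ _ w :=
    BTensor.ext_right (bddLin_mulLeft z) (bddLin_mulLeft w) fun a b c => by
      simpa using h (tm (tm a b) c)
  exact LinearMap.congr_fun this _

/-- Coassociativity `(a ⊗ 1 ⊗ 1) (Δ ⊗ id) (Δ(f) (1 ⊗ y)) = (id ⊗ Δ) ((a ⊗ 1) Δ(f)) (1 ⊗ 1 ⊗ y)`. -/
theorem assocMap_rl_gr (a f y : H) :
    assocMap H H H (tmap (Q.rl a) LinearMap.id (Q.bddLin_rl a) BddLin.id (Q.gr y f)) =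
      tmap LinearMap.id (Q.gr y) BddLin.id (Q.bddLin_gr y) (Q.rl a f) := by
  obtain ⟨E₁, E₂, hE₁, hE₂, h₁, h₂, hc⟩ := Q.isComultiplication.coassoc
  refine Q.eq_of_mul_assoc_eq fun x => ?_
  have e1 : E₁ (incl _ (Q.gr y f)) =
      E₁ (Q.comul f) * E₁ ((1 : Multiplier H).tensor (incl H y)) := by
    rw [← hE₁.map_mul, ← gammaR_tm, Q.galois.gammaR_tm]
  have e2 : E₂ (incl _ (Q.rl a f)) =
      E₂ ((incl H a).tensor (1 : Multiplier H)) * E₂ (Q.comul f) := by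
    rw [← hE₂.map_mul, ← rhoL_tm, Q.galois.rhoL_tm]
  -- Both sides become the action of `a ⊗ 1 ⊗ 1`, then an iterated coproduct of `f`, then `1 ⊗ 1 ⊗
  -- y`; only the bracketing of the middle factor differs.
  rw [← assocMap_mul, ← Q.extension_rl hE₁ h₁, ← Q.extension_gr hE₂ h₂, e1, e2, mul_L_apply,
    mul_L_apply, Q.extension_one_tensor hE₁ h₁, Q.extension_tensor_one hE₂ h₂,
    assocMap_tensor_left, ← assocMap_tensor_right]
  congr 1
  exact LinearMap.congr_fun (hc f).1 _

/-- Coassociativity `(1 ⊗ 1 ⊗ c) (Δ ⊗ id) Δ(f) (q ⊗ 1 ⊗ 1) = (1 ⊗ 1 ⊗ c) (id ⊗ Δ) Δ(f) (q ⊗ 1 ⊗ 1)`. -/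
theorem assocMap_gl_rr (q f c : H) :
    assocMap H H H (tmap (Q.gl q) LinearMap.id (Q.bddLin_gl q) BddLin.id (Q.rr c f)) =
      tmap LinearMap.id (Q.rr c) BddLin.id (Q.bddLin_rr c) (Q.gl q f) := by
  obtain ⟨E₁, E₂, hE₁, hE₂, h₁, h₂, hc⟩ := Q.isComultiplication.coassoc
  refine Q.eq_of_mul_assoc_eq fun x => ?_
  have e1 : E₁ (incl _ (Q.rr c f)) =
      E₁ ((1 : Multiplier H).tensor (incl H c)) * E₁ (Q.comul f) := by
    rw [← hE₁.map_mul, ← rhoR_tm, Q.galois.rhoR_tm]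
  have e2 : E₂ (incl _ (Q.gl q f)) =
      E₂ (Q.comul f) * E₂ ((incl H q).tensor (1 : Multiplier H)) := by
    rw [← hE₂.map_mul, ← gammaL_tm, Q.galois.gammaL_tm]
  rw [← assocMap_mul, ← Q.extension_gl hE₁ h₁, ← Q.extension_rr hE₂ h₂, e1, e2, mul_L_apply,
    mul_L_apply, Q.extension_one_tensor hE₁ h₁, Q.extension_tensor_one hE₂ h₂,
    ← assocMap_tensor_left, assocMap_tensor_right]
  congr 1
  exact LinearMap.congr_fun (hc f).1 _

end BornQuantumGroup

/-! ### Compatibility of slice maps with associativity and tensor products of maps. -/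

section Slices

variable {A B C D : Type u} [AddCommGroup A] [Module ℂ A] [Bornology A] [CompleteBornSpace A]
  [AddCommGroup B] [Module ℂ B] [Bornology B] [CompleteBornSpace B]
  [AddCommGroup C] [Module ℂ C] [Bornology C] [CompleteBornSpace C]
  [AddCommGroup D] [Module ℂ D] [Bornology D] [CompleteBornSpace D]

theorem sliceLeft_assocMap {ω : A →ₗ[ℂ] ℂ} (hω : BddLin ω) (w : CTensor (CTensor A B) C) :
    sliceLeft ω hω (assocMap A B C w) =
      tmap (sliceLeft ω hω) LinearMap.id (bddLin_sliceLeft hω) BddLin.id w := by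
  have : sliceLeft ω hω ∘ₗ assocMap A B C =
      tmap (sliceLeft ω hω) LinearMap.id (bddLin_sliceLeft hω) BddLin.id :=
    BTensor.ext_left ((bddLin_sliceLeft _).comp bddLin_assocMap) (bddLin_tmap _ _ _ _)
      fun a b c => by simp [tm]
  exact LinearMap.congr_fun this w

theorem sliceRight_eq_tmap_assocMap {ω : C →ₗ[ℂ] ℂ} (hω : BddLin ω)
    (w : CTensor (CTensor A B) C) :
    tmap LinearMap.id (sliceRight ω hω) BddLin.id (bddLin_sliceRight hω) (assocMap A B C w) =
      sliceRight ω hω w := by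
  have : tmap LinearMap.id (sliceRight ω hω) BddLin.id (bddLin_sliceRight hω) ∘ₗ
      assocMap A B C = sliceRight ω hω :=
    BTensor.ext_left ((bddLin_tmap _ _ _ _).comp bddLin_assocMap) (bddLin_sliceRight _)
      fun a b c => by simp [tm]
  exact LinearMap.congr_fun this w

theorem sliceLeft_tmap {ω : A →ₗ[ℂ] ℂ} (hω : BddLin ω) {g : B →ₗ[ℂ] C} (hg : BddLin g)
    (w : CTensor A B) :
    sliceLeft ω hω (tmap LinearMap.id g BddLin.id hg w) = g (sliceLeft ω hω w) := by
  have : sliceLeft ω hω ∘ₗ tmap LinearMap.id g BddLin.id hg = g ∘ₗ sliceLeft ω hω :=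
    BTensor.ext ((bddLin_sliceLeft _).comp (bddLin_tmap _ _ _ _))
      (hg.comp (bddLin_sliceLeft _)) fun a b => by simp
  exact LinearMap.congr_fun this w

theorem sliceRight_tmap {ω : B →ₗ[ℂ] ℂ} (hω : BddLin ω) {g : A →ₗ[ℂ] C} (hg : BddLin g)
    (w : CTensor A B) :
    sliceRight ω hω (tmap g LinearMap.id hg BddLin.id w) = g (sliceRight ω hω w) := by
  have : sliceRight ω hω ∘ₗ tmap g LinearMap.id hg BddLin.id = g ∘ₗ sliceRight ω hω :=
    BTensor.ext ((bddLin_sliceRight _).comp (bddLin_tmap _ _ _ _))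
      (hg.comp (bddLin_sliceRight _)) fun a b => by simp
  exact LinearMap.congr_fun this w

theorem tmap_tmap_left {f : B →ₗ[ℂ] C} (hf : BddLin f) {g : A →ₗ[ℂ] B} (hg : BddLin g)
    (w : CTensor A D) :
    tmap f LinearMap.id hf BddLin.id (tmap g LinearMap.id hg BddLin.id w) =
      tmap (f ∘ₗ g) (LinearMap.id : D →ₗ[ℂ] D) (hf.comp hg) BddLin.id w := by
  have : tmap f LinearMap.id hf BddLin.id ∘ₗ tmap g LinearMap.id hg BddLin.id =
      tmap (f ∘ₗ g) (LinearMap.id : D →ₗ[ℂ] D) (hf.comp hg) BddLin.id :=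
    BTensor.ext ((bddLin_tmap _ _ _ _).comp (bddLin_tmap _ _ _ _)) (bddLin_tmap _ _ _ _)
      fun a b => by simp
  exact LinearMap.congr_fun this w

theorem tmap_tmap_right {f : B →ₗ[ℂ] C} (hf : BddLin f) {g : A →ₗ[ℂ] B} (hg : BddLin g)
    (w : CTensor D A) :
    tmap LinearMap.id f BddLin.id hf (tmap LinearMap.id g BddLin.id hg w) =
      tmap (LinearMap.id : D →ₗ[ℂ] D) (f ∘ₗ g) BddLin.id (hf.comp hg) w := by
  have : tmap LinearMap.id f BddLin.id hf ∘ₗ tmap LinearMap.id g BddLin.id hg =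
      tmap (LinearMap.id : D →ₗ[ℂ] D) (f ∘ₗ g) BddLin.id (hf.comp hg) :=
    BTensor.ext ((bddLin_tmap _ _ _ _).comp (bddLin_tmap _ _ _ _)) (bddLin_tmap _ _ _ _)
      fun a b => by simp
  exact LinearMap.congr_fun this w

end Slices

/-! ### Slices and multiplication in one leg. -/

namespace Multiplier

variable {A B : Type u} [NonUnitalRing A] [Module ℂ A] [Bornology A] [BornAlgebra A]
  [NonUnitalRing B] [Module ℂ B] [Bornology B] [BornAlgebra B]

@[simp]
theorem tensor_R_tm (m : Multiplier A) (n : Multiplier B) (a : A) (b : B) :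
    (m.tensor n).R (tm a b) = tm (m.R a) (n.R b) :=
  tmap_tm _ _ m.bddLin_R n.bddLin_R _ _

@[simp]
theorem incl_R (a x : A) : (incl A a).R x = x * a := rfl

@[simp]
theorem one_R (x : A) : (1 : Multiplier A).R x = x := rfl

theorem sliceLeft_tensor_one_L {ω : A →ₗ[ℂ] ℂ} (hω : BddLin ω) (a : A) (z : CTensor A B) :
    sliceLeft ω hω (((incl A a).tensor (1 : Multiplier B)).L z) =
      sliceLeft (ω ∘ₗ LinearMap.mul ℂ A a) (hω.functional_comp (bddLin_mulLeft a)) z := by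
  have : sliceLeft ω hω ∘ₗ ((incl A a).tensor (1 : Multiplier B)).L =
      sliceLeft (ω ∘ₗ LinearMap.mul ℂ A a) (hω.functional_comp (bddLin_mulLeft a)) :=
    BTensor.ext ((bddLin_sliceLeft _).comp (bddLin_L _)) (bddLin_sliceLeft _)
      fun x y => by simp
  exact LinearMap.congr_fun this z

theorem sliceLeft_one_tensor_R {ω : A →ₗ[ℂ] ℂ} (hω : BddLin ω) (b : B) (z : CTensor A B) :
    sliceLeft ω hω (((1 : Multiplier A).tensor (incl B b)).R z) = sliceLeft ω hω z * b := by
  have : sliceLeft ω hω ∘ₗ ((1 : Multiplier A).tensor (incl B b)).R =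
      (LinearMap.mul ℂ B).flip b ∘ₗ sliceLeft ω hω :=
    BTensor.ext ((bddLin_sliceLeft _).comp (bddLin_R _))
      ((bddLin_mulRight _).comp (bddLin_sliceLeft _)) fun x y => by simp
  exact LinearMap.congr_fun this z

theorem sliceRight_tensor_one_R {ω : B →ₗ[ℂ] ℂ} (hω : BddLin ω) (a : A) (z : CTensor A B) :
    sliceRight ω hω (((incl A a).tensor (1 : Multiplier B)).R z) = sliceRight ω hω z * a := by
  have : sliceRight ω hω ∘ₗ ((incl A a).tensor (1 : Multiplier B)).R =
      (LinearMap.mul ℂ A).flip a ∘ₗ sliceRight ω hω :=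
    BTensor.ext ((bddLin_sliceRight _).comp (bddLin_R _))
      ((bddLin_mulRight _).comp (bddLin_sliceRight _)) fun x y => by simp
  exact LinearMap.congr_fun this z

end Multiplier

/-! ### Antipode and construction of a right invariant functional. -/

namespace BornQuantumGroup

open Multiplier

variable {H : Type u} [NonUnitalRing H] [Module ℂ H] [Bornology H] [BornAlgebra H]
  (Q : BornQuantumGroup H) {ω : H →ₗ[ℂ] ℂ}

/-- The map `f ↦ (ω ⊗ id) ((a ⊗ 1) Δ(f))`. -/
noncomputable def convL (a : H) (hω : BddLin ω) : H →ₗ[ℂ] H := sliceLeft ω hω ∘ₗ Q.rl a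

/-- The map `f ↦ (id ⊗ ω) ((1 ⊗ c) Δ(f))`. -/
noncomputable def convR (c : H) (hω : BddLin ω) : H →ₗ[ℂ] H := sliceRight ω hω ∘ₗ Q.rr c

theorem bddLin_convL (a : H) (hω : BddLin ω) : BddLin (Q.convL a hω) :=
  (bddLin_sliceLeft _).comp (Q.bddLin_rl a)

theorem bddLin_convR (c : H) (hω : BddLin ω) : BddLin (Q.convR c hω) :=
  (bddLin_sliceRight _).comp (Q.bddLin_rr c)

/-- Coassociativity with its first leg sliced off: convolution on the left commutes with the
comultiplication in the remaining legs. -/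
theorem tmap_convL_gr (a f y : H) (hω : BddLin ω) :
    tmap (Q.convL a hω) LinearMap.id (Q.bddLin_convL a hω) BddLin.id (Q.gr y f) =
      Q.gr y (Q.convL a hω f) := by
  have h := congrArg (sliceLeft ω hω) (Q.assocMap_rl_gr a f y)
  rw [sliceLeft_assocMap, tmap_tmap_left, sliceLeft_tmap] at h
  exact h

/-- Coassociativity with its third leg sliced off. -/
theorem gl_convR (q f c : H) (hω : BddLin ω) :
    Q.gl q (Q.convR c hω f) =
      tmap LinearMap.id (Q.convR c hω) BddLin.id (Q.bddLin_convR c hω) (Q.gl q f) := by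
  have h := congrArg (tmap LinearMap.id (sliceRight ω hω) BddLin.id (bddLin_sliceRight hω))
    (Q.assocMap_gl_rr q f c)
  rw [sliceRight_eq_tmap_assocMap, tmap_tmap_right, sliceRight_tmap] at h
  exact h

/-- Both sides are `(a ⊗ 1)Δ(f)(1 ⊗ y)`. -/
theorem tensor_one_L_gr (a y f : H) :
    ((incl H a).tensor (1 : Multiplier H)).L (Q.gr y f) =
      ((1 : Multiplier H).tensor (incl H y)).R (Q.rl a f) :=
  Q.eq_of_mul_eq fun u => by rw [← Multiplier.L_mul, gr_mul, ← Multiplier.mul_L, rl_mul]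

theorem tensor_one_R_gr (x y f : H) :
    ((incl H x).tensor (1 : Multiplier H)).R (Q.gr y f) = (Q.comul f).L (tm x y) :=
  Q.eq_of_mul_eq fun u => by
    rw [← Multiplier.mul_L, gr_mul, ← Multiplier.L_mul]
    congr 1
    have : ((1 : Multiplier H).tensor (incl H y)).L ∘ₗ
        ((incl H x).tensor (1 : Multiplier H)).L = LinearMap.mul ℂ _ (tm x y) :=
      BTensor.ext ((bddLin_L _).comp (bddLin_L _)) (bddLin_mulLeft _) fun a b => by simp
    exact LinearMap.congr_fun this u

theorem one_tensor_L_gl (c q g : H) :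
    ((1 : Multiplier H).tensor (incl H c)).L (Q.gl q g) =
      ((incl H q).tensor (1 : Multiplier H)).R (Q.rr c g) :=
  Q.eq_of_mul_eq fun u => by rw [← Multiplier.L_mul, gl_mul, ← Multiplier.mul_L, rr_mul]

/-- Elements of `H ⊗ H` are determined by the slices `(ω(a ·) ⊗ id)`. -/
theorem eq_of_slice_eq (Q : BornQuantumGroup H) {z w : CTensor H H}
    (h : ∀ (a : H) (ω : H →ₗ[ℂ] ℂ) (hω : BddLin ω),
      sliceLeft ω hω (((incl H a).tensor (1 : Multiplier H)).L z) =
        sliceLeft ω hω (((incl H a).tensor (1 : Multiplier H)).L w)) : z = w := by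
  have := Q.nontrivial
  rw [← sub_eq_zero]
  -- The functionals `φ(a ·)` with `φ` the Haar functional are among the test slices, and by
  -- faithfulness they detect the right slices.
  have h1 : ∀ (ω' : H →ₗ[ℂ] ℂ) (hω' : BddLin ω'), sliceRight ω' hω' (z - w) = 0 :=
    fun ω' hω' => Q.haar_faithful.right _ fun a => by
      have h2 := sliceLeft_sliceRight
        (Q.haar_faithful.bdd.functional_comp (bddLin_mulLeft a)) hω' (z - w)
      rw [← sliceLeft_tensor_one_L Q.haar_faithful.bdd, map_sub, map_sub, h, sub_self,
        map_zero] at h2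
      exact h2.symm
  refine eq_zero_of_sliceLeft Q.approximation _ fun ω hω => Q.isSeparated _ fun ω' hω' => ?_
  rw [sliceLeft_sliceRight hω hω', h1, map_zero]

theorem bddLin_haar (Q : BornQuantumGroup H) : BddLin Q.haar := Q.haar_leftInvariant.bdd

/-- The map `y ↦ (id ⊗ φ) (Δ(f) (1 ⊗ y))` for the left Haar functional `φ`. -/
noncomputable def haarConv (f : H) : H →ₗ[ℂ] H :=
  sliceRight Q.haar Q.bddLin_haar ∘ₗ Q.galois.gammaR.toLinearMap ∘ₗ BTensor.tmul ∅ f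

theorem bddLin_haarConv (f : H) : BddLin (Q.haarConv f) :=
  (bddLin_sliceRight _).comp
    (BddLin.comp Q.galois.gammaR_iso.1 (BTensor.bddBilin_tmul.left f))

theorem haarConv_apply (f y : H) :
    Q.haarConv f y = sliceRight Q.haar Q.bddLin_haar (Q.gr y f) := rfl

/-- The map `x ⊗ y ↦ (id ⊗ φ) (Δ(f) (1 ⊗ y)) ⊗ x`. -/
noncomputable def haarConvSwap (f : H) : CTensor H H →ₗ[ℂ] CTensor H H :=
  BTensor.lift ((BTensor.tmul ∅).compl₁₂ (Q.haarConv f) LinearMap.id).flip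
    (BTensor.bddBilin_tmul.compl (Q.bddLin_haarConv f) BddLin.id).flip (fun _ _ h => h.elim)

theorem bddLin_haarConvSwap (f : H) : BddLin (Q.haarConvSwap f) := BTensor.bddLin_lift _ _

@[simp]
theorem haarConvSwap_tm (f x y : H) : Q.haarConvSwap f (tm x y) = tm (Q.haarConv f y) x :=
  BTensor.lift_tmul _ _ _ _

/-- Both sides are `(ω ⊗ φ)((a ⊗ 1)Δ(f)(1 ⊗ y))` with `φ` the Haar functional. -/
theorem apply_mul_haarConv (a f y : H) (hω : BddLin ω) :
    ω (a * Q.haarConv f y) = Q.haar (Q.convL a hω f * y) := by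
  have := Q.nontrivial
  rw [haarConv_apply, convL, LinearMap.comp_apply, ← sliceLeft_one_tensor_R, ← tensor_one_L_gr,
    sliceLeft_tensor_one_L, sliceLeft_sliceRight _ Q.bddLin_haar]
  rfl

theorem convL_haarConv (a f y : H) (hω : BddLin ω) :
    Q.convL a hω (Q.haarConv f y) = Q.haarConv (Q.convL a hω f) y := by
  rw [haarConv_apply, haarConv_apply, ← tmap_convL_gr, sliceRight_tmap]

theorem sliceRight_haar_gl (f q : H) :
    sliceRight Q.haar Q.bddLin_haar (Q.gl q f) = Q.haar f • q := Q.haar_leftInvariant.left f q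

/-- In Sweedler notation the argument of `γ_r` is `f₁ φ(f₂g₂) ⊗ g₁q`, with image `f₁ ⊗ f₂g₁q
φ(f₃g₂)`; left invariance applied to `f₂g` turns this into `f₁ φ(f₂g) ⊗ q`. To stay within bounded
maps, the first leg is sliced by `ω(a ·)`, which replaces `f` by its left convolution. -/
theorem gammaR_haarConvSwap (f g q : H) :
    Q.galois.gammaR (Q.haarConvSwap f (Q.gl q g)) = tm (Q.haarConv f g) q := by
  refine Q.eq_of_slice_eq fun a ω hω => ?_
  have h : sliceLeft ω hω ∘ₗ ((incl H a).tensor (1 : Multiplier H)).L ∘ₗ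
      Q.galois.gammaR.toLinearMap ∘ₗ Q.haarConvSwap f =
        sliceRight Q.haar Q.bddLin_haar ∘ₗ (Q.comul (Q.convL a hω f)).L := by
    refine BTensor.ext ((bddLin_sliceLeft _).comp ((bddLin_L _).comp
      (BddLin.comp Q.galois.gammaR_iso.1 (Q.bddLin_haarConvSwap f))))
      ((bddLin_sliceRight _).comp (bddLin_L _)) fun x y => ?_
    simp only [LinearMap.comp_apply, LinearEquiv.coe_coe, haarConvSwap_tm, gammaR_tm]
    rw [tensor_one_L_gr, sliceLeft_one_tensor_R, ← tensor_one_R_gr, sliceRight_tensor_one_R,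
      ← haarConv_apply, ← convL_haarConv]
    rfl
  refine (LinearMap.congr_fun h (Q.gl q g)).trans ?_
  rw [LinearMap.comp_apply, ← gl_mul_left, sliceRight_haar_gl, tensor_L_tm, sliceLeft_tm,
    incl_L, one_L, Q.apply_mul_haarConv]

theorem gammaR_symm_tm_haarConv (f g q : H) :
    Q.galois.gammaR.symm (tm (Q.haarConv f g) q) = Q.haarConvSwap f (Q.gl q g) := by
  rw [← gammaR_haarConvSwap, LinearEquiv.symm_apply_apply]

/-- With `f' = ω(a f₁) f₂`, both sides are `g₁q φ(f'g₂)`. -/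
theorem slice_haarConvSwap_gl (a f g q : H) (hω : BddLin ω) :
    sliceLeft ω hω (((incl H a).tensor (1 : Multiplier H)).L (Q.haarConvSwap f (Q.gl q g))) =
      Q.convR (Q.convL a hω f) Q.bddLin_haar g * q := by
  have h : sliceLeft ω hω ∘ₗ ((incl H a).tensor (1 : Multiplier H)).L ∘ₗ Q.haarConvSwap f =
      sliceRight Q.haar Q.bddLin_haar ∘ₗ
        ((1 : Multiplier H).tensor (incl H (Q.convL a hω f))).L := by
    refine BTensor.ext ((bddLin_sliceLeft _).comp ((bddLin_L _).comp (Q.bddLin_haarConvSwap f)))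
      ((bddLin_sliceRight _).comp (bddLin_L _)) fun x y => ?_
    simp [Q.apply_mul_haarConv a f y hω]
  refine (LinearMap.congr_fun h (Q.gl q g)).trans ?_
  rw [LinearMap.comp_apply, one_tensor_L_gl, sliceRight_tensor_one_R]
  rfl

/-- The map `f ⊗ g ↦ (id ⊗ φ) ((1 ⊗ f) Δ(g))` precomposed with the inverse of `γ_r`. -/
noncomputable def preAntipode : CTensor H H →ₗ[ℂ] H :=
  sliceRight Q.haar Q.bddLin_haar ∘ₗ Q.galois.rhoR.toLinearMap ∘ₗ
    Q.galois.gammaR.symm.toLinearMap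

theorem bddLin_preAntipode : BddLin Q.preAntipode :=
  (bddLin_sliceRight _).comp (BddLin.comp Q.galois.rhoR_iso.1 Q.galois.gammaR_iso.2)

/-- This is the formula expected of `S ⊗ φ`, with `S` the antipode and `φ` the Haar functional. -/
theorem preAntipode_gr (f g : H) : Q.preAntipode (Q.gr g f) = Q.convR f Q.bddLin_haar g := by
  rw [← gammaR_tm]
  simp only [preAntipode, LinearMap.comp_apply, LinearEquiv.coe_coe,
    LinearEquiv.symm_apply_apply]
  rfl

/-- The point is that `b` enters only through its Haar value. As `γ_r` is onto, `p ⊗ b` may be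
replaced by `γ_r(f ⊗ g)`; there the left side is computed by `tmap_convL_gr` and `preAntipode_gr`,
and the right side by the explicit inverse of `γ_r`. -/
theorem preAntipode_convL_mul (a p b q : H) (hω : BddLin ω) :
    Q.preAntipode (tm (Q.convL a hω p) b) * q = Q.haar b •
      sliceLeft ω hω (((incl H a).tensor (1 : Multiplier H)).L
        (Q.galois.gammaR.symm (tm p q))) := by
  let T : CTensor H H →ₗ[ℂ] CTensor H H :=
    tmap (Q.convL a hω) LinearMap.id (Q.bddLin_convL a hω) BddLin.id
  have hT : BddLin T := bddLin_tmap _ _ _ _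
  let F : H →ₗ[ℂ] CTensor H H := Q.galois.gammaR.symm.toLinearMap ∘ₗ (BTensor.tmul ∅).flip q
  have hF : BddLin F := BddLin.comp Q.galois.gammaR_iso.2 (BTensor.bddBilin_tmul.right q)
  let N : CTensor H H →ₗ[ℂ] H := sliceLeft ω hω ∘ₗ ((incl H a).tensor (1 : Multiplier H)).L
  have hN : BddLin N := (bddLin_sliceLeft hω).comp (bddLin_L _)
  have h : ((LinearMap.mul ℂ H).flip q ∘ₗ Q.preAntipode ∘ₗ T) ∘ₗ Q.galois.gammaR.toLinearMap =
      (N ∘ₗ F ∘ₗ sliceRight Q.haar Q.bddLin_haar) ∘ₗ Q.galois.gammaR.toLinearMap := by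
    refine BTensor.ext (BddLin.comp ((bddLin_mulRight q).comp (Q.bddLin_preAntipode.comp hT))
      Q.galois.gammaR_iso.1) (BddLin.comp (hN.comp (hF.comp (bddLin_sliceRight _)))
        Q.galois.gammaR_iso.1) fun f g => ?_
    change Q.preAntipode (T (Q.gr g f)) * q =
      N (Q.galois.gammaR.symm (tm (Q.haarConv f g) q))
    rw [gammaR_symm_tm_haarConv, Q.tmap_convL_gr, preAntipode_gr]
    exact (Q.slice_haarConvSwap_gl a f g q hω).symm
  have h' := LinearMap.congr_fun ((LinearMap.cancel_right Q.galois.gammaR.surjective).1 h) (tm p b)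
  have h1 : T (tm p b) = tm (Q.convL a hω p) b := tmap_tm _ _ _ _ _ _
  have h2 : F (sliceRight Q.haar Q.bddLin_haar (tm p b)) = Q.haar b • F p := by
    rw [sliceRight_tm, map_smul]
  change Q.preAntipode (T (tm p b)) * q =
    N (F (sliceRight Q.haar Q.bddLin_haar (tm p b))) at h'
  rw [h1, h2, map_smul] at h'
  exact h'

theorem preAntipode_tm (v b : H) {b₀ : H} (hb₀ : Q.haar b₀ = 1) :
    Q.preAntipode (tm v b) = Q.haar b • Q.preAntipode (tm v b₀) := by
  have hT : ∀ b, BddLin (Q.preAntipode ∘ₗ (BTensor.tmul ∅).flip b ∘ₗ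
      sliceLeft Q.haar Q.bddLin_haar ∘ₗ Q.galois.rhoL.toLinearMap) := fun b =>
    Q.bddLin_preAntipode.comp ((BTensor.bddBilin_tmul.right b).comp
      ((bddLin_sliceLeft _).comp Q.galois.rhoL_iso.1))
  have h := BTensor.ext (hT b) ((hT b₀).smul (Q.haar b)) fun a p => by
    change Q.preAntipode (tm (Q.convL a Q.bddLin_haar p) b) =
      Q.haar b • Q.preAntipode (tm (Q.convL a Q.bddLin_haar p) b₀)
    refine sub_eq_zero.1 (Q.isNondegenerate _ fun q => ?_)
    rw [sub_mul, smul_mul_assoc, preAntipode_convL_mul, preAntipode_convL_mul, hb₀, one_smul,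
      sub_self]
  -- Left convolutions exhaust `H`: the left Haar slice of `ρ_l(ρ_l⁻¹(b₀ ⊗ v)) = b₀ ⊗ v` is `v`.
  have h' := LinearMap.congr_fun h (Q.galois.rhoL.symm (tm b₀ v))
  simpa [hb₀] using h'

/-- A quantum group has a nonzero right invariant functional. -/
theorem exists_rightInvariant : ∃ (ψ : H →ₗ[ℂ] ℂ) (hψ : BddLin ψ), ψ ≠ 0 ∧
    ∀ f g, sliceLeft ψ hψ (Q.gr g f) = ψ f • g := by
  have := Q.nontrivial
  obtain ⟨b₀, hb₀⟩ := Q.haar_faithful.exists_eq_one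
  -- This plays the role of the antipode; by `preAntipode_tm`, `Q.preAntipode` is `S` after the Haar
  -- slice.
  let S : H →ₗ[ℂ] H := Q.preAntipode ∘ₗ (BTensor.tmul ∅).flip b₀
  have hS : BddLin S := Q.bddLin_preAntipode.comp (BTensor.bddBilin_tmul.right b₀)
  have hS' : ∀ w, Q.preAntipode w = S (sliceRight Q.haar Q.bddLin_haar w) := fun w => by
    have : Q.preAntipode = S ∘ₗ sliceRight Q.haar Q.bddLin_haar :=
      BTensor.ext Q.bddLin_preAntipode (hS.comp (bddLin_sliceRight _)) fun v b => by
        rw [Q.preAntipode_tm v b hb₀]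
        simp [S]
    exact LinearMap.congr_fun this w
  have hconv : ∀ f g, Q.convR f Q.bddLin_haar g = S (Q.haarConv f g) := fun f g => by
    rw [← preAntipode_gr, hS', haarConv_apply]
  let ψ : H →ₗ[ℂ] ℂ := Q.haar ∘ₗ S
  have hψ : BddLin ψ := Q.bddLin_haar.functional_comp hS
  -- By the formula for `γ_r⁻¹`, the right side is the Haar slice of `Δ(g)(q ⊗ 1)` with the right
  -- convolution by `f` applied to the second leg. `gl_convR` moves the convolution inside `Δ`, and
  -- left invariance finishes.
  have h1 : ∀ f g q, ψ (Q.haarConv f g) • q =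
      sliceLeft ψ hψ (Q.galois.gammaR.symm (tm (Q.haarConv f g) q)) := fun f g q => by
    have h2 : sliceLeft ψ hψ ∘ₗ Q.haarConvSwap f = sliceRight Q.haar Q.bddLin_haar ∘ₗ
        tmap LinearMap.id (Q.convR f Q.bddLin_haar) BddLin.id (Q.bddLin_convR f Q.bddLin_haar) :=
      BTensor.ext ((bddLin_sliceLeft _).comp (Q.bddLin_haarConvSwap f))
        ((bddLin_sliceRight _).comp (bddLin_tmap _ _ _ _)) fun x y => by
          simp [hconv, ψ]
    rw [gammaR_symm_tm_haarConv]
    refine Eq.trans ?_ (LinearMap.congr_fun h2 (Q.gl q g)).symm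
    change Q.haar (S (Q.haarConv f g)) • q = sliceRight Q.haar Q.bddLin_haar
      (tmap LinearMap.id (Q.convR f Q.bddLin_haar) BddLin.id _ (Q.gl q g))
    rw [← gl_convR, sliceRight_haar_gl, hconv]
  -- Both sides are bounded and linear in `p`, and every `p` is the Haar slice of `γ_r(γ_r⁻¹(p ⊗
  -- b₀))`.
  have h3 : ∀ p q, ψ p • q = sliceLeft ψ hψ (Q.galois.gammaR.symm (tm p q)) := fun p q => by
    have h4 : (ψ.smulRight q) ∘ₗ sliceRight Q.haar Q.bddLin_haar ∘ₗ
        Q.galois.gammaR.toLinearMap =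
        (sliceLeft ψ hψ ∘ₗ Q.galois.gammaR.symm.toLinearMap ∘ₗ (BTensor.tmul ∅).flip q) ∘ₗ
          sliceRight Q.haar Q.bddLin_haar ∘ₗ Q.galois.gammaR.toLinearMap :=
      BTensor.ext ((bddLin_smulRight hψ q).comp ((bddLin_sliceRight _).comp
        Q.galois.gammaR_iso.1)) (((bddLin_sliceLeft _).comp (BddLin.comp Q.galois.gammaR_iso.2
          (BTensor.bddBilin_tmul.right q))).comp ((bddLin_sliceRight _).comp
            Q.galois.gammaR_iso.1)) fun f g => h1 f g q
    have h5 := LinearMap.congr_fun h4 (Q.galois.gammaR.symm (tm p b₀))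
    simpa [hb₀] using h5
  refine ⟨ψ, hψ, fun h0 => ?_, fun f g => ?_⟩
  -- If `ψ` vanished, so would `(φ ⊗ φ)ρ_r` for the Haar functional `φ`; but `ρ_r` is onto and `(φ ⊗
  -- φ)(b₀ ⊗ b₀) = 1`.
  · have h6 : Q.haar ∘ₗ sliceRight Q.haar Q.bddLin_haar ∘ₗ Q.galois.rhoR.toLinearMap = 0 :=
      BTensor.functional_ext (Q.bddLin_haar.functional_comp
        ((bddLin_sliceRight _).comp Q.galois.rhoR_iso.1)) bddLin_zero fun f g => by
          change Q.haar (Q.convR f Q.bddLin_haar g) = 0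
          rw [hconv]
          exact LinearMap.congr_fun h0 _
    have h7 := LinearMap.congr_fun h6 (Q.galois.rhoR.symm (tm b₀ b₀))
    simp [hb₀] at h7
  -- Invariance of `ψ ⊗ id` under `γ_r⁻¹` is equivalent to invariance under `γ_r`.
  · have h8 : sliceLeft ψ hψ = sliceLeft ψ hψ ∘ₗ Q.galois.gammaR.symm.toLinearMap :=
      BTensor.ext (bddLin_sliceLeft _) ((bddLin_sliceLeft _).comp Q.galois.gammaR_iso.2)
        fun p q => by
          rw [sliceLeft_tm]
          exact h3 p q
    rw [h8, ← gammaR_tm]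
    simp

end BornQuantumGroup

end BornQG

/-! ### The main theorem. -/

theorem mainTheorem7 {H : Type u} [NonUnitalRing H] [Module ℂ H] [Bornology H]
    [BornQG.BornAlgebra H] (Q : BornQG.BornQuantumGroup H) :
    (∀ φ' : H →ₗ[ℂ] ℂ, BornQG.IsLeftInvariant Q.galois φ' →
      ∃ c : ℂ, φ' = c • Q.haar ∧ (BornQG.IsFaithful φ' → c ≠ 0)) ∧
    (∀ φ ψ : H →ₗ[ℂ] ℂ, BornQG.IsFaithful φ → BornQG.IsLeftInvariant Q.galois φ →
      BornQG.IsFaithful ψ → BornQG.IsRightInvariant Q.galois ψ →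
      ∃ ν : H ≃ₗ[ℂ] H, BornQG.IsBornIso ν ∧ ∀ f h, ψ (h * f) = φ (h * ν f)) := by
  refine ⟨fun φ' hφ' => ?_, fun φ ψ hφ hφl hψ hψr => Q.exists_modular_iso hφ hφl hψ hψr⟩
  obtain ⟨ψ, hψ, h0, h⟩ := Q.exists_rightInvariant
  obtain ⟨c, hc⟩ := Q.eq_smul_haar_of_rightInvariant hψ h0 h hφ'
  refine ⟨c, hc, fun hf hc0 => ?_⟩
  have := Q.nontrivial
  -- A faithful functional on a nonzero algebra takes the value `1`, which rules out `c = 0`.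
  obtain ⟨g, hg⟩ := hf.exists_eq_one
  simp [hc, hc0] at hg
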